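/- Let $M$ be a compact smooth manifold with boundary $\partial M$, equipped with a collar, i.e. a diffeomorphism from $\partial M\times[0,1)$ onto an open subset of $M$ which is the inclusion on $\partial M\times\{0\}$; we regard $\partial M\times[0,1)$ as a subset of $M$. Write $t$ for the coordinate on $[0,1)$. For a closed manifold $N$ let $\mathcal R^+(N)$ be the space of smooth Riemannian metrics of positive scalar curvature (psc metrics) on $N$, with the $C^\infty$-topology. For $c\in(0,1)$ let $\mathcal R^+(M)^c$ be the space of all psc metrics $h$ on $M$ such that $h=g+dt^2$ on $\partial M\times[0,c]$ for some Riemannian metric $g$ on $\partial M$, with the $C^\infty$-topology. For $b>c$ one has $\mathcal R^+(M)^b\subset\mathcal R^+(M)^c$; let $\mathcal R^+(M)=\operatorname{colim}_{c\to0}\mathcal R^+(M)^c$, i.e. the union of all $\mathcal R^+(M)^c$ with the colimit topology. Then for every $h\in\mathcal R^+(M)$ there is a unique Riemannian metric $\mathrm{res}(h)$ on $\partial M$ such that $h=\mathrm{res}(h)+dt^2$ on $\partial M\times[0,c]$ for some $c\in(0,1)$; it has positive scalar curvature, and the restriction map $$\mathrm{res}\colon\mathcal R^+(M)\to\mathcal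 R^+(\partial M),\qquad h\mapsto \mathrm{res}(h),$$ is a Serre fibration: it is continuous and has the homotopy lifting property with respect to all discs $D^n$, $n\ge0$. -/

import Mathlib

open Set Filter Topology
open scoped Manifold ContDiff Bundle UniformConvergence

noncomputable section

namespace PSC

/-! ### Scalar curvature in coordinates

`G : E → E → E → ℝ` is the coordinate expression of a Riemannian metric on a subset of the
finite-dimensional vector space `E` with basis `b`: `G y u v` is the inner product of the vectors
`u` and `v` at the point `y`. Derivatives are taken within a set `s` (the range of the model with
corners), so that everything makes sense up to the boundary. -/

section Coordinates

variable {E : Type*} [NormedAddCommGroup E] [NormedSpace ℝ E] {ι : Type*} [Fintype ι]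
  [DecidableEq ι]

/-- The inverse `g^{ij}` of the matrix `g_{ij} = G(b i, b j)`. -/
def inverseGram (b : Module.Basis ι ℝ E) (G : E → E → E → ℝ) (y : E) : Matrix ι ι ℝ :=
  (Matrix.of fun i j => G y (b i) (b j))⁻¹

/-- The Christoffel symbols of the first kind:
`1/2 * (∂_u G(v, w) + ∂_v G(u, w) - ∂_w G(u, v))`. -/
def christoffelFirst (G : E → E → E → ℝ) (s : Set E) (y u v w : E) : ℝ :=
  1 / 2 * (fderivWithin ℝ (fun z => G z v w) s y u + fderivWithin ℝ (fun z => G z u w) s y v -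
    fderivWithin ℝ (fun z => G z u v) s y w)

/-- The Christoffel symbols `Γ(u, v) = ∑_{k, l} g^{kl} * christoffelFirst(u, v, b l) • b k`. -/
def christoffel (b : Module.Basis ι ℝ E) (G : E → E → E → ℝ) (s : Set E) (y u v : E) : E :=
  ∑ k, ∑ l, (inverseGram b G y k l * christoffelFirst G s y u v (b l)) • b k

/-- The curvature tensor
`R(u, v) w = ∂_u (Γ(v, w)) - ∂_v (Γ(u, w)) + Γ(u, Γ(v, w)) - Γ(v, Γ(u, w))`. -/
def curvature (b : Module.Basis ι ℝ E) (G : E → E → E → ℝ) (s : Set E) (y u v w : E) : E :=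
  fderivWithin ℝ (fun z => christoffel b G s z v w) s y u -
    fderivWithin ℝ (fun z => christoffel b G s z u w) s y v +
    christoffel b G s y u (christoffel b G s y v w) -
    christoffel b G s y v (christoffel b G s y u w)

/-- The Ricci tensor `Ric(v, w) = trace (u ↦ R(u, v) w)`. -/
def ricci (b : Module.Basis ι ℝ E) (G : E → E → E → ℝ) (s : Set E) (y v w : E) : ℝ :=
  ∑ k, b.repr (curvature b G s y (b k) v w) k

/-- The scalar curvature `∑_{j, l} g^{jl} Ric(b j, b l)`. -/
def scalarCurvatureCoord (b : Module.Basis ι ℝ E) (G : E → E → E → ℝ) (s : Set E) (y : E) : ℝ :=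
  ∑ j, ∑ l, inverseGram b G y j l * ricci b G s y (b j) (b l)

end Coordinates

/-! ### Riemannian metrics on a manifold, their scalar curvature and the `C^∞` topology -/

section Metrics

variable {E : Type*} [NormedAddCommGroup E] [NormedSpace ℝ E] [FiniteDimensional ℝ E]
  {H : Type*} [TopologicalSpace H] (I : ModelWithCorners ℝ E H)
  (M : Type*) [TopologicalSpace M] [ChartedSpace H M] [IsManifold I ∞ M]

/-- Smooth Riemannian metrics on `M` (Mathlib's notion, for the tangent bundle). -/
abbrev RiemMetric : Type _ :=
  Bundle.ContMDiffRiemannianMetric I ∞ E (fun x : M => TangentSpace I x)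

variable {I M}

/-- The expression of a Riemannian metric in a chart `e`: the pullback of the metric to (a subset
of) the model vector space `E` under the inverse of the chart. It is meaningful on
`(e.extend I).target`. -/
def localMetric (e : OpenPartialHomeomorph M H) (h : RiemMetric I M) (y u v : E) : ℝ :=
  h.inner ((e.extend I).symm y) (mfderivWithin 𝓘(ℝ, E) I (e.extend I).symm (range I) y u)
    (mfderivWithin 𝓘(ℝ, E) I (e.extend I).symm (range I) y v)

/-- The scalar curvature of a Riemannian metric at a point, computed in the preferred chart. -/
def scal (h : RiemMetric I M) (x : M) : ℝ :=
  scalarCurvatureCoord (Module.finBasis ℝ E) (localMetric (chartAt H x) h) (range I)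
    (extChartAt I x x)

/-- The `C^∞` topology on the space of smooth Riemannian metrics: the topology of uniform
convergence, on compact subsets of every chart domain, of the components `h(u, v)` of the metric in
the chart (`u, v` constant vector fields), together with all their partial derivatives. -/
instance instTopologicalSpaceRiemMetric : TopologicalSpace (RiemMetric I M) :=
  ⨅ (e : IsManifold.maximalAtlas I ∞ M) (u : E) (v : E) (k : ℕ),
    TopologicalSpace.induced
      (fun h => UniformOnFun.ofFun {K : Set E | IsCompact K ∧ K ⊆ (e.1.extend I).target}
        (iteratedFDerivWithin ℝ k (fun y => localMetric e.1 h y u v) (range I)))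
      inferInstance

variable (I M) in
/-- The set of metrics of positive scalar curvature. As a subtype, with the subspace topology, it is
the space `ℛ⁺(M)` when `M` is a closed manifold. -/
def pscMetrics : Set (RiemMetric I M) := {h | ∀ x, 0 < scal h x}

end Metrics

/-! ### Collars and the space of metrics which are cylindrical near the boundary -/

section Collar

variable {E : Type*} [NormedAddCommGroup E] [NormedSpace ℝ E] [FiniteDimensional ℝ E]
  {H : Type*} [TopologicalSpace H] (I : ModelWithCorners ℝ E H)
  {E' : Type*} [NormedAddCommGroup E'] [NormedSpace ℝ E'] [FiniteDimensional ℝ E']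
  {H' : Type*} [TopologicalSpace H'] (J : ModelWithCorners ℝ E' H')
  (M : Type*) [TopologicalSpace M] [ChartedSpace H M] [IsManifold I ∞ M]
  (N : Type*) [TopologicalSpace N] [ChartedSpace H' N] [IsManifold J ∞ N]

/-- A collar of `∂M`, where `N` is the manifold `∂M`: a diffeomorphism from `N × [0, 1)` onto an
open subset of `M` which identifies `N × {0}` with the boundary of `M`. -/
structure Collar where
  /-- The collar, as a bijection between subsets of `N × ℝ` and of `M`. -/
  toPartialEquiv : PartialEquiv (N × ℝ) M
  source_eq : toPartialEquiv.source = univ ×ˢ Ico 0 1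
  isOpen_target : IsOpen toPartialEquiv.target
  contMDiffOn : ContMDiffOn (J.prod 𝓘(ℝ, ℝ)) I ∞ toPartialEquiv toPartialEquiv.source
  contMDiffOn_symm : ContMDiffOn I (J.prod 𝓘(ℝ, ℝ)) ∞ toPartialEquiv.symm toPartialEquiv.target
  range_zero : range (fun x : N => toPartialEquiv (x, 0)) = I.boundary M

variable {I J M N}

/-- The derivative of the collar at the point `(x, t)` of `N × [0, 1)`, on `T_x N × ℝ`. -/
def Collar.deriv (φ : Collar I J M N) (x : N) (t : ℝ) :
    E' × ℝ →L[ℝ] TangentSpace I (φ.toPartialEquiv (x, t)) :=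
  mfderivWithin (J.prod 𝓘(ℝ, ℝ)) I φ.toPartialEquiv (univ ×ˢ Ico 0 1) (x, t)

/-- `h = g + dt²` on `∂M × [0, c]`, with respect to the collar. -/
def IsCylindricalOn (φ : Collar I J M N) (c : ℝ) (h : RiemMetric I M) (g : RiemMetric J N) : Prop :=
  ∀ (x : N), ∀ t ∈ Icc 0 c, ∀ (v w : TangentSpace J x) (a b : ℝ),
    h.inner (φ.toPartialEquiv (x, t)) (φ.deriv x t (v, a)) (φ.deriv x t (w, b)) =
      g.inner x v w + a * b

/-- The set `ℛ⁺(M)^c` of metrics of positive scalar curvature on `M` which are of the form `g + dt²`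
on `∂M × [0, c]`, for some metric `g` on `∂M`. As a subtype it has the `C^∞` topology. -/
def pscMetricsCyl (φ : Collar I J M N) (c : ℝ) : Set (RiemMetric I M) :=
  {h | h ∈ pscMetrics I M ∧ ∃ g : RiemMetric J N, IsCylindricalOn φ c h g}

/-- The underlying set of `ℛ⁺(M) = colim_{c → 0} ℛ⁺(M)^c`, the union of all `ℛ⁺(M)^c` with
`0 < c < 1`. -/
def PSCMetricsCollared (φ : Collar I J M N) : Type _ :=
  ↥(⋃ c : Ioo (0 : ℝ) 1, pscMetricsCyl φ c)

/-- The inclusion of `ℛ⁺(M)^c` in `ℛ⁺(M)`. -/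
def PSCMetricsCollared.incl (φ : Collar I J M N) (c : Ioo (0 : ℝ) 1) :
    pscMetricsCyl φ c → PSCMetricsCollared φ :=
  Set.inclusion (Set.subset_iUnion (fun c : Ioo (0 : ℝ) 1 => pscMetricsCyl φ c) c)

/-- The colimit topology on `ℛ⁺(M)`: the finest topology for which all the inclusions of the
`ℛ⁺(M)^c` are continuous. -/
instance (φ : Collar I J M N) : TopologicalSpace (PSCMetricsCollared φ) :=
  ⨆ c : Ioo (0 : ℝ) 1, TopologicalSpace.coinduced (PSCMetricsCollared.incl φ c) inferInstance

/-- The metric on `M` underlying a point of `ℛ⁺(M)`. -/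
def PSCMetricsCollared.metric {φ : Collar I J M N} (h : PSCMetricsCollared φ) : RiemMetric I M :=
  Subtype.val h

end Collar

/-! ### Serre fibrations -/

/-- A Serre fibration: a continuous map with the homotopy lifting property with respect to all
closed discs `D^n`, `n ≥ 0`. -/
def IsSerreFibration {X B : Type*} [TopologicalSpace X] [TopologicalSpace B] (p : X → B) : Prop :=
  Continuous p ∧
    ∀ (n : ℕ) (F : C(Metric.closedBall (0 : EuclideanSpace ℝ (Fin n)) 1, X))
      (G : C(Metric.closedBall (0 : EuclideanSpace ℝ (Fin n)) 1 × unitInterval, B)),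
      (∀ z, p (F z) = G (z, 0)) →
      ∃ K : C(Metric.closedBall (0 : EuclideanSpace ℝ (Fin n)) 1 × unitInterval, X),
        (∀ z, K (z, 0) = F z) ∧ ∀ z, p (K z) = G z

end PSC

end

noncomputable section

namespace PSC

section Families

variable {X : Type*} [TopologicalSpace X] {E : Type*} [NormedAddCommGroup E] [NormedSpace ℝ E]

/-- A family `f x` of real functions on `s ⊆ E` all of whose iterated directional derivatives of
order at most `k` exist and are jointly continuous in the parameter and the point. -/
def FamC (s : Set E) : ℕ → (X → E → ℝ) → Prop
  | 0, f => ContinuousOn (fun q : X × E => f q.1 q.2) (univ ×ˢ s)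
  | k + 1, f => ContinuousOn (fun q : X × E => f q.1 q.2) (univ ×ˢ s) ∧
      (∀ x, DifferentiableOn ℝ (f x) s) ∧
      ∀ u, FamC s k (fun x y => fderivWithin ℝ (f x) s y u)

namespace FamC

variable {s t : Set E} {k : ℕ} {f g : X → E → ℝ}

theorem continuousOn (h : FamC s k f) :
    ContinuousOn (fun q : X × E => f q.1 q.2) (univ ×ˢ s) := by
  cases k with
  | zero => exact h
  | succ k => exact h.1

theorem congr (h : FamC s k f) (hfg : ∀ x, EqOn (g x) (f x) s) : FamC s k g := by
  induction k generalizing f g with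
  | zero => exact ContinuousOn.congr h fun q hq => hfg q.1 hq.2
  | succ k ih =>
    refine ⟨h.1.congr fun q hq => hfg q.1 hq.2, fun x => (h.2.1 x).congr (hfg x), fun u => ?_⟩
    exact ih (h.2.2 u) fun x y hy => by
      simp only [fderivWithin_congr (hfg x) (hfg x hy)]

theorem of_succ (h : FamC s (k + 1) f) : FamC s k f := by
  induction k generalizing f with
  | zero => exact h.1
  | succ k ih => exact ⟨h.1, h.2.1, fun u => ih (h.2.2 u)⟩

theorem inter {U : Set E} (hU : IsOpen U) (h : FamC s k f) : FamC (s ∩ U) k f := by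
  induction k generalizing f with
  | zero => exact ContinuousOn.mono h (prod_mono_right inter_subset_left)
  | succ k ih =>
    refine ⟨h.1.mono (prod_mono_right inter_subset_left),
      fun x => (h.2.1 x).mono inter_subset_left, fun u => ?_⟩
    exact (ih (h.2.2 u)).congr fun x y hy => by
      simp only [fderivWithin_inter (hU.mem_nhds hy.2)]

theorem of_local (h : ∀ y ∈ s, ∃ U, IsOpen U ∧ y ∈ U ∧ FamC (s ∩ U) k f) : FamC s k f := by
  have hc : ContinuousOn (fun q : X × E => f q.1 q.2) (univ ×ˢ s) := by
    intro q hq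
    obtain ⟨U, hU, hy, hf⟩ := h q.2 hq.2
    have := hf.continuousOn q ⟨trivial, hq.2, hy⟩
    refine this.mono_of_mem_nhdsWithin ?_
    have h2 : (univ : Set X) ×ˢ (s ∩ U) = (univ ×ˢ s) ∩ (Prod.snd ⁻¹' U) := by
      ext; simp
    rw [h2]
    exact inter_mem self_mem_nhdsWithin
      (mem_nhdsWithin_of_mem_nhds ((hU.preimage continuous_snd).mem_nhds hy))
  induction k generalizing f with
  | zero => exact hc
  | succ k ih =>
    refine ⟨hc, fun x y hy => ?_, fun u => ?_⟩
    · obtain ⟨U, hU, hyU, hf⟩ := h y hy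
      exact (hf.2.1 x y ⟨hy, hyU⟩).mono_of_mem_nhdsWithin
        (inter_mem self_mem_nhdsWithin (mem_nhdsWithin_of_mem_nhds (hU.mem_nhds hyU)))
    · have key : ∀ y ∈ s, ∃ U, IsOpen U ∧ y ∈ U ∧
          FamC (s ∩ U) k (fun x y => fderivWithin ℝ (f x) s y u) := fun y hy => by
        obtain ⟨U, hU, hyU, hf⟩ := h y hy
        refine ⟨U, hU, hyU, (hf.2.2 u).congr fun x z hz => ?_⟩
        simp only [fderivWithin_inter (hU.mem_nhds hz.2)]
      refine ih key ?_
      intro q hq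
      obtain ⟨U, hU, hy, hf⟩ := key q.2 hq.2
      have := hf.continuousOn q ⟨trivial, hq.2, hy⟩
      refine this.mono_of_mem_nhdsWithin ?_
      have h2 : (univ : Set X) ×ˢ (s ∩ U) = (univ ×ˢ s) ∩ (Prod.snd ⁻¹' U) := by
        ext; simp
      rw [h2]
      exact inter_mem self_mem_nhdsWithin
        (mem_nhdsWithin_of_mem_nhds ((hU.preimage continuous_snd).mem_nhds hy))

theorem param {a : X → ℝ} (ha : Continuous a) : FamC s k (fun x _ => a x) := by
  have h0 : ContinuousOn (fun q : X × E => a q.1) (univ ×ˢ s) := by fun_prop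
  induction k generalizing a with
  | zero => exact h0
  | succ k ih =>
    refine ⟨h0, fun x => differentiableOn_const _, fun u => ?_⟩
    simpa using ih (a := fun _ => 0) continuous_const (by fun_prop)

variable (hs : UniqueDiffOn ℝ s)
include hs

theorem add (hf : FamC s k f) (hg : FamC s k g) : FamC s k (fun x y => f x y + g x y) := by
  induction k generalizing f g with
  | zero => exact ContinuousOn.add hf hg
  | succ k ih =>
    refine ⟨hf.1.add hg.1, fun x => (hf.2.1 x).add (hg.2.1 x), fun u => ?_⟩
    refine (ih (hf.2.2 u) (hg.2.2 u)).congr fun x y hy => ?_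
    simp only [fderivWithin_fun_add (hs y hy) (hf.2.1 x y hy) (hg.2.1 x y hy)]
    rfl

theorem mul (hf : FamC s k f) (hg : FamC s k g) : FamC s k (fun x y => f x y * g x y) := by
  induction k generalizing f g with
  | zero => exact ContinuousOn.mul hf hg
  | succ k ih =>
    refine ⟨hf.1.mul hg.1, fun x => (hf.2.1 x).mul (hg.2.1 x), fun u => ?_⟩
    refine (add hs (ih hf.of_succ (hg.2.2 u)) (ih hg.of_succ (hf.2.2 u))).congr fun x y hy => ?_
    simp only [fderivWithin_fun_mul (hs y hy) (hf.2.1 x y hy) (hg.2.1 x y hy)]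
    rfl

theorem const_mul (c : ℝ) (hf : FamC s k f) : FamC s k (fun x y => c * f x y) :=
  mul hs (param continuous_const) hf

theorem neg (hf : FamC s k f) : FamC s k (fun x y => - f x y) := by
  simpa using const_mul hs (-1) hf

theorem sub (hf : FamC s k f) (hg : FamC s k g) : FamC s k (fun x y => f x y - g x y) := by
  simpa [sub_eq_add_neg] using add hs hf (neg hs hg)

theorem sum {ι : Type*} {A : Finset ι} {F : ι → X → E → ℝ} (h : ∀ i ∈ A, FamC s k (F i)) :
    FamC s k (fun x y => ∑ i ∈ A, F i x y) := by
  classical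
  induction A using Finset.induction_on with
  | empty => simpa using param continuous_const
  | insert i A hi ih =>
    simp only [Finset.sum_insert hi]
    exact add hs (h i (by simp)) (ih fun j hj => h j (by simp [hj]))

theorem prod {ι : Type*} {A : Finset ι} {F : ι → X → E → ℝ} (h : ∀ i ∈ A, FamC s k (F i)) :
    FamC s k (fun x y => ∏ i ∈ A, F i x y) := by
  classical
  induction A using Finset.induction_on with
  | empty => simpa using param continuous_const
  | insert i A hi ih =>
    simp only [Finset.prod_insert hi]
    exact mul hs (h i (by simp)) (ih fun j hj => h j (by simp [hj]))

theorem inv (hf : FamC s k f) (h0 : ∀ x, ∀ y ∈ s, f x y ≠ 0) :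
    FamC s k (fun x y => (f x y)⁻¹) := by
  induction k generalizing f with
  | zero => exact ContinuousOn.inv₀ hf fun q hq => h0 _ _ hq.2
  | succ k ih =>
    refine ⟨hf.1.inv₀ fun q hq => h0 _ _ hq.2, fun x => (hf.2.1 x).inv (h0 x), fun u => ?_⟩
    have h1 := ih hf.of_succ h0
    refine (neg hs (mul hs (mul hs h1 h1) (hf.2.2 u))).congr fun x y hy => ?_
    have := ((hasDerivAt_inv (h0 x y hy)).comp_hasFDerivWithinAt y
      (hf.2.1 x y hy).hasFDerivWithinAt).fderivWithin (hs y hy)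
    simp only [Function.comp_def] at this
    simp only [this]
    simp [pow_two]

theorem of_contDiffOn [FiniteDimensional ℝ E] {f : E → ℝ} (hf : ContDiffOn ℝ k f s) :
    FamC s k (fun _ : X => f) := by
  have h0 : ∀ {f : E → ℝ}, ContinuousOn f s →
      ContinuousOn (fun q : X × E => f q.2) (univ ×ˢ s) := fun hf =>
    hf.comp continuousOn_snd fun q hq => hq.2
  induction k generalizing f with
  | zero => exact h0 hf.continuousOn
  | succ k ih =>
    have h := (contDiffOn_succ_iff_fderivWithin (n := (k : ℕ∞ω)) hs).1 (by exact_mod_cast hf)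
    refine ⟨h0 hf.continuousOn, fun _ => h.1, fun u => ih ?_⟩
    exact contDiffOn_clm_apply.1 h.2.2 u

omit hs in
theorem contDiffOn [FiniteDimensional ℝ E] (hs : UniqueDiffOn ℝ s) (hf : FamC s k f) (x : X) :
    ContDiffOn ℝ k (f x) s := by
  induction k generalizing f with
  | zero =>
    refine contDiffOn_zero.2 ?_
    exact ContinuousOn.comp (g := fun q : X × E => f q.1 q.2) hf
      (f := fun y => (x, y)) (by fun_prop) fun y hy => ⟨trivial, hy⟩
  | succ k ih =>
    have := (contDiffOn_succ_iff_fderivWithin (𝕜 := ℝ) (n := (k : ℕ∞ω)) (f := f x) hs).2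
      ⟨hf.2.1 x, by simp, contDiffOn_clm_apply.2 fun u => ih (hf.2.2 u)⟩
    exact_mod_cast this

theorem comp {E₁ : Type*} [NormedAddCommGroup E₁] [NormedSpace ℝ E₁] {ι : Type*} [Fintype ι]
    (b : Module.Basis ι ℝ E₁) [FiniteDimensional ℝ E₁] {s₁ : Set E₁} {F : X → E₁ → ℝ}
    {p : X → E → E₁} (hF : FamC s₁ k F) (hp : ∀ i, FamC s k (fun x y => b.coord i (p x y)))
    (hm : ∀ x, MapsTo (p x) s s₁) : FamC s k (fun x y => F x (p x y)) := by
  have hsum : ∀ v : E₁, v = ∑ i, b.coord i v • b i := fun v => by simp [b.sum_repr]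
  have h0 : ∀ {F : X → E₁ → ℝ} , ContinuousOn (fun q : X × E₁ => F q.1 q.2) (univ ×ˢ s₁) →
      ContinuousOn (fun q : X × E => F q.1 (p q.1 q.2)) (univ ×ˢ s) := fun {F} hF => by
    refine ContinuousOn.comp (g := fun q : X × E₁ => F q.1 q.2)
      (f := fun q : X × E => (q.1, p q.1 q.2)) hF ?_ fun q hq => ⟨trivial, hm _ hq.2⟩
    refine continuousOn_fst.prodMk ?_
    have : (fun q : X × E => p q.1 q.2) = fun q => ∑ i, b.coord i (p q.1 q.2) • b i :=
      funext fun q => hsum _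
    rw [this]
    exact continuousOn_finsetSum _ fun i _ => (hp i).continuousOn.smul continuousOn_const
  induction k generalizing F with
  | zero => exact h0 hF
  | succ k ih =>
    have hpd : ∀ x, DifferentiableOn ℝ (p x) s := fun x => by
      have : p x = fun y => ∑ i, b.coord i (p x y) • b i := funext fun q => hsum _
      rw [this]
      exact DifferentiableOn.fun_sum fun i _ => ((hp i).2.1 x).smul_const _
    refine ⟨h0 hF.1, fun x => (hF.2.1 x).comp (hpd x) (hm x), fun u => ?_⟩
    have := FamC.sum hs (A := Finset.univ) (k := k) (F := fun i x y =>
      fderivWithin ℝ (fun y => b.coord i (p x y)) s y u * fderivWithin ℝ (F x) s₁ (p x y) (b i))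
      fun i _ => mul hs ((hp i).2.2 u) (ih (hF.2.2 (b i)) fun i => (hp i).of_succ)
    refine this.congr fun x y hy => ?_
    have hc : ∀ i, fderivWithin ℝ (fun y => b.coord i (p x y)) s y u =
        b.coord i (fderivWithin ℝ (p x) s y u) := fun i => by
      have := ((LinearMap.toContinuousLinearMap (b.coord i)).hasFDerivAt.comp_hasFDerivWithinAt y
        (hpd x y hy).hasFDerivWithinAt).fderivWithin (hs y hy)
      simp only [Function.comp_def] at this
      exact congrArg (fun L => L u) this
    have hch : fderivWithin ℝ (fun y => F x (p x y)) s y =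
        (fderivWithin ℝ (F x) s₁ (p x y)).comp (fderivWithin ℝ (p x) s y) :=
      ((hF.2.1 x _ (hm x hy)).hasFDerivWithinAt.comp y (hpd x y hy).hasFDerivWithinAt
        (hm x)).fderivWithin (hs y hy)
    simp only [hch, hc]
    conv_lhs => rw [ContinuousLinearMap.comp_apply, hsum (fderivWithin ℝ (p x) s y u)]
    simp only [map_sum, map_smul, smul_eq_mul]

end FamC

/-- Pointwise criterion for continuity of a family of multilinear forms. -/
theorem continuousOn_multilinear_apply [FiniteDimensional ℝ E] {Y : Type*} [TopologicalSpace Y]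
    {n : ℕ} {A : Set Y} {g : Y → (E [×n]→L[ℝ] ℝ)} (h : ∀ m, ContinuousOn (fun y => g y m) A) :
    ContinuousOn g A := by
  let T : (E [×n]→L[ℝ] ℝ) →ₗ[ℝ] ((Fin n → E) → ℝ) :=
    { toFun := fun a m => a m
      map_add' := fun _ _ => rfl
      map_smul' := fun _ _ => rfl }
  have : FiniteDimensional ℝ (E [×n]→L[ℝ] ℝ) :=
    Module.Finite.of_injective (ContinuousMultilinearMap.toMultilinearMapLinear (R' := ℝ) (A := ℝ))
      ContinuousMultilinearMap.toMultilinearMap_injective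
  have hT : IsClosedEmbedding T := LinearMap.isClosedEmbedding_of_injective
    (LinearMap.ker_eq_bot.2 fun a b hab => ContinuousMultilinearMap.ext fun m => congrFun hab m)
  rw [hT.isInducing.continuousOn_iff]
  exact continuousOn_pi.2 h

theorem iteratedFDerivWithin_succ_apply_last {s : Set E} (hs : UniqueDiffOn ℝ s) {k : ℕ}
    {f : E → ℝ} (hf : ContDiffOn ℝ (k + 1) f s) {y : E} (hy : y ∈ s) (m : Fin (k + 1) → E) :
    iteratedFDerivWithin ℝ (k + 1) f s y m =
      iteratedFDerivWithin ℝ k (fun z => fderivWithin ℝ f s z (m (Fin.last k))) s y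
        (Fin.init m) := by
  rw [iteratedFDerivWithin_succ_apply_right hs hy]
  have := iteratedFDerivWithin_clm_apply_const_apply (n := k) (i := k) hs
    (((contDiffOn_succ_iff_fderivWithin hs).1 hf).2.2) le_rfl hy (u := m (Fin.last k))
    (m := Fin.init m)
  exact this.symm

/-- The families of class `C^k` are those with jointly continuous iterated derivatives. -/
theorem famC_of_iteratedFDerivWithin [FiniteDimensional ℝ E] {s : Set E} (hs : UniqueDiffOn ℝ s)
    {k : ℕ} {f : X → E → ℝ} (hf : ∀ x, ContDiffOn ℝ k (f x) s)
    (h : ∀ j ≤ k, ∀ m, ContinuousOn (fun q : X × E => iteratedFDerivWithin ℝ j (f q.1) s q.2 m)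
      (univ ×ˢ s)) : FamC s k f := by
  induction k generalizing f with
  | zero => simpa [FamC] using h 0 le_rfl 0
  | succ k ih =>
    have h' : ∀ x, ContDiffOn ℝ (k + 1) (f x) s := fun x => by exact_mod_cast hf x
    have hd := fun x => (contDiffOn_succ_iff_fderivWithin hs).1 (h' x)
    refine ⟨by simpa using h 0 (by simp) 0, fun x => (hd x).1, fun u => ih (fun x => ?_) ?_⟩
    · exact contDiffOn_clm_apply.1 (hd x).2.2 u
    · intro j hj m
      refine (h (j + 1) (by lia) (Fin.snoc m u)).congr fun q hq => ?_
      simp only [iteratedFDerivWithin_succ_apply_last (k := j) hs ((h' q.1).of_le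
        (by exact_mod_cast Nat.succ_le_succ hj)) hq.2]
      simp

theorem FamC.continuousOn_iteratedFDerivWithin [FiniteDimensional ℝ E] {s : Set E}
    (hs : UniqueDiffOn ℝ s) {k : ℕ} {f : X → E → ℝ} (hf : FamC s k f) :
    ContinuousOn (fun q : X × E => iteratedFDerivWithin ℝ k (f q.1) s q.2) (univ ×ˢ s) := by
  refine continuousOn_multilinear_apply fun m => ?_
  induction k generalizing f with
  | zero => simpa [FamC] using hf
  | succ k ih =>
    refine (ih (hf.2.2 (m (Fin.last k))) (Fin.init m)).congr fun q hq => ?_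
    rw [iteratedFDerivWithin_succ_apply_last hs (by exact_mod_cast hf.contDiffOn hs q.1) hq.2]

end Families

section CoordinateGeometry

set_option maxSynthPendingDepth 3

variable {E : Type*} [NormedAddCommGroup E] [NormedSpace ℝ E] {ι : Type*} [Fintype ι]
  [DecidableEq ι]

/-- A smooth field of positive definite symmetric bilinear forms on a subset of a vector space. -/
structure IsMetricOn (s : Set E) (B : E → E →L[ℝ] E →L[ℝ] ℝ) : Prop where
  symm : ∀ y ∈ s, ∀ u v, B y u v = B y v u
  pos : ∀ y ∈ s, ∀ u, u ≠ 0 → 0 < B y u u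
  smooth : ContDiffOn ℝ ∞ B s

/-- The vector dual to a linear form, for the inverse Gram matrix `g`. -/
def sharp (b : Module.Basis ι ℝ E) (g : Matrix ι ι ℝ) (α : E → ℝ) : E :=
  ∑ k, ∑ l, (g k l * α (b l)) • b k

theorem gram_det_ne_zero (b : Module.Basis ι ℝ E) {B : E →L[ℝ] E →L[ℝ] ℝ}
    (hpos : ∀ u, u ≠ 0 → 0 < B u u) : (Matrix.of fun i j => B (b i) (b j)).det ≠ 0 := by
  intro h
  obtain ⟨v, hv, h0⟩ := Matrix.exists_mulVec_eq_zero_iff.2 h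
  have hne : ∑ i, v i • b i ≠ 0 := fun h =>
    hv (funext fun i => Fintype.linearIndependent_iff.1 b.linearIndependent v h i)
  refine (hpos _ hne).ne' ?_
  have h1 : ∀ i, ∑ j, v j * B (b i) (b j) = 0 := fun i => by
    simpa [Matrix.mulVec, dotProduct, mul_comm] using congrFun h0 i
  simp only [map_sum, map_smul, sum_apply, smul_apply,
    smul_eq_mul, Finset.mul_sum]
  rw [Finset.sum_comm]
  refine Finset.sum_eq_zero fun i _ => ?_
  rw [Finset.sum_congr rfl fun j _ => show v j * (v i * B (b i) (b j)) =
    v i * (v j * B (b i) (b j)) by ring, ← Finset.mul_sum, h1, mul_zero]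

theorem sharp_spec (b : Module.Basis ι ℝ E) {B : E →L[ℝ] E →L[ℝ] ℝ}
    (hsymm : ∀ u v, B u v = B v u) (hpos : ∀ u, u ≠ 0 → 0 < B u u) (α : E →ₗ[ℝ] ℝ) (w : E) :
    B (sharp b (Matrix.of fun i j => B (b i) (b j))⁻¹ α) w = α w := by
  set M := Matrix.of fun i j => B (b i) (b j) with hM
  have hdet : IsUnit M.det := (gram_det_ne_zero b hpos).isUnit
  have hinv := Matrix.mul_nonsing_inv M hdet
  have hlin : (B (sharp b M⁻¹ α) : E →ₗ[ℝ] ℝ) = α := by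
    refine b.ext fun m => ?_
    have h1 : ∀ l, ∑ k, M m k * M⁻¹ k l = if m = l then 1 else 0 := fun l => by
      simpa [Matrix.mul_apply, Matrix.one_apply] using congrFun (congrFun hinv m) l
    simp only [sharp, ContinuousLinearMap.coe_coe, map_sum, sum_apply,
      map_smul, smul_apply, smul_eq_mul]
    rw [Finset.sum_comm]
    calc ∑ l, ∑ k, M⁻¹ k l * α (b l) * B (b k) (b m)
        = ∑ l, (∑ k, M m k * M⁻¹ k l) * α (b l) := by
          refine Finset.sum_congr rfl fun l _ => ?_
          rw [Finset.sum_mul]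
          refine Finset.sum_congr rfl fun k _ => ?_
          rw [hsymm (b k) (b m)]
          simp only [hM, Matrix.of_apply]
          ring
      _ = α (b m) := by simp [h1]
  exact LinearMap.congr_fun hlin w

theorem eq_of_forall_form_eq {B : E →L[ℝ] E →L[ℝ] ℝ} (hpos : ∀ u, u ≠ 0 → 0 < B u u) {a c : E}
    (h : ∀ w, B a w = B c w) : a = c := by
  by_contra hne
  have := hpos (a - c) (sub_ne_zero.2 hne)
  have h2 : B (a - c) (a - c) = 0 := by rw [map_sub B, sub_apply, h, sub_self]
  exact this.ne' h2

/-- The Christoffel symbols of the first kind, as a trilinear form. -/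
def christoffelFirstL (B : E → E →L[ℝ] E →L[ℝ] ℝ) (s : Set E) (y : E) :
    E →L[ℝ] E →L[ℝ] E →L[ℝ] ℝ :=
  (1 / 2 : ℝ) • (fderivWithin ℝ B s y + (fderivWithin ℝ B s y).flip -
    (ContinuousLinearMap.flipₗᵢ ℝ E E ℝ : (E →L[ℝ] E →L[ℝ] ℝ) →L[ℝ] (E →L[ℝ] E →L[ℝ] ℝ)).comp
      (fderivWithin ℝ B s y).flip)

theorem christoffelFirstL_apply (B : E → E →L[ℝ] E →L[ℝ] ℝ) (s : Set E) (y u v w : E) :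
    christoffelFirstL B s y u v w = 1 / 2 * (fderivWithin ℝ B s y u v w +
      fderivWithin ℝ B s y v u w - fderivWithin ℝ B s y w u v) := by
  simp [christoffelFirstL]

theorem fderivWithin_form_apply {s : Set E} (hs : UniqueDiffOn ℝ s)
    {B : E → E →L[ℝ] E →L[ℝ] ℝ} {y : E} (hB : DifferentiableWithinAt ℝ B s y) (hy : y ∈ s)
    (u v w : E) :
    fderivWithin ℝ (fun z => B z v w) s y u = fderivWithin ℝ B s y u v w := by
  have h1 := (hB.hasFDerivWithinAt.clm_apply (hasFDerivWithinAt_const v y s)).clm_apply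
    (hasFDerivWithinAt_const w y s)
  rw [h1.fderivWithin (hs y hy)]
  simp

theorem christoffelFirst_eq {s : Set E} (hs : UniqueDiffOn ℝ s)
    {B : E → E →L[ℝ] E →L[ℝ] ℝ} {y : E} (hB : DifferentiableWithinAt ℝ B s y) (hy : y ∈ s)
    (u v w : E) :
    christoffelFirst (fun z a c => B z a c) s y u v w = christoffelFirstL B s y u v w := by
  simp only [christoffelFirst, christoffelFirstL_apply, fderivWithin_form_apply hs hB hy]

/-- The Christoffel symbols as a bilinear map. -/
def christoffelL (b : Module.Basis ι ℝ E) (B : E → E →L[ℝ] E →L[ℝ] ℝ) (s : Set E) (y : E) :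
    E →L[ℝ] E →L[ℝ] E :=
  (ContinuousLinearMap.compL ℝ E (E →L[ℝ] ℝ) E (∑ k, ∑ l, inverseGram b (fun z a c => B z a c) y k l •
    (ContinuousLinearMap.apply ℝ ℝ (b l)).smulRight (b k))).comp (christoffelFirstL B s y)

theorem christoffelL_apply (b : Module.Basis ι ℝ E) (B : E → E →L[ℝ] E →L[ℝ] ℝ) (s : Set E)
    (y u v : E) : christoffelL b B s y u v =
      sharp b (inverseGram b (fun z a c => B z a c) y) (christoffelFirstL B s y u v) := by
  simp [christoffelL, sharp, sum_apply, smul_smul]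

theorem christoffel_eq (b : Module.Basis ι ℝ E) {s : Set E} (hs : UniqueDiffOn ℝ s)
    {B : E → E →L[ℝ] E →L[ℝ] ℝ} {y : E} (hB : DifferentiableWithinAt ℝ B s y) (hy : y ∈ s)
    (u v : E) : christoffel b (fun z a c => B z a c) s y u v = christoffelL b B s y u v := by
  simp only [christoffelL_apply, christoffel, sharp, christoffelFirst_eq hs hB hy]

theorem IsMetricOn.differentiableOn {s : Set E} {B : E → E →L[ℝ] E →L[ℝ] ℝ}
    (h : IsMetricOn s B) : DifferentiableOn ℝ B s :=
  h.smooth.differentiableOn (by simp)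

theorem IsMetricOn.christoffelL_spec {s : Set E} {B : E → E →L[ℝ] E →L[ℝ] ℝ}
    (h : IsMetricOn s B) (b : Module.Basis ι ℝ E) {y : E} (hy : y ∈ s) (u v w : E) :
    B y (christoffelL b B s y u v) w = christoffelFirstL B s y u v w := by
  rw [christoffelL_apply]
  exact sharp_spec b (h.symm y hy) (h.pos y hy) (christoffelFirstL B s y u v : E →ₗ[ℝ] ℝ) w

theorem famC_inverseGram {X : Type*} [TopologicalSpace X] {s : Set E} (hs : UniqueDiffOn ℝ s)
    (b : Module.Basis ι ℝ E) {G : X → E → E → E → ℝ} {k : ℕ}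
    (hG : ∀ u v, FamC s k fun x y => G x y u v)
    (h0 : ∀ x, ∀ y ∈ s, (Matrix.of fun i j => G x y (b i) (b j)).det ≠ 0) (i j : ι) :
    FamC s k fun x y => inverseGram b (G x) y i j := by
  have hdet : ∀ M : X → E → Matrix ι ι ℝ, (∀ i j, FamC s k fun x y => M x y i j) →
      FamC s k fun x y => (M x y).det := fun M hM => by
    simp only [Matrix.det_apply']
    exact FamC.sum hs fun σ _ => FamC.const_mul hs _ (FamC.prod hs fun i _ => hM _ _)
  have hM : ∀ i j, FamC s k fun x y => (Matrix.of fun i j => G x y (b i) (b j)) i j :=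
    fun i j => hG _ _
  have h2 := FamC.mul hs (FamC.inv hs (hdet _ hM) h0)
    (hdet (fun x y => (Matrix.of fun i j => G x y (b i) (b j)).updateRow j (Pi.single i 1))
      fun i' j' => by
        by_cases h : i' = j
        · subst h
          simpa using FamC.param continuous_const
        · simpa [h] using hM i' j')
  refine h2.congr fun x y _ => ?_
  simp [inverseGram, Matrix.inv_def, Matrix.adjugate_apply]

theorem famC_christoffelFirst {X : Type*} [TopologicalSpace X] {s : Set E}
    (hs : UniqueDiffOn ℝ s) {G : X → E → E → E → ℝ} {k : ℕ}
    (hG : ∀ u v, FamC s (k + 1) fun x y => G x y u v) (u v w : E) :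
    FamC s k fun x y => christoffelFirst (G x) s y u v w :=
  FamC.const_mul hs _ (FamC.sub hs (FamC.add hs ((hG v w).2.2 u) ((hG u w).2.2 v))
    ((hG u v).2.2 w))

theorem famC_christoffel {X : Type*} [TopologicalSpace X] {s : Set E} (hs : UniqueDiffOn ℝ s)
    (b : Module.Basis ι ℝ E) {G : X → E → E → E → ℝ} {k : ℕ}
    (hG : ∀ u v, FamC s (k + 1) fun x y => G x y u v)
    (h0 : ∀ x, ∀ y ∈ s, (Matrix.of fun i j => G x y (b i) (b j)).det ≠ 0) (u v : E) (i : ι) :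
    FamC s k fun x y => b.coord i (christoffel b (G x) s y u v) := by
  have h := FamC.sum (A := Finset.univ) hs fun l _ => FamC.mul hs
    (famC_inverseGram hs b (fun u v => (hG u v).of_succ) h0 i l)
    (famC_christoffelFirst hs hG u v (b l))
  refine h.congr fun x y _ => ?_
  simp only [christoffel, map_sum, map_smul, Module.Basis.coord_apply, Module.Basis.repr_self]
  rw [Finset.sum_eq_single i (fun j _ hj => by simp [hj]) (by simp)]
  simp

variable [FiniteDimensional ℝ E]

theorem IsMetricOn.contDiffOn_christoffelL {s : Set E} (hs : UniqueDiffOn ℝ s)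
    {B : E → E →L[ℝ] E →L[ℝ] ℝ} (h : IsMetricOn s B) (b : Module.Basis ι ℝ E) :
    ContDiffOn ℝ ∞ (christoffelL b B s) s := by
  refine contDiffOn_clm_apply.2 fun u => contDiffOn_clm_apply.2 fun v => ?_
  have hk : ∀ (k : ℕ) i, ContDiffOn ℝ k
      (fun y => b.coord i (christoffel b (fun z a c => B z a c) s y u v)) s := fun k i =>
    FamC.contDiffOn (X := Unit) hs (f := fun _ y => _)
      (famC_christoffel hs b (G := fun _ z a c => B z a c)
      (fun u v => FamC.of_contDiffOn hs (((contDiffOn_clm_apply.1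
        (contDiffOn_clm_apply.1 h.smooth u) v).of_le (by exact_mod_cast le_top))))
      (fun _ y hy => gram_det_ne_zero b (h.pos y hy)) u v i) ()
  have h2 : ContDiffOn ℝ ∞ (fun y => ∑ i, b.coord i
      (christoffel b (fun z a c => B z a c) s y u v) • b i) s :=
    ContDiffOn.sum fun i _ => (contDiffOn_infty.2 fun k => hk k i).smul contDiffOn_const
  refine h2.congr fun y hy => ?_
  rw [← christoffel_eq b hs (h.differentiableOn y hy) hy]
  simp [b.sum_repr]

/-- The curvature tensor in terms of the bilinear Christoffel symbols. -/
theorem IsMetricOn.curvature_eq {s : Set E} (hs : UniqueDiffOn ℝ s)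
    {B : E → E →L[ℝ] E →L[ℝ] ℝ} (h : IsMetricOn s B) (b : Module.Basis ι ℝ E) {y : E}
    (hy : y ∈ s) (u v w : E) :
    curvature b (fun z a c => B z a c) s y u v w =
      fderivWithin ℝ (christoffelL b B s) s y u v w - fderivWithin ℝ (christoffelL b B s) s y v u w +
        christoffelL b B s y u (christoffelL b B s y v w) -
        christoffelL b B s y v (christoffelL b B s y u w) := by
  have hd := (h.contDiffOn_christoffelL hs b).differentiableOn (by simp) y hy
  have h1 : ∀ u v w, fderivWithin ℝ (fun z => christoffel b (fun z a c => B z a c) s z v w) s y u =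
      fderivWithin ℝ (christoffelL b B s) s y u v w := fun u v w => by
    rw [fderivWithin_congr (f := fun z => christoffelL b B s z v w)
      (fun z hz => christoffel_eq b hs (h.differentiableOn z hz) hz _ _)
      (christoffel_eq b hs (h.differentiableOn y hy) hy _ _)]
    have := (hd.hasFDerivWithinAt.clm_apply (hasFDerivWithinAt_const v y s)).clm_apply
      (hasFDerivWithinAt_const w y s)
    rw [this.fderivWithin (hs y hy)]
    simp
  simp only [curvature, h1, christoffel_eq b hs (h.differentiableOn y hy) hy]

/-- The curvature operator `u ↦ R(u, v) w`. -/
def curvatureL (b : Module.Basis ι ℝ E) (B : E → E →L[ℝ] E →L[ℝ] ℝ) (s : Set E) (y v w : E) :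
    E →ₗ[ℝ] E where
  toFun u := fderivWithin ℝ (christoffelL b B s) s y u v w -
    fderivWithin ℝ (christoffelL b B s) s y v u w +
    christoffelL b B s y u (christoffelL b B s y v w) -
    christoffelL b B s y v (christoffelL b B s y u w)
  map_add' u u' := by
    simp only [map_add, add_apply]
    abel
  map_smul' c u := by
    simp only [map_smul, smul_apply, RingHom.id_apply, smul_add, smul_sub]

/-- The Ricci tensor, as a bilinear form. -/
def ricciL (b : Module.Basis ι ℝ E) (B : E → E →L[ℝ] E →L[ℝ] ℝ) (s : Set E) (y : E) :
    E →ₗ[ℝ] E →ₗ[ℝ] ℝ :=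
  LinearMap.mk₂ ℝ (fun v w => LinearMap.trace ℝ E (curvatureL b B s y v w))
    (fun v v' w => by
      rw [← map_add]
      congr 1
      ext u
      simp only [curvatureL, map_add, add_apply, LinearMap.coe_mk,
        AddHom.coe_mk, LinearMap.add_apply]
      abel)
    (fun c v w => by
      rw [← map_smul]
      congr 1
      ext u
      simp [curvatureL, smul_add, smul_sub])
    (fun v w w' => by
      rw [← map_add]
      congr 1
      ext u
      simp only [curvatureL, map_add, LinearMap.coe_mk, AddHom.coe_mk, LinearMap.add_apply]
      abel)
    (fun c v w => by
      rw [← map_smul]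
      congr 1
      ext u
      simp [curvatureL, smul_add, smul_sub])

theorem IsMetricOn.ricci_eq {s : Set E} (hs : UniqueDiffOn ℝ s)
    {B : E → E →L[ℝ] E →L[ℝ] ℝ} (h : IsMetricOn s B) (b : Module.Basis ι ℝ E) {y : E}
    (hy : y ∈ s) (v w : E) :
    ricci b (fun z a c => B z a c) s y v w = ricciL b B s y v w := by
  simp only [ricci, ricciL, LinearMap.mk₂_apply, LinearMap.trace_eq_matrix_trace ℝ b,
    Matrix.trace, Matrix.diag, LinearMap.toMatrix_apply, h.curvature_eq hs b hy]
  rfl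

/-- The Ricci endomorphism. -/
def ricciEnd (b : Module.Basis ι ℝ E) (B : E → E →L[ℝ] E →L[ℝ] ℝ) (s : Set E) (y : E) :
    E →ₗ[ℝ] E where
  toFun v := sharp b (inverseGram b (fun z a c => B z a c) y) (ricciL b B s y v)
  map_add' v v' := by
    simp [sharp, mul_add, add_smul, Finset.sum_add_distrib]
  map_smul' c v := by
    simp only [sharp, map_smul, LinearMap.smul_apply, smul_eq_mul, Finset.smul_sum, smul_smul,
      RingHom.id_apply]
    simp only [mul_left_comm]

omit [FiniteDimensional ℝ E] in
theorem IsMetricOn.ricciEnd_spec {s : Set E} {B : E → E →L[ℝ] E →L[ℝ] ℝ}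
    (h : IsMetricOn s B) (b : Module.Basis ι ℝ E) {y : E} (hy : y ∈ s) (v w : E) :
    B y (ricciEnd b B s y v) w = ricciL b B s y v w :=
  sharp_spec b (h.symm y hy) (h.pos y hy) (ricciL b B s y v) w

theorem IsMetricOn.scalarCurvatureCoord_eq {s : Set E} (hs : UniqueDiffOn ℝ s)
    {B : E → E →L[ℝ] E →L[ℝ] ℝ} (h : IsMetricOn s B) (b : Module.Basis ι ℝ E) {y : E}
    (hy : y ∈ s) :
    scalarCurvatureCoord b (fun z a c => B z a c) s y =
      LinearMap.trace ℝ E (ricciEnd b B s y) := by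
  simp only [scalarCurvatureCoord, LinearMap.trace_eq_matrix_trace ℝ b, Matrix.trace, Matrix.diag,
    LinearMap.toMatrix_apply, h.ricci_eq hs b hy]
  refine Finset.sum_congr rfl fun j _ => ?_
  simp only [ricciEnd, sharp, LinearMap.coe_mk, AddHom.coe_mk, ← Finset.sum_smul, map_sum,
    map_smul, Module.Basis.repr_self]
  simp [Finsupp.finsetSum_apply, Finsupp.single_apply]

end CoordinateGeometry

section Naturality

set_option maxSynthPendingDepth 3
set_option linter.unusedSectionVars false

variable {E : Type*} [NormedAddCommGroup E] [NormedSpace ℝ E] [FiniteDimensional ℝ E]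
  {E₂ : Type*} [NormedAddCommGroup E₂] [NormedSpace ℝ E₂] [FiniteDimensional ℝ E₂]
  {ι : Type*} [Fintype ι] [DecidableEq ι] {ι₂ : Type*} [Fintype ι₂] [DecidableEq ι₂]

/-- `ψ : s → s₂` pulls back the metric `B₂` to the metric `B`. -/
structure IsLocalIsometry (s : Set E) (B : E → E →L[ℝ] E →L[ℝ] ℝ) (s₂ : Set E₂)
    (B₂ : E₂ → E₂ →L[ℝ] E₂ →L[ℝ] ℝ) (ψ : E → E₂) : Prop where
  uniqueDiffOn : UniqueDiffOn ℝ s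
  uniqueDiffOn₂ : UniqueDiffOn ℝ s₂
  subset_closure : s ⊆ closure (interior s)
  metric : IsMetricOn s B
  metric₂ : IsMetricOn s₂ B₂
  smooth : ContDiffOn ℝ ∞ ψ s
  mapsTo : MapsTo ψ s s₂
  finrank_eq : Module.finrank ℝ E = Module.finrank ℝ E₂
  form_eq : ∀ y ∈ s, ∀ u v, B y u v = B₂ (ψ y) (fderivWithin ℝ ψ s y u) (fderivWithin ℝ ψ s y v)

namespace IsLocalIsometry

variable {s : Set E} {B : E → E →L[ℝ] E →L[ℝ] ℝ} {s₂ : Set E₂}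
  {B₂ : E₂ → E₂ →L[ℝ] E₂ →L[ℝ] ℝ} {ψ : E → E₂} (h : IsLocalIsometry s B s₂ B₂ ψ)
include h

theorem injective {y : E} (hy : y ∈ s) : Function.Injective (fderivWithin ℝ ψ s y) := by
  refine (injective_iff_map_eq_zero _).2 fun u hu => ?_
  by_contra hne
  have := h.metric.pos y hy u hne
  rw [h.form_eq y hy, hu] at this
  simp at this

theorem surjective {y : E} (hy : y ∈ s) : Function.Surjective (fderivWithin ℝ ψ s y) :=
  (LinearMap.injective_iff_surjective_of_finrank_eq_finrank h.finrank_eq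
    (f := (fderivWithin ℝ ψ s y : E →ₗ[ℝ] E₂))).1 (h.injective hy)

theorem smooth_fderivWithin : ContDiffOn ℝ ∞ (fderivWithin ℝ ψ s) s :=
  h.smooth.fderivWithin h.uniqueDiffOn (by simp)

theorem smooth_fderivWithin₂ : ContDiffOn ℝ ∞ (fderivWithin ℝ (fderivWithin ℝ ψ s) s) s :=
  h.smooth_fderivWithin.fderivWithin h.uniqueDiffOn (by simp)

theorem symm_fderivWithin₂ {y : E} (hy : y ∈ s) (u v : E) :
    fderivWithin ℝ (fderivWithin ℝ ψ s) s y u v = fderivWithin ℝ (fderivWithin ℝ ψ s) s y v u :=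
  ((h.smooth y hy).isSymmSndFDerivWithinAt
    (by simp only [minSmoothness_of_isRCLikeNormedField]; exact ENat.LEInfty.out) h.uniqueDiffOn (h.subset_closure hy) hy) u v

theorem symm_fderivWithin₃ {y : E} (hy : y ∈ s) (u v w : E) :
    fderivWithin ℝ (fderivWithin ℝ (fderivWithin ℝ ψ s) s) s y u v w =
      fderivWithin ℝ (fderivWithin ℝ (fderivWithin ℝ ψ s) s) s y v u w :=
  congrArg (fun L => L w) (((h.smooth_fderivWithin y hy).isSymmSndFDerivWithinAt
    (by simp only [minSmoothness_of_isRCLikeNormedField]; exact ENat.LEInfty.out)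
    h.uniqueDiffOn (h.subset_closure hy) hy) u v)

theorem hasFDerivWithinAt {y : E} (hy : y ∈ s) :
    HasFDerivWithinAt ψ (fderivWithin ℝ ψ s y) s y :=
  (h.smooth.differentiableOn (by simp) y hy).hasFDerivWithinAt

theorem hasFDerivWithinAt₂ {y : E} (hy : y ∈ s) : HasFDerivWithinAt (fderivWithin ℝ ψ s)
    (fderivWithin ℝ (fderivWithin ℝ ψ s) s y) s y :=
  (h.smooth_fderivWithin.differentiableOn (by simp) y hy).hasFDerivWithinAt

theorem fderivWithin_form {y : E} (hy : y ∈ s) (u v w : E) :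
    fderivWithin ℝ B s y u v w =
      fderivWithin ℝ B₂ s₂ (ψ y) (fderivWithin ℝ ψ s y u) (fderivWithin ℝ ψ s y v)
        (fderivWithin ℝ ψ s y w) +
      B₂ (ψ y) (fderivWithin ℝ (fderivWithin ℝ ψ s) s y u v) (fderivWithin ℝ ψ s y w) +
      B₂ (ψ y) (fderivWithin ℝ ψ s y v) (fderivWithin ℝ (fderivWithin ℝ ψ s) s y u w) := by
  rw [← fderivWithin_form_apply h.uniqueDiffOn (h.metric.differentiableOn y hy) hy,
    fderivWithin_congr (fun z hz => h.form_eq z hz v w) (h.form_eq y hy v w)]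
  have hB := (h.metric₂.differentiableOn _ (h.mapsTo hy)).hasFDerivWithinAt.comp y
    (h.hasFDerivWithinAt hy) h.mapsTo
  have hA := fun v => (h.hasFDerivWithinAt₂ hy).clm_apply (hasFDerivWithinAt_const v y s)
  have := (hB.clm_apply (hA v)).clm_apply (hA w)
  simp only [Function.comp_def] at this
  rw [this.fderivWithin (h.uniqueDiffOn y hy)]
  simp
  ring

theorem christoffelFirstL_eq {y : E} (hy : y ∈ s) (u v w : E) :
    christoffelFirstL B s y u v w =
      christoffelFirstL B₂ s₂ (ψ y) (fderivWithin ℝ ψ s y u) (fderivWithin ℝ ψ s y v)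
        (fderivWithin ℝ ψ s y w) +
      B₂ (ψ y) (fderivWithin ℝ (fderivWithin ℝ ψ s) s y u v) (fderivWithin ℝ ψ s y w) := by
  simp only [christoffelFirstL_apply, h.fderivWithin_form hy]
  rw [h.symm_fderivWithin₂ hy v u, h.symm_fderivWithin₂ hy w u, h.symm_fderivWithin₂ hy w v,
    h.metric₂.symm _ (h.mapsTo hy) (fderivWithin ℝ ψ s y v)
      (fderivWithin ℝ (fderivWithin ℝ ψ s) s y u w)]
  ring

theorem christoffelL_eq (b : Module.Basis ι ℝ E) (b₂ : Module.Basis ι₂ ℝ E₂) {y : E} (hy : y ∈ s)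
    (u v : E) : fderivWithin ℝ ψ s y (christoffelL b B s y u v) =
      christoffelL b₂ B₂ s₂ (ψ y) (fderivWithin ℝ ψ s y u) (fderivWithin ℝ ψ s y v) +
        fderivWithin ℝ (fderivWithin ℝ ψ s) s y u v := by
  refine eq_of_forall_form_eq (h.metric₂.pos _ (h.mapsTo hy)) fun w => ?_
  obtain ⟨w, rfl⟩ := h.surjective hy w
  rw [← h.form_eq y hy, h.metric.christoffelL_spec b hy, h.christoffelFirstL_eq hy,
    map_add, add_apply, h.metric₂.christoffelL_spec b₂ (h.mapsTo hy)]

theorem fderivWithin_christoffelL (b : Module.Basis ι ℝ E) (b₂ : Module.Basis ι₂ ℝ E₂) {y : E}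
    (hy : y ∈ s) (u v w : E) :
    fderivWithin ℝ (fderivWithin ℝ ψ s) s y u (christoffelL b B s y v w) +
      fderivWithin ℝ ψ s y (fderivWithin ℝ (christoffelL b B s) s y u v w) =
    fderivWithin ℝ (christoffelL b₂ B₂ s₂) s₂ (ψ y) (fderivWithin ℝ ψ s y u)
        (fderivWithin ℝ ψ s y v) (fderivWithin ℝ ψ s y w) +
      christoffelL b₂ B₂ s₂ (ψ y) (fderivWithin ℝ (fderivWithin ℝ ψ s) s y u v)
        (fderivWithin ℝ ψ s y w) +
      christoffelL b₂ B₂ s₂ (ψ y) (fderivWithin ℝ ψ s y v)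
        (fderivWithin ℝ (fderivWithin ℝ ψ s) s y u w) +
      fderivWithin ℝ (fderivWithin ℝ (fderivWithin ℝ ψ s) s) s y u v w := by
  have hΓ := ((h.metric.contDiffOn_christoffelL h.uniqueDiffOn b).differentiableOn (by simp) y
    hy).hasFDerivWithinAt
  have hΓ₂ := ((h.metric₂.contDiffOn_christoffelL h.uniqueDiffOn₂ b₂).differentiableOn (by simp) _
    (h.mapsTo hy)).hasFDerivWithinAt.comp y (h.hasFDerivWithinAt hy) h.mapsTo
  have hc := fun v : E => hasFDerivWithinAt_const (𝕜 := ℝ) v y s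
  have hA := fun v : E => (h.hasFDerivWithinAt₂ hy).clm_apply (hc v)
  have h3 := (((h.smooth_fderivWithin₂.differentiableOn (by simp) y hy).hasFDerivWithinAt.clm_apply
    (hc v)).clm_apply (hc w))
  have hL := (h.hasFDerivWithinAt₂ hy).clm_apply ((hΓ.clm_apply (hc v)).clm_apply (hc w))
  have hR := ((hΓ₂.clm_apply (hA v)).clm_apply (hA w)).add h3
  have := congrArg (fun L => L u) ((h.uniqueDiffOn y hy).eq hL
    (hR.congr (fun z hz => h.christoffelL_eq b b₂ hz v w) (h.christoffelL_eq b b₂ hy v w)))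
  simp at this
  rw [add_comm, this]
  abel

theorem curvatureL_eq (b : Module.Basis ι ℝ E) (b₂ : Module.Basis ι₂ ℝ E₂) {y : E} (hy : y ∈ s)
    (u v w : E) : fderivWithin ℝ ψ s y (curvatureL b B s y v w u) =
      curvatureL b₂ B₂ s₂ (ψ y) (fderivWithin ℝ ψ s y v) (fderivWithin ℝ ψ s y w)
        (fderivWithin ℝ ψ s y u) := by
  have h1 := h.fderivWithin_christoffelL b b₂ hy u v w
  have h2 := h.fderivWithin_christoffelL b b₂ hy v u w
  rw [h.symm_fderivWithin₃ hy v u, h.symm_fderivWithin₂ hy v u] at h2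
  simp only [curvatureL, LinearMap.coe_mk, AddHom.coe_mk, map_add, map_sub,
    h.christoffelL_eq b b₂ hy] at h1 h2 ⊢
  rw [eq_sub_of_add_eq' h1, eq_sub_of_add_eq' h2]
  abel

/-- The derivative of a local isometry, as a linear equivalence. -/
def equiv {y : E} (hy : y ∈ s) : E ≃ₗ[ℝ] E₂ :=
  LinearEquiv.ofBijective (fderivWithin ℝ ψ s y : E →ₗ[ℝ] E₂) ⟨h.injective hy, h.surjective hy⟩

theorem equiv_apply {y : E} (hy : y ∈ s) (u : E) : h.equiv hy u = fderivWithin ℝ ψ s y u := rfl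

theorem ricciL_eq (b : Module.Basis ι ℝ E) (b₂ : Module.Basis ι₂ ℝ E₂) {y : E} (hy : y ∈ s)
    (v w : E) : ricciL b B s y v w =
      ricciL b₂ B₂ s₂ (ψ y) (fderivWithin ℝ ψ s y v) (fderivWithin ℝ ψ s y w) := by
  simp only [ricciL, LinearMap.mk₂_apply]
  rw [← LinearMap.trace_conj' _ (h.equiv hy)]
  congr 1
  ext u
  obtain ⟨u, rfl⟩ := (h.equiv hy).surjective u
  rw [LinearEquiv.conj_apply_apply, LinearEquiv.symm_apply_apply]
  simpa only [equiv_apply] using h.curvatureL_eq b b₂ hy u v w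

/-- Scalar curvature is invariant under local isometries. -/
theorem scalarCurvatureCoord_eq (b : Module.Basis ι ℝ E) (b₂ : Module.Basis ι₂ ℝ E₂) {y : E}
    (hy : y ∈ s) : scalarCurvatureCoord b (fun z a c => B z a c) s y =
      scalarCurvatureCoord b₂ (fun z a c => B₂ z a c) s₂ (ψ y) := by
  rw [h.metric.scalarCurvatureCoord_eq h.uniqueDiffOn b hy,
    h.metric₂.scalarCurvatureCoord_eq h.uniqueDiffOn₂ b₂ (h.mapsTo hy),
    ← LinearMap.trace_conj' _ (h.equiv hy)]
  congr 1
  ext u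
  obtain ⟨u, rfl⟩ := (h.equiv hy).surjective u
  rw [LinearEquiv.conj_apply_apply, LinearEquiv.symm_apply_apply]
  refine eq_of_forall_form_eq (h.metric₂.pos _ (h.mapsTo hy)) fun w => ?_
  obtain ⟨w, rfl⟩ := (h.equiv hy).surjective w
  simp only [equiv_apply]
  rw [← h.form_eq y hy, h.metric.ricciEnd_spec b hy, h.metric₂.ricciEnd_spec b₂ (h.mapsTo hy),
    h.ricciL_eq b b₂ hy]

end IsLocalIsometry

section Locality

variable (b : Module.Basis ι ℝ E) {s U : Set E} {G G' : E → E → E → ℝ}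

omit [FiniteDimensional ℝ E] in
/-- The scalar curvature at a point only depends on the metric near this point. -/
theorem scalarCurvatureCoord_inter (hU : IsOpen U) {y : E} (hy : y ∈ s ∩ U)
    (hG : ∀ z ∈ s ∩ U, G z = G' z) :
    scalarCurvatureCoord b G s y = scalarCurvatureCoord b G' (s ∩ U) y := by
  have hd : ∀ {F F' : E → ℝ}, (∀ z ∈ s ∩ U, F z = F' z) → ∀ z ∈ s ∩ U,
      fderivWithin ℝ F s z = fderivWithin ℝ F' (s ∩ U) z := fun hF z hz => by
    rw [← fderivWithin_inter (hU.mem_nhds hz.2), fderivWithin_congr hF (hF z hz)]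
  have hd' : ∀ {F F' : E → E}, (∀ z ∈ s ∩ U, F z = F' z) → ∀ z ∈ s ∩ U,
      fderivWithin ℝ F s z = fderivWithin ℝ F' (s ∩ U) z := fun hF z hz => by
    rw [← fderivWithin_inter (hU.mem_nhds hz.2), fderivWithin_congr hF (hF z hz)]
  have hi : ∀ z ∈ s ∩ U, inverseGram b G z = inverseGram b G' z := fun z hz => by
    simp only [inverseGram, hG z hz]
  have hc : ∀ u v, ∀ z ∈ s ∩ U, christoffel b G s z u v = christoffel b G' (s ∩ U) z u v := by
    intro u v z hz
    have h1 := fun u v => hd (F := fun z => G z u v) (F' := fun z => G' z u v)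
      (fun z hz => by rw [hG z hz]) z hz
    simp only [christoffel, christoffelFirst, h1, hi z hz]
  have hc' := fun u v => hd' (hc u v) y hy
  simp only [scalarCurvatureCoord, ricci, curvature, hi y hy, hc', hc _ _ y hy]

end Locality

end Naturality

section ScalarCurvatureFamilies

set_option maxSynthPendingDepth 3
set_option linter.unusedSectionVars false

variable {E : Type*} [NormedAddCommGroup E] [NormedSpace ℝ E] [FiniteDimensional ℝ E]
  {ι : Type*} [Fintype ι] [DecidableEq ι]

theorem continuousOn_scalarCurvatureCoord {X : Type*} [TopologicalSpace X] {s : Set E}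
    (hs : UniqueDiffOn ℝ s) (b : Module.Basis ι ℝ E) {B : X → E → E →L[ℝ] E →L[ℝ] ℝ}
    (hm : ∀ x, IsMetricOn s (B x)) (hB : ∀ u v, FamC s 2 fun x y => B x y u v) :
    ContinuousOn (fun q : X × E => scalarCurvatureCoord b (fun z a c => B q.1 z a c) s q.2)
      (univ ×ˢ s) := by
  have h0 : ∀ x, ∀ y ∈ s, (Matrix.of fun i j => B x y (b i) (b j)).det ≠ 0 :=
    fun x y hy => gram_det_ne_zero b ((hm x).pos y hy)
  have hg := fun i j => (famC_inverseGram hs b (G := fun x z a c => B x z a c) hB h0 i j).continuousOn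
  have hc := fun u v i => famC_christoffel hs b (G := fun x z a c => B x z a c) hB h0 u v i
  have hD : ∀ u v w i, ContinuousOn (fun q : X × E => b.repr (fderivWithin ℝ
      (fun z => christoffel b (fun z a c => B q.1 z a c) s z v w) s q.2 u) i) (univ ×ˢ s) := by
    intro u v w i
    refine ((hc v w i).2.2 u).continuousOn.congr fun q hq => ?_
    have hd : DifferentiableWithinAt ℝ
        (fun z => christoffel b (fun z a c => B q.1 z a c) s z v w) s q.2 := by
      have h1 : DifferentiableWithinAt ℝ (fun z => christoffelL b (B q.1) s z v w) s q.2 := by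
        have := ((hm q.1).contDiffOn_christoffelL hs b).differentiableOn (by simp) q.2 hq.2
        exact (this.clm_apply (differentiableWithinAt_const _)).clm_apply
          (differentiableWithinAt_const _)
      exact h1.congr (fun z hz => christoffel_eq b hs ((hm q.1).differentiableOn z hz) hz _ _)
        (christoffel_eq b hs ((hm q.1).differentiableOn _ hq.2) hq.2 _ _)
    have := ((LinearMap.toContinuousLinearMap (b.coord i)).hasFDerivAt.comp_hasFDerivWithinAt q.2
        hd.hasFDerivWithinAt).fderivWithin (hs q.2 hq.2)
    exact (congrArg (fun L => L u) this).symm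
  have hCC : ∀ u v w i, ContinuousOn (fun q : X × E => b.repr (christoffel b
      (fun z a c => B q.1 z a c) s q.2 u (christoffel b (fun z a c => B q.1 z a c) s q.2 v w)) i)
      (univ ×ˢ s) := by
    intro u v w i
    have : ContinuousOn (fun q : X × E => ∑ m,
        b.coord m (christoffel b (fun z a c => B q.1 z a c) s q.2 v w) *
        b.coord i (christoffel b (fun z a c => B q.1 z a c) s q.2 u (b m))) (univ ×ˢ s) :=
      continuousOn_finsetSum _ fun m _ => (hc v w m).continuousOn.mul (hc u (b m) i).continuousOn
    refine this.congr fun q hq => ?_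
    simp only [christoffel_eq b hs ((hm q.1).differentiableOn _ hq.2) hq.2]
    conv_lhs => rw [← b.sum_repr (christoffelL b (B q.1) s q.2 v w)]
    simp only [map_sum, map_smul, Finsupp.finsetSum_apply, Finsupp.smul_apply, smul_eq_mul,
      Module.Basis.coord_apply]
  have hR : ∀ u v w i, ContinuousOn (fun q : X × E => b.repr (curvature b
      (fun z a c => B q.1 z a c) s q.2 u v w) i) (univ ×ˢ s) := fun u v w i => by
    simp only [curvature, map_add, map_sub, Finsupp.add_apply, Finsupp.sub_apply]
    exact (((hD u v w i).sub (hD v u w i)).add (hCC u v w i)).sub (hCC v u w i)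
  exact continuousOn_finsetSum _ fun j _ => continuousOn_finsetSum _ fun l _ =>
    (hg j l).mul (continuousOn_finsetSum _ fun k _ => hR _ _ _ _)

end ScalarCurvatureFamilies

section Product

set_option maxSynthPendingDepth 3
set_option linter.unusedSectionVars false

variable {E : Type*} [NormedAddCommGroup E] [NormedSpace ℝ E] [FiniteDimensional ℝ E]
  {ι : Type*} [Fintype ι] [DecidableEq ι] {ι₂ : Type*} [Fintype ι₂] [DecidableEq ι₂]

/-- `B₂ = B + f dt²` on `s × T`. -/
structure IsProductMetric (s : Set E) (B : E → E →L[ℝ] E →L[ℝ] ℝ) (T : Set ℝ) (f : ℝ → ℝ)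
    (B₂ : E × ℝ → E × ℝ →L[ℝ] E × ℝ →L[ℝ] ℝ) : Prop where
  uniqueDiffOn : UniqueDiffOn ℝ s
  isOpen : IsOpen T
  metric : IsMetricOn s B
  metric₂ : IsMetricOn (s ×ˢ T) B₂
  contDiff : ContDiff ℝ ∞ f
  pos : ∀ t, 0 < f t
  form_eq : ∀ p ∈ s ×ˢ T, ∀ u v, B₂ p u v = B p.1 u.1 v.1 + f p.2 * (u.2 * v.2)

namespace IsProductMetric

variable {s : Set E} {B : E → E →L[ℝ] E →L[ℝ] ℝ} {T : Set ℝ} {f : ℝ → ℝ}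
  {B₂ : E × ℝ → E × ℝ →L[ℝ] E × ℝ →L[ℝ] ℝ} (h : IsProductMetric s B T f B₂)
include h

theorem uniqueDiffOn₂ : UniqueDiffOn ℝ (s ×ˢ T) := h.uniqueDiffOn.prod h.isOpen.uniqueDiffOn

theorem hasFDerivWithinAt_fst_comp {F : Type*} [NormedAddCommGroup F] [NormedSpace ℝ F]
    {g : E → F} {p : E × ℝ} (hg : DifferentiableWithinAt ℝ g s p.1) :
    HasFDerivWithinAt (fun q : E × ℝ => g q.1)
      ((fderivWithin ℝ g s p.1).comp (ContinuousLinearMap.fst ℝ E ℝ)) (s ×ˢ T) p :=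
  hg.hasFDerivWithinAt.comp p hasFDerivWithinAt_fst fun _ hq => hq.1

theorem hasFDerivWithinAt_snd_comp {F : Type*} [NormedAddCommGroup F] [NormedSpace ℝ F]
    {g : ℝ → F} {p : E × ℝ} (hg : DifferentiableAt ℝ g p.2) :
    HasFDerivWithinAt (fun q : E × ℝ => g q.2)
      ((fderiv ℝ g p.2).comp (ContinuousLinearMap.snd ℝ E ℝ)) (s ×ˢ T) p :=
  hg.hasFDerivAt.comp_hasFDerivWithinAt p hasFDerivWithinAt_snd

theorem fderivWithin_form {p : E × ℝ} (hp : p ∈ s ×ˢ T) (u v w : E × ℝ) :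
    fderivWithin ℝ B₂ (s ×ˢ T) p u v w =
      fderivWithin ℝ B s p.1 u.1 v.1 w.1 + deriv f p.2 * u.2 * (v.2 * w.2) := by
  rw [← fderivWithin_form_apply h.uniqueDiffOn₂ (h.metric₂.differentiableOn p hp) hp,
    fderivWithin_congr (fun z hz => h.form_eq z hz v w) (h.form_eq p hp v w)]
  have h1 := h.hasFDerivWithinAt_fst_comp (h.metric.differentiableOn p.1 hp.1)
  have h2 := h.hasFDerivWithinAt_snd_comp (p := p) (h.contDiff.differentiable (by simp) p.2)
  have h3 := ((h1.clm_apply (hasFDerivWithinAt_const v.1 p _)).clm_apply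
    (hasFDerivWithinAt_const w.1 p _)).fun_add (h2.mul_const (v.2 * w.2))
  rw [h3.fderivWithin (h.uniqueDiffOn₂ p hp)]
  simp
  ring

theorem christoffelFirstL_eq {p : E × ℝ} (hp : p ∈ s ×ˢ T) (u v w : E × ℝ) :
    christoffelFirstL B₂ (s ×ˢ T) p u v w = christoffelFirstL B s p.1 u.1 v.1 w.1 +
      deriv f p.2 / 2 * (u.2 * v.2 * w.2) := by
  simp only [christoffelFirstL_apply, h.fderivWithin_form hp]
  ring

theorem christoffelL_eq (b : Module.Basis ι ℝ E) (b₂ : Module.Basis ι₂ ℝ (E × ℝ)) {p : E × ℝ}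
    (hp : p ∈ s ×ˢ T) (u v : E × ℝ) : christoffelL b₂ B₂ (s ×ˢ T) p u v =
      (christoffelL b B s p.1 u.1 v.1, deriv f p.2 / (2 * f p.2) * (u.2 * v.2)) := by
  refine eq_of_forall_form_eq (h.metric₂.pos p hp) fun w => ?_
  rw [h.metric₂.christoffelL_spec b₂ hp, h.form_eq p hp, h.metric.christoffelL_spec b hp.1,
    h.christoffelFirstL_eq hp]
  have := (h.pos p.2).ne'
  field_simp

theorem fderivWithin_christoffelL (b : Module.Basis ι ℝ E) (b₂ : Module.Basis ι₂ ℝ (E × ℝ))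
    {p : E × ℝ} (hp : p ∈ s ×ˢ T) (u v w : E × ℝ) :
    fderivWithin ℝ (christoffelL b₂ B₂ (s ×ˢ T)) (s ×ˢ T) p u v w =
      (fderivWithin ℝ (christoffelL b B s) s p.1 u.1 v.1 w.1,
        deriv (fun t => deriv f t / (2 * f t)) p.2 * u.2 * (v.2 * w.2)) := by
  have hd := (h.metric₂.contDiffOn_christoffelL h.uniqueDiffOn₂ b₂).differentiableOn (by simp) p hp
  have h1 := (hd.hasFDerivWithinAt.clm_apply (hasFDerivWithinAt_const v p _)).clm_apply
    (hasFDerivWithinAt_const w p _)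
  have hd1 := (h.metric.contDiffOn_christoffelL h.uniqueDiffOn b).differentiableOn (by simp) p.1 hp.1
  have hd2 : DifferentiableAt ℝ (fun t => deriv f t / (2 * f t)) p.2 := by
    have h3 : ContDiff ℝ ∞ (deriv f) := h.contDiff.deriv' 
    exact (h3.differentiable (by simp) _).div
      ((h.contDiff.differentiable (by simp) _).const_mul 2) (by simpa using (h.pos p.2).ne')
  have h2 := (((h.hasFDerivWithinAt_fst_comp hd1).clm_apply
    (hasFDerivWithinAt_const v.1 p _)).clm_apply (hasFDerivWithinAt_const w.1 p _)).prodMk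
    ((h.hasFDerivWithinAt_snd_comp (p := p) hd2).mul_const (v.2 * w.2))
  have := congrArg (fun L => L u) ((h.uniqueDiffOn₂ p hp).eq h1
    (h2.congr (fun z hz => h.christoffelL_eq b b₂ hz v w) (h.christoffelL_eq b b₂ hp v w)))
  simp at this
  rw [this]
  ext1
  · rfl
  · simp
    ring

theorem curvatureL_eq (b : Module.Basis ι ℝ E) (b₂ : Module.Basis ι₂ ℝ (E × ℝ)) {p : E × ℝ}
    (hp : p ∈ s ×ˢ T) (v w : E × ℝ) : curvatureL b₂ B₂ (s ×ˢ T) p v w =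
      (curvatureL b B s p.1 v.1 w.1).prodMap 0 := by
  refine LinearMap.ext fun u => ?_
  simp only [curvatureL, LinearMap.coe_mk, AddHom.coe_mk, h.fderivWithin_christoffelL b b₂ hp,
    h.christoffelL_eq b b₂ hp, LinearMap.prodMap_apply]
  ext1
  · simp
  · simp
    ring

theorem ricciL_eq (b : Module.Basis ι ℝ E) (b₂ : Module.Basis ι₂ ℝ (E × ℝ)) {p : E × ℝ}
    (hp : p ∈ s ×ˢ T) (v w : E × ℝ) :
    ricciL b₂ B₂ (s ×ˢ T) p v w = ricciL b B s p.1 v.1 w.1 := by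
  simp only [ricciL, LinearMap.mk₂_apply, h.curvatureL_eq b b₂ hp, LinearMap.trace_prodMap',
    map_zero, add_zero]

/-- The scalar curvature of the product metric `B + f dt²` is the scalar curvature of `B`. -/
theorem scalarCurvatureCoord_eq (b : Module.Basis ι ℝ E) (b₂ : Module.Basis ι₂ ℝ (E × ℝ))
    {p : E × ℝ} (hp : p ∈ s ×ˢ T) :
    scalarCurvatureCoord b₂ (fun z a c => B₂ z a c) (s ×ˢ T) p =
      scalarCurvatureCoord b (fun z a c => B z a c) s p.1 := by
  rw [h.metric.scalarCurvatureCoord_eq h.uniqueDiffOn b hp.1,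
    h.metric₂.scalarCurvatureCoord_eq h.uniqueDiffOn₂ b₂ hp]
  have : ricciEnd b₂ B₂ (s ×ˢ T) p = (ricciEnd b B s p.1).prodMap 0 := by
    refine LinearMap.ext fun v => eq_of_forall_form_eq (h.metric₂.pos p hp) fun w => ?_
    rw [h.metric₂.ricciEnd_spec b₂ hp, h.form_eq p hp, LinearMap.prodMap_apply,
      h.metric.ricciEnd_spec b hp.1, h.ricciL_eq b b₂ hp]
    simp
  rw [this, LinearMap.trace_prodMap', map_zero, add_zero]

end IsProductMetric

end Product

section FormFields

set_option maxSynthPendingDepth 3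

variable {E : Type*} [NormedAddCommGroup E] [NormedSpace ℝ E]
  {H : Type*} [TopologicalSpace H] (I : ModelWithCorners ℝ E H)
  (M : Type*) [TopologicalSpace M] [ChartedSpace H M]

/-- Fields of bilinear forms on the tangent spaces of `M`. -/
abbrev FormField : Type _ := (p : M) → TangentSpace I p →L[ℝ] TangentSpace I p →L[ℝ] ℝ

variable {I M}

/-- The derivative of the inverse of a chart. -/
def chartSymmDeriv (I : ModelWithCorners ℝ E H) (e : OpenPartialHomeomorph M H) (y : E) :
    E →L[ℝ] E :=
  mfderivWithin 𝓘(ℝ, E) I (e.extend I).symm (range I) y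

/-- The expression of a field of bilinear forms in a chart. -/
def localForm (e : OpenPartialHomeomorph M H) (A : FormField I M) (y : E) :
    E →L[ℝ] E →L[ℝ] ℝ :=
  ContinuousLinearMap.bilinearComp (E := E) (F := E) (A ((e.extend I).symm y))
    (chartSymmDeriv I e y) (chartSymmDeriv I e y)

theorem localForm_apply (e : OpenPartialHomeomorph M H) (A : FormField I M) (y u v : E) :
    localForm e A y u v =
      A ((e.extend I).symm y) (mfderivWithin 𝓘(ℝ, E) I (e.extend I).symm (range I) y u)
        (mfderivWithin 𝓘(ℝ, E) I (e.extend I).symm (range I) y v) := rfl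

theorem trivializationAt_form [IsManifold I ∞ M] (A : FormField I M) (p₀ p : M)
    (hp : p ∈ (chartAt H p₀).source) :
    (trivializationAt (E →L[ℝ] E →L[ℝ] ℝ)
      (fun p : M => TangentSpace I p →L[ℝ] TangentSpace I p →L[ℝ] ℝ) p₀ ⟨p, A p⟩).2 =
      localForm (chartAt H p₀) A (extChartAt I p₀ p) := by
  have : IsManifold I 1 M := IsManifold.of_le (n := ∞) (by simp)
  rw [hom_trivializationAt_apply]
  ext u v
  have hb : p ∈ (trivializationAt E (TangentSpace I) p₀).baseSet := by simpa using hp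
  have hL := TangentBundle.symmL_trivializationAt (I := I) (𝕜 := ℝ) hp
  have hs : ∀ w : E, (trivializationAt E (TangentSpace I) p₀).symm p w =
      mfderivWithin 𝓘(ℝ, E) I (extChartAt I p₀).symm (range I) (extChartAt I p₀ p) w := fun w =>
    (Bundle.Trivialization.symmL_apply (R := ℝ) (trivializationAt E (TangentSpace I) p₀)
      hb w).symm.trans (congrArg (fun L : E →L[ℝ] E => L w) hL)
  have hpp : (extChartAt I p₀).symm (extChartAt I p₀ p) = p :=
    (extChartAt I p₀).left_inv (by simpa using hp)
  refine (inCoordinates_apply_eq₂ (F₁ := E) (F₂ := E) (F₃ := ℝ) (E₁ := TangentSpace I)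
    (E₂ := TangentSpace I) (E₃ := fun _ : M => ℝ) (x₀ := p₀) (x := p) (ϕ := A p) (v := u) (w := v)
    hb hb (mem_univ _)).trans ?_
  rw [hs, hs, localForm_apply]
  have key : ∀ q : M, q = p → ∀ w w' : E, (A q : E →L[ℝ] E →L[ℝ] ℝ) w w' =
    (A p : E →L[ℝ] E →L[ℝ] ℝ) w w' := by rintro q rfl w w'; rfl
  refine Eq.trans ?_ (key _ hpp _ _).symm
  simp
  rfl

end FormFields

section ChartSets

set_option maxSynthPendingDepth 3
set_option linter.unusedSectionVars false

variable {E : Type*} [NormedAddCommGroup E] [NormedSpace ℝ E]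
  {H : Type*} [TopologicalSpace H] {I : ModelWithCorners ℝ E H}
  {M : Type*} [TopologicalSpace M] [ChartedSpace H M]

/-- The part of the model space corresponding to `U` under the chart `e`. -/
def chartSet (I : ModelWithCorners ℝ E H) (e : OpenPartialHomeomorph M H) (U : Set M) : Set E :=
  range I ∩ I.symm ⁻¹' (e.target ∩ e.symm ⁻¹' U)

section

variable {e : OpenPartialHomeomorph M H} {U : Set M}

theorem isOpen_chartSet_aux (hU : IsOpen U) :
    IsOpen (I.symm ⁻¹' (e.target ∩ e.symm ⁻¹' U)) :=
  (e.isOpen_inter_preimage_symm hU).preimage I.continuous_symm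

theorem uniqueDiffOn_chartSet (hU : IsOpen U) : UniqueDiffOn ℝ (chartSet I e U) :=
  I.uniqueDiffOn.inter (isOpen_chartSet_aux hU)

theorem chartSet_subset_closure (hU : IsOpen U) :
    chartSet I e U ⊆ closure (interior (chartSet I e U)) := by
  have ho := isOpen_chartSet_aux (I := I) (e := e) hU
  rw [chartSet, interior_inter, ho.interior_eq]
  rintro y ⟨hy, hyU⟩
  rw [inter_comm]
  exact ho.inter_closure ⟨hyU, I.range_subset_closure_interior hy⟩

theorem mem_chartSet {p : M} (hp : p ∈ e.source) (hU : p ∈ U) : e.extend I p ∈ chartSet I e U := by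
  refine ⟨by simp, ?_⟩
  simp [hp, hU]

theorem symm_mem_of_mem_chartSet {y : E} (hy : y ∈ chartSet I e U) :
    (e.extend I).symm y ∈ U := by simpa using hy.2.2

theorem symm_mem_source_of_mem_chartSet {y : E} (hy : y ∈ chartSet I e U) :
    (e.extend I).symm y ∈ e.source := by simpa using e.map_target hy.2.1

theorem mem_target_of_mem_chartSet {y : E} (hy : y ∈ chartSet I e U) :
    y ∈ (e.extend I).target := by
  rw [e.extend_target]
  exact ⟨hy.2.1, hy.1⟩

theorem extend_symm_of_mem_chartSet {y : E} (hy : y ∈ chartSet I e U) :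
    e.extend I ((e.extend I).symm y) = y :=
  (e.extend I).right_inv (mem_target_of_mem_chartSet hy)

theorem chartSet_univ : chartSet I e univ = (e.extend I).target := by
  rw [chartSet, e.extend_target, inter_comm]
  simp

theorem chartSet_inter_chartSet {V : Set M} :
    chartSet I e (U ∩ V) = chartSet I e U ∩ I.symm ⁻¹' (e.target ∩ e.symm ⁻¹' V) := by
  ext
  simp [chartSet]
  tauto

theorem chartSet_mono {V : Set M} (h : U ⊆ V) : chartSet I e U ⊆ chartSet I e V :=
  fun _ hy => ⟨hy.1, hy.2.1, h hy.2.2⟩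

theorem chartSet_mem_nhdsWithin (hU : IsOpen U) {y : E} (hy : y ∈ chartSet I e U) :
    chartSet I e U ∈ 𝓝[range I] y :=
  inter_mem self_mem_nhdsWithin (mem_nhdsWithin_of_mem_nhds ((isOpen_chartSet_aux hU).mem_nhds hy.2))

theorem fderivWithin_chartSet {F : Type*} [NormedAddCommGroup F] [NormedSpace ℝ F] (hU : IsOpen U)
    {y : E} (hy : y ∈ chartSet I e U) (f : E → F) :
    fderivWithin ℝ f (chartSet I e U) y = fderivWithin ℝ f (range I) y :=
  fderivWithin_inter ((isOpen_chartSet_aux hU).mem_nhds hy.2)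

end

theorem contMDiffOn_extend_symm_chartSet [IsManifold I ∞ M] {e : OpenPartialHomeomorph M H}
    (he : e ∈ IsManifold.maximalAtlas I ∞ M) (U : Set M) :
    ContMDiffOn 𝓘(ℝ, E) I ∞ (e.extend I).symm (chartSet I e U) :=
  (contMDiffOn_extend_symm he).mono fun y hy => by
    rw [← e.extend_target']
    exact mem_target_of_mem_chartSet hy

theorem mdifferentiableWithinAt_extend_symm [IsManifold I ∞ M] {e : OpenPartialHomeomorph M H}
    (he : e ∈ IsManifold.maximalAtlas I ∞ M) {y : E} (hy : y ∈ (e.extend I).target) :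
    MDifferentiableWithinAt 𝓘(ℝ, E) I (e.extend I).symm (range I) y := by
  rw [← chartSet_univ] at hy
  exact ((contMDiffOn_extend_symm_chartSet he univ y hy).mdifferentiableWithinAt
    (by simp)).mono_of_mem_nhdsWithin (chartSet_mem_nhdsWithin isOpen_univ hy)

theorem contDiffOn_localForm_chartAt [IsManifold I ∞ M] {A : FormField I M}
    (hA : ContMDiff I (I.prod 𝓘(ℝ, E →L[ℝ] E →L[ℝ] ℝ)) ∞
      (fun p => Bundle.TotalSpace.mk' (E →L[ℝ] E →L[ℝ] ℝ) p (A p))) (p₀ : M) :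
    ContDiffOn ℝ ∞ (localForm (chartAt H p₀) A) (chartSet I (chartAt H p₀) univ) := by
  have h1 := (Bundle.Trivialization.contMDiffOn_section_iff (IB := I) (n := ∞) (s := A)
    (a := (chartAt H p₀).source) (trivializationAt (E →L[ℝ] E →L[ℝ] ℝ)
      (fun p : M => TangentSpace I p →L[ℝ] TangentSpace I p →L[ℝ] ℝ) p₀)
      (chartAt H p₀).open_source (by simp [hom_trivializationAt_baseSet])).1 hA.contMDiffOn
  have h2 := h1.comp (contMDiffOn_extend_symm_chartSet (IsManifold.chart_mem_maximalAtlas p₀) univ)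
    fun y hy => symm_mem_source_of_mem_chartSet hy
  refine (contMDiffOn_iff_contDiffOn.1 h2).congr fun y hy => ?_
  rw [Function.comp_apply, trivializationAt_form A p₀ _ (symm_mem_source_of_mem_chartSet hy)]
  exact congrArg _ (extend_symm_of_mem_chartSet hy).symm

theorem contMDiffAt_of_localForm [IsManifold I ∞ M] {A : FormField I M} {p₀ : M} {U : Set M}
    (hU : IsOpen U) (hp : p₀ ∈ U)
    (h : ContDiffOn ℝ ∞ (localForm (chartAt H p₀) A) (chartSet I (chartAt H p₀) U)) :
    ContMDiffAt I (I.prod 𝓘(ℝ, E →L[ℝ] E →L[ℝ] ℝ)) ∞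
      (fun p => Bundle.TotalSpace.mk' (E →L[ℝ] E →L[ℝ] ℝ) p (A p)) p₀ := by
  rw [Bundle.contMDiffAt_section]
  have hs := mem_chart_source H p₀
  have hm : MapsTo (extChartAt I p₀) ((chartAt H p₀).source ∩ U) (chartSet I (chartAt H p₀) U) :=
    fun p hp => mem_chartSet hp.1 hp.2
  have h1 := (contMDiffOn_iff_contDiffOn.2 h).comp
    ((contMDiffOn_extChartAt (I := I) (x := p₀) (n := ∞)).mono inter_subset_left) hm
  have h2 := h1.contMDiffAt (((chartAt H p₀).open_source.inter hU).mem_nhds ⟨hs, hp⟩)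
  refine h2.congr_of_eventuallyEq ?_
  filter_upwards [(chartAt H p₀).open_source.mem_nhds hs] with p hp
  exact trivializationAt_form A p₀ p hp

end ChartSets

section Pullback

set_option maxSynthPendingDepth 3
set_option linter.unusedSectionVars false

variable {E : Type*} [NormedAddCommGroup E] [NormedSpace ℝ E]
  {H : Type*} [TopologicalSpace H] {I : ModelWithCorners ℝ E H}
  {M : Type*} [TopologicalSpace M] [ChartedSpace H M] [IsManifold I ∞ M]
  {E₂ : Type*} [NormedAddCommGroup E₂] [NormedSpace ℝ E₂]
  {H₂ : Type*} [TopologicalSpace H₂] {I₂ : ModelWithCorners ℝ E₂ H₂}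
  {M₂ : Type*} [TopologicalSpace M₂] [ChartedSpace H₂ M₂] [IsManifold I₂ ∞ M₂]

/-- `A` is the pullback of `A₂` under `f`, at the point `p`. -/
def IsPullbackAt (f : M → M₂) (A : FormField I M) (A₂ : FormField I₂ M₂) (p : M) : Prop :=
  ∀ u v, A p u v = A₂ (f p) (mfderiv I I₂ f p u) (mfderiv I I₂ f p v)

variable (I I₂) in
/-- The expression of a map in charts. -/
def coordMap (e : OpenPartialHomeomorph M H) (e₂ : OpenPartialHomeomorph M₂ H₂) (f : M → M₂) :
    E → E₂ :=
  e₂.extend I₂ ∘ f ∘ (e.extend I).symm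

variable {e : OpenPartialHomeomorph M H} {e₂ : OpenPartialHomeomorph M₂ H₂} {f : M → M₂}
  {U : Set M} {U₂ : Set M₂}

theorem mapsTo_coordMap (hf : MapsTo f U (e₂.source ∩ U₂)) :
    MapsTo (coordMap I I₂ e e₂ f) (chartSet I e U) (chartSet I₂ e₂ U₂) := fun _ hy =>
  mem_chartSet (hf (symm_mem_of_mem_chartSet hy)).1 (hf (symm_mem_of_mem_chartSet hy)).2

theorem contDiffOn_coordMap (he : e ∈ IsManifold.maximalAtlas I ∞ M)
    (he₂ : e₂ ∈ IsManifold.maximalAtlas I₂ ∞ M₂) (hf : ContMDiffOn I I₂ ∞ f U)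
    (hm : MapsTo f U (e₂.source ∩ U₂)) :
    ContDiffOn ℝ ∞ (coordMap I I₂ e e₂ f) (chartSet I e U) := by
  refine contMDiffOn_iff_contDiffOn.1 ?_
  refine (OpenPartialHomeomorph.contMDiffOn_extend he₂).comp
    (hf.comp (contMDiffOn_extend_symm_chartSet he U) fun y hy => symm_mem_of_mem_chartSet hy) ?_
  exact fun y hy => (hm (symm_mem_of_mem_chartSet hy)).1

theorem mfderiv_comp_chartSymmDeriv (hU : IsOpen U) (he : e ∈ IsManifold.maximalAtlas I ∞ M)
    (he₂ : e₂ ∈ IsManifold.maximalAtlas I₂ ∞ M₂) (hf : ContMDiffOn I I₂ ∞ f U)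
    (hm : MapsTo f U (e₂.source ∩ U₂)) {y : E} (hy : y ∈ chartSet I e U) (u : E) :
    (mfderiv I I₂ f ((e.extend I).symm y) (chartSymmDeriv I e y u) : E₂) =
      chartSymmDeriv I₂ e₂ (coordMap I I₂ e e₂ f y)
        (fderivWithin ℝ (coordMap I I₂ e e₂ f) (range I) y u) := by
  have hfd : MDifferentiableAt I I₂ f ((e.extend I).symm y) :=
    ((hf _ (symm_mem_of_mem_chartSet hy)).contMDiffAt
      (hU.mem_nhds (symm_mem_of_mem_chartSet hy))).mdifferentiableAt (by simp)
  have hun : UniqueMDiffWithinAt 𝓘(ℝ, E) (range I) y :=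
    (I.uniqueDiffOn y hy.1).uniqueMDiffWithinAt
  have hed := mdifferentiableWithinAt_extend_symm he (mem_target_of_mem_chartSet hy)
  have h1 := mfderiv_comp_mfderivWithin y hfd hed hun
  have hmy := mapsTo_coordMap (I := I) (I₂ := I₂) hm hy
  have he₂d := mdifferentiableWithinAt_extend_symm he₂ (mem_target_of_mem_chartSet hmy)
  have hψ : MDifferentiableWithinAt 𝓘(ℝ, E) 𝓘(ℝ, E₂) (coordMap I I₂ e e₂ f) (range I) y :=
    (((contDiffOn_coordMap he he₂ hf hm).differentiableOn (by simp) y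
      hy).mono_of_mem_nhdsWithin (chartSet_mem_nhdsWithin hU hy)).mdifferentiableWithinAt
  have h2 := mfderivWithin_comp y he₂d hψ (fun z _ => by simp [coordMap]) hun
  have hev : ∀ z ∈ chartSet I e U, (f ∘ (e.extend I).symm) z =
      ((e₂.extend I₂).symm ∘ coordMap I I₂ e e₂ f) z := fun z hz =>
    ((e₂.extend I₂).left_inv (by
      rw [e₂.extend_source]; exact (hm (symm_mem_of_mem_chartSet hz)).1)).symm
  have h3 : mfderivWithin 𝓘(ℝ, E) I₂ (f ∘ (e.extend I).symm) (range I) y =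
      mfderivWithin 𝓘(ℝ, E) I₂ ((e₂.extend I₂).symm ∘ coordMap I I₂ e e₂ f) (range I) y :=
    Filter.EventuallyEq.mfderivWithin_eq
      (Filter.eventuallyEq_of_mem (chartSet_mem_nhdsWithin hU hy) hev) (hev y hy)
  rw [mfderivWithin_eq_fderivWithin] at h2
  exact (congrArg (fun L : E →L[ℝ] E₂ => L u) h1).symm.trans
    ((congrArg (fun L : E →L[ℝ] E₂ => L u) h3).trans
      (congrArg (fun L : E →L[ℝ] E₂ => L u) h2))

/-- The local expression of a pullback. -/
theorem localForm_pullback (hU : IsOpen U) (he : e ∈ IsManifold.maximalAtlas I ∞ M)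
    (he₂ : e₂ ∈ IsManifold.maximalAtlas I₂ ∞ M₂) (hf : ContMDiffOn I I₂ ∞ f U)
    (hm : MapsTo f U (e₂.source ∩ U₂)) {A : FormField I M} {A₂ : FormField I₂ M₂} {y : E}
    (hA : IsPullbackAt f A A₂ ((e.extend I).symm y)) (hy : y ∈ chartSet I e U) (u v : E) :
    localForm e A y u v = localForm e₂ A₂ (coordMap I I₂ e e₂ f y)
      (fderivWithin ℝ (coordMap I I₂ e e₂ f) (range I) y u)
      (fderivWithin ℝ (coordMap I I₂ e e₂ f) (range I) y v) := by
  have key : ∀ q q' : M₂, q = q' → ∀ w w' z z' : E₂, w = z → w' = z' →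
      (A₂ q : E₂ →L[ℝ] E₂ →L[ℝ] ℝ) w w' = (A₂ q' : E₂ →L[ℝ] E₂ →L[ℝ] ℝ) z z' := by
    rintro q _ rfl w w' _ _ rfl rfl; rfl
  have hq : f ((e.extend I).symm y) = (e₂.extend I₂).symm (coordMap I I₂ e e₂ f y) := by
    refine ((e₂.extend I₂).left_inv ?_).symm
    rw [e₂.extend_source]
    exact (hm (symm_mem_of_mem_chartSet hy)).1
  have h1 : localForm e A y u v =
      (A₂ (f ((e.extend I).symm y)) : E₂ →L[ℝ] E₂ →L[ℝ] ℝ)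
        (mfderiv I I₂ f ((e.extend I).symm y) (chartSymmDeriv I e y u) : E₂)
        (mfderiv I I₂ f ((e.extend I).symm y) (chartSymmDeriv I e y v) : E₂) :=
    hA (chartSymmDeriv I e y u) (chartSymmDeriv I e y v)
  exact h1.trans (key _ _ hq _ _ _ _ (mfderiv_comp_chartSymmDeriv hU he he₂ hf hm hy u)
    (mfderiv_comp_chartSymmDeriv hU he he₂ hf hm hy v))

end Pullback

section FormFamilies

set_option maxSynthPendingDepth 3
set_option linter.unusedSectionVars false

variable {E : Type*} [NormedAddCommGroup E] [NormedSpace ℝ E] [FiniteDimensional ℝ E]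
  {H : Type*} [TopologicalSpace H] {I : ModelWithCorners ℝ E H}
  {M : Type*} [TopologicalSpace M] [ChartedSpace H M] [IsManifold I ∞ M]
  {E₂ : Type*} [NormedAddCommGroup E₂] [NormedSpace ℝ E₂] [FiniteDimensional ℝ E₂]
  {H₂ : Type*} [TopologicalSpace H₂] {I₂ : ModelWithCorners ℝ E₂ H₂}
  {M₂ : Type*} [TopologicalSpace M₂] [ChartedSpace H₂ M₂] [IsManifold I₂ ∞ M₂]
  {X : Type*} [TopologicalSpace X]

/-- A family of fields of bilinear forms whose components in the chart `e` are, on `U`, smooth with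
all derivatives jointly continuous in the parameter and the point. -/
def FamSmoothIn (e : OpenPartialHomeomorph M H) (A : X → FormField I M) (U : Set M) : Prop :=
  ∀ k u v, FamC (chartSet I e U) k fun x y => localForm e (A x) y u v

/-- A family of fields of bilinear forms which is smooth near `p`, in all charts. -/
def FamSmoothAt (A : X → FormField I M) (p : M) : Prop :=
  ∀ e ∈ IsManifold.maximalAtlas I ∞ M, p ∈ e.source → ∃ U, IsOpen U ∧ p ∈ U ∧ FamSmoothIn e A U

theorem FamSmoothIn.mono {e : OpenPartialHomeomorph M H} {A : X → FormField I M} {U V : Set M}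
    (h : FamSmoothIn e A U) (hV : IsOpen V) (hVU : V ⊆ U) : FamSmoothIn e A V := fun k u v => by
  have := (h k u v).inter (isOpen_chartSet_aux (I := I) (e := e) hV)
  rwa [← chartSet_inter_chartSet, inter_eq_right.2 hVU] at this

theorem FamSmoothIn.pullback {e : OpenPartialHomeomorph M H} {e₂ : OpenPartialHomeomorph M₂ H₂}
    {f : M → M₂} {U : Set M} {U₂ : Set M₂} {A : X → FormField I M} {A₂ : X → FormField I₂ M₂}
    (h : FamSmoothIn e₂ A₂ U₂) (hU : IsOpen U) (he : e ∈ IsManifold.maximalAtlas I ∞ M)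
    (he₂ : e₂ ∈ IsManifold.maximalAtlas I₂ ∞ M₂) (hf : ContMDiffOn I I₂ ∞ f U)
    (hm : MapsTo f U (e₂.source ∩ U₂)) (hA : ∀ x, ∀ p ∈ U, IsPullbackAt f (A x) (A₂ x) p) :
    FamSmoothIn e A U := fun k u v => by
  set b := Module.finBasis ℝ E₂
  set ψ := coordMap I I₂ e e₂ f
  have hs := uniqueDiffOn_chartSet (I := I) (e := e) hU
  have hψ : ContDiffOn ℝ ∞ ψ (chartSet I e U) := contDiffOn_coordMap he he₂ hf hm
  have hψ' : ContDiffOn ℝ ∞ (fderivWithin ℝ ψ (chartSet I e U)) (chartSet I e U) :=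
    hψ.fderivWithin hs (by simp)
  have hcoord : ∀ {g : E → E₂}, ContDiffOn ℝ ∞ g (chartSet I e U) → ∀ i,
      FamC (X := X) (chartSet I e U) k fun _ y => b.coord i (g y) := fun {g} hg i =>
    FamC.of_contDiffOn hs (((LinearMap.toContinuousLinearMap (b.coord i)).contDiff.comp_contDiffOn
      hg).of_le (by exact_mod_cast le_top))
  have h1 : ∀ i j, FamC (chartSet I e U) k fun x y => localForm e₂ (A₂ x) (ψ y) (b i) (b j) :=
    fun i j => FamC.comp hs b (h k (b i) (b j)) (hcoord hψ) fun _ => mapsTo_coordMap hm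
  have h2 := FamC.sum (A := Finset.univ) hs fun i _ => FamC.sum (A := Finset.univ) hs fun j _ =>
    FamC.mul hs (FamC.mul hs (hcoord (hψ'.clm_apply (contDiffOn_const (c := u))) i)
      (hcoord (hψ'.clm_apply (contDiffOn_const (c := v))) j)) (h1 i j)
  refine h2.congr fun x y hy => ?_
  simp only [localForm_pullback hU he he₂ hf hm (hA x _ (symm_mem_of_mem_chartSet hy)) hy u v,
    fderivWithin_chartSet hU hy]
  conv_lhs => rw [← b.sum_repr (fderivWithin ℝ (coordMap I I₂ e e₂ f) (range I) y u),
    ← b.sum_repr (fderivWithin ℝ (coordMap I I₂ e e₂ f) (range I) y v)]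
  simp only [map_sum, map_smul, sum_apply, smul_apply, smul_eq_mul, Module.Basis.coord_apply,
    Finset.mul_sum]
  rw [Finset.sum_comm]
  refine Finset.sum_congr rfl fun i _ => Finset.sum_congr rfl fun j _ => ?_
  ring

theorem FamSmoothAt.pullback_of_chart {f : M → M₂} {p : M} {V : Set M} (hV : IsOpen V) (hp : p ∈ V)
    {A : X → FormField I M} {A₂ : X → FormField I₂ M₂} {e₂ : OpenPartialHomeomorph M₂ H₂}
    (he₂ : e₂ ∈ IsManifold.maximalAtlas I₂ ∞ M₂) (hpe : f p ∈ e₂.source) {U₂ : Set M₂}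
    (hU₂ : IsOpen U₂) (hpU : f p ∈ U₂) (h : FamSmoothIn e₂ A₂ U₂) (hf : ContMDiffOn I I₂ ∞ f V)
    (hA : ∀ x, ∀ p ∈ V, IsPullbackAt f (A x) (A₂ x) p) : FamSmoothAt A p := fun e he _ => by
  have hU : IsOpen (V ∩ f ⁻¹' (e₂.source ∩ U₂)) :=
    hf.continuousOn.isOpen_inter_preimage hV (e₂.open_source.inter hU₂)
  exact ⟨_, hU, ⟨hp, hpe, hpU⟩, h.pullback hU he he₂ (hf.mono inter_subset_left)
    (fun q hq => hq.2) fun x q hq => hA x q hq.1⟩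

theorem FamSmoothAt.pullback {f : M → M₂} {p : M} {V : Set M} (hV : IsOpen V) (hp : p ∈ V)
    {A : X → FormField I M} {A₂ : X → FormField I₂ M₂} (h : FamSmoothAt A₂ (f p))
    (hf : ContMDiffOn I I₂ ∞ f V) (hA : ∀ x, ∀ p ∈ V, IsPullbackAt f (A x) (A₂ x) p) :
    FamSmoothAt A p := by
  obtain ⟨U₂, hU₂, hpU, h⟩ := h _ (IsManifold.chart_mem_maximalAtlas (f p)) (mem_chart_source H₂ _)
  exact pullback_of_chart hV hp (IsManifold.chart_mem_maximalAtlas (f p)) (mem_chart_source H₂ _)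
    hU₂ hpU h hf hA

theorem isPullbackAt_id (A : FormField I M) (p : M) : IsPullbackAt id A A p := fun u v => by
  rw [mfderiv_id]
  rfl

theorem FamSmoothAt.of_chart {p : M} {A : X → FormField I M} {e : OpenPartialHomeomorph M H}
    (he : e ∈ IsManifold.maximalAtlas I ∞ M) (hpe : p ∈ e.source) {U : Set M} (hU : IsOpen U)
    (hpU : p ∈ U) (h : FamSmoothIn e A U) : FamSmoothAt A p :=
  pullback_of_chart (f := id) isOpen_univ trivial he hpe hU hpU h contMDiffOn_id
    fun _ _ _ => isPullbackAt_id _ _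

theorem FamSmoothAt.congr {p : M} {A A' : X → FormField I M} (h : FamSmoothAt A p) {V : Set M}
    (hV : IsOpen V) (hp : p ∈ V) (hA : ∀ x, ∀ q ∈ V, A' x q = A x q) : FamSmoothAt A' p :=
  pullback (f := id) hV hp h contMDiffOn_id fun x q hq => by
    have := isPullbackAt_id (A x) q
    intro u v
    rw [hA x q hq]
    exact this u v

end FormFamilies

section RiemannianMetrics

set_option maxSynthPendingDepth 3
set_option linter.unusedSectionVars false

variable {E : Type*} [NormedAddCommGroup E] [NormedSpace ℝ E] [FiniteDimensional ℝ E]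
  {H : Type*} [TopologicalSpace H] {I : ModelWithCorners ℝ E H}
  {M : Type*} [TopologicalSpace M] [ChartedSpace H M] [IsManifold I ∞ M]
  {X : Type*} [TopologicalSpace X]

theorem isVonNBounded_of_pos {B : E →L[ℝ] E →L[ℝ] ℝ} (hpos : ∀ v, v ≠ 0 → 0 < B v v) :
    Bornology.IsVonNBounded ℝ {v : E | B v v < 1} := by
  rw [NormedSpace.isVonNBounded_iff]
  obtain ⟨m, hm, hB⟩ : ∃ m > 0, ∀ v ∈ Metric.sphere (0 : E) 1, m ≤ B v v := by
    rcases (Metric.sphere (0 : E) 1).eq_empty_or_nonempty with h | h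
    · exact ⟨1, one_pos, by simp [h]⟩
    · obtain ⟨v, hv, hmin⟩ := (isCompact_sphere (0 : E) 1).exists_isMinOn h
        (f := fun v => B v v) (by fun_prop)
      exact ⟨B v v, hpos v (ne_zero_of_mem_unit_sphere ⟨v, hv⟩), fun w hw => hmin hw⟩
  refine (Metric.isBounded_closedBall (x := (0 : E)) (r := m⁻¹ + 1)).subset fun v hv => ?_
  rw [mem_closedBall_zero_iff]
  by_cases h0 : v = 0
  · rw [h0, norm_zero]
    positivity
  have hn : 0 < ‖v‖ := norm_pos_iff.2 h0
  have h1 := hB (‖v‖⁻¹ • v) (by simp [norm_smul, hn.ne'])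
  simp only [map_smul, smul_apply, smul_eq_mul] at h1
  have h2 : m * ‖v‖ ^ 2 < 1 := by
    have : m * ‖v‖ ^ 2 ≤ B v v := by
      calc m * ‖v‖ ^ 2 ≤ (‖v‖⁻¹ * (‖v‖⁻¹ * B v v)) * ‖v‖ ^ 2 := by gcongr
        _ = B v v := by field_simp
    exact this.trans_lt hv
  have h3 : ‖v‖ ^ 2 < m⁻¹ := by
    rw [lt_inv_comm₀ (by positivity) hm, ← one_div, lt_div_iff₀ (by positivity)]
    exact h2
  nlinarith [inv_pos.2 hm]

/-- Construction of a Riemannian metric from a smooth field of positive definite forms. -/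
def RiemMetric.ofForm (A : FormField I M) (symm : ∀ p v w, A p v w = A p w v)
    (pos : ∀ p v, v ≠ 0 → 0 < A p v v) (smooth : ∀ p, FamSmoothAt (fun _ : Unit => A) p) :
    RiemMetric I M where
  inner := A
  symm := symm
  pos := pos
  isVonNBounded p := isVonNBounded_of_pos (E := E) (B := A p) (pos p)
  contMDiff p := by
    obtain ⟨U, hU, hpU, h⟩ := smooth p _ (IsManifold.chart_mem_maximalAtlas p)
      (mem_chart_source H p)
    refine contMDiffAt_of_localForm hU hpU (contDiffOn_clm_apply.2 fun u =>
      contDiffOn_clm_apply.2 fun v => contDiffOn_infty.2 fun k => ?_)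
    exact (h k u v).contDiffOn (uniqueDiffOn_chartSet hU) ()

theorem RiemMetric.contDiffOn_chartAt (h : RiemMetric I M) (p : M) :
    ContDiffOn ℝ ∞ (localForm (chartAt H p) h.inner) (chartSet I (chartAt H p) univ) :=
  contDiffOn_localForm_chartAt h.contMDiff p

theorem RiemMetric.famSmoothAt (h : RiemMetric I M) (p : M) :
    FamSmoothAt (fun _ : X => h.inner) p := by
  refine FamSmoothAt.of_chart (IsManifold.chart_mem_maximalAtlas p) (mem_chart_source H p)
    isOpen_univ trivial fun k u v => ?_
  exact FamC.of_contDiffOn (uniqueDiffOn_chartSet isOpen_univ)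
    ((contDiffOn_clm_apply.1 (contDiffOn_clm_apply.1 (h.contDiffOn_chartAt p) u) v).of_le
      (by exact_mod_cast le_top))

theorem iteratedFDerivWithin_chartSet {e : OpenPartialHomeomorph M H} {U : Set M} (hU : IsOpen U)
    {y : E} (hy : y ∈ chartSet I e U) (k : ℕ) (f : E → ℝ) :
    iteratedFDerivWithin ℝ k f (chartSet I e U) y = iteratedFDerivWithin ℝ k f (range I) y :=
  iteratedFDerivWithin_inter_open (isOpen_chartSet_aux hU) hy.2

theorem RiemMetric.famSmoothAt_of_continuous {h : X → RiemMetric I M} (hc : Continuous h) (p : M) :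
    FamSmoothAt (fun x => (h x).inner) p := by
  have he := IsManifold.chart_mem_maximalAtlas (I := I) (n := ∞) p
  refine FamSmoothAt.of_chart he (mem_chart_source H p) isOpen_univ trivial fun k u v => ?_
  have hs := uniqueDiffOn_chartSet (I := I) (e := chartAt H p) isOpen_univ
  have hd : ∀ x, ContDiffOn ℝ ∞ (fun y => localForm (chartAt H p) (h x).inner y u v)
      (chartSet I (chartAt H p) univ) := fun x =>
    contDiffOn_clm_apply.1 (contDiffOn_clm_apply.1 ((h x).contDiffOn_chartAt p) u) v
  refine famC_of_iteratedFDerivWithin hs (fun x => (hd x).of_le (by exact_mod_cast le_top))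
    fun j _ m => ?_
  suffices hj : ContinuousOn (fun q : X × E => iteratedFDerivWithin ℝ j
      (fun y => localForm (chartAt H p) (h q.1).inner y u v) (chartSet I (chartAt H p) univ) q.2)
      (univ ×ˢ chartSet I (chartAt H p) univ) from
    (ContinuousMultilinearMap.apply ℝ (fun _ : Fin j => E) ℝ m).continuous.comp_continuousOn hj
  have hc' := (continuous_induced_rng.1 (continuous_iInf_rng.1 (continuous_iInf_rng.1
    (continuous_iInf_rng.1 (continuous_iInf_rng.1 hc ⟨chartAt H p, he⟩) u) v) j))
  rintro ⟨x₀, y₀⟩ ⟨-, hy₀⟩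
  obtain ⟨r, hr, hball⟩ := Metric.nhds_basis_closedBall.mem_iff.1
    ((isOpen_chartSet_aux (I := I) (e := chartAt H p) isOpen_univ).mem_nhds hy₀.2)
  have hK : IsCompact (range I ∩ Metric.closedBall y₀ r) :=
    (isCompact_closedBall y₀ r).inter_left I.isClosed_range
  have hKs : range I ∩ Metric.closedBall y₀ r ⊆ chartSet I (chartAt H p) univ :=
    inter_subset_inter_right _ hball
  have hKn : range I ∩ Metric.closedBall y₀ r ∈ 𝓝[chartSet I (chartAt H p) univ] y₀ :=
    inter_mem (mem_of_superset self_mem_nhdsWithin inter_subset_left)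
      (mem_nhdsWithin_of_mem_nhds (Metric.closedBall_mem_nhds _ hr))
  have hunif := UniformOnFun.tendsto_iff_tendstoUniformlyOn.1 (hc'.tendsto x₀) _
    ⟨hK, by rw [← chartSet_univ]; exact hKs⟩
  refine tendsto_comp_of_locally_uniform_limit_within
    (f := iteratedFDerivWithin ℝ j
      (fun y => localForm (chartAt H p) (h x₀).inner y u v) (chartSet I (chartAt H p) univ))
    (F := fun q : X × E => iteratedFDerivWithin ℝ j
      (fun y => localForm (chartAt H p) (h q.1).inner y u v) (chartSet I (chartAt H p) univ))
    (g := Prod.snd) (s := chartSet I (chartAt H p) univ) ?_ ?_ fun V hV => ⟨_, hKn, ?_⟩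
  · exact (hd x₀).continuousOn_iteratedFDerivWithin (by exact_mod_cast le_top) hs y₀ hy₀
  · exact tendsto_nhdsWithin_iff.2 ⟨(continuous_snd.tendsto (x₀, y₀)).mono_left nhdsWithin_le_nhds,
      mem_of_superset self_mem_nhdsWithin fun q hq => hq.2⟩
  · have h1 := ((continuous_fst.tendsto (x₀, y₀)).mono_left
      (nhdsWithin_le_nhds (s := univ ×ˢ chartSet I (chartAt H p) univ))).eventually (hunif V hV)
    filter_upwards [h1] with q hq y hy
    rw [iteratedFDerivWithin_chartSet isOpen_univ (hKs hy),
      iteratedFDerivWithin_chartSet isOpen_univ (hKs hy)]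
    exact hq y hy

theorem RiemMetric.continuous_of_famSmoothAt {h : X → RiemMetric I M}
    (hc : ∀ p, FamSmoothAt (fun x => (h x).inner) p) : Continuous h := by
  refine continuous_iInf_rng.2 fun e => continuous_iInf_rng.2 fun u => continuous_iInf_rng.2
    fun v => continuous_iInf_rng.2 fun k => continuous_induced_rng.2 ?_
  have hs := uniqueDiffOn_chartSet (I := I) (e := e.1) isOpen_univ
  have hF : FamC (chartSet I e.1 univ) k fun x y => localForm e.1 (h x).inner y u v := by
    refine FamC.of_local fun y hy => ?_
    obtain ⟨U, hU, hpU, hf⟩ := hc ((e.1.extend I).symm y) e.1 e.2 (symm_mem_source_of_mem_chartSet hy)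
    refine ⟨_, isOpen_chartSet_aux (I := I) (e := e.1) hU, ⟨hy.2.1, by simpa using hpU⟩, ?_⟩
    rw [← chartSet_inter_chartSet, univ_inter]
    exact hf k u v
  have hcont := hF.continuousOn_iteratedFDerivWithin hs
  refine continuous_iff_continuousAt.2 fun x₀ => UniformOnFun.tendsto_iff_tendstoUniformlyOn.2 ?_
  rintro K ⟨hK, hKt⟩ V hV
  rw [← chartSet_univ] at hKt
  obtain ⟨W, hW, hWV⟩ := hK.mem_uniformity_of_prod (s := univ) (q := x₀)
    (f := fun x y => iteratedFDerivWithin ℝ k (fun y => localForm e.1 (h x).inner y u v)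
      (chartSet I e.1 univ) y) (hcont.mono (prod_mono_right hKt)) trivial (symm_le_uniformity hV)
  rw [nhdsWithin_univ] at hW
  filter_upwards [hW] with x hx y hy
  have := hWV x hx y hy
  rw [iteratedFDerivWithin_chartSet isOpen_univ (hKt hy),
    iteratedFDerivWithin_chartSet isOpen_univ (hKt hy)] at this
  exact this

theorem chartSymmDeriv_injective {e : OpenPartialHomeomorph M H}
    (he : e ∈ IsManifold.maximalAtlas I ∞ M) {y : E} (hy : y ∈ chartSet I e univ) :
    Function.Injective (chartSymmDeriv I e y) := by
  have h1 := (mfderiv_comp_mfderivWithin y (((OpenPartialHomeomorph.contMDiffAt_extend he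
    (symm_mem_source_of_mem_chartSet hy))).mdifferentiableAt (by simp))
    (mdifferentiableWithinAt_extend_symm he (mem_target_of_mem_chartSet hy))
    (I.uniqueDiffOn y hy.1).uniqueMDiffWithinAt)
  have h2 : mfderivWithin 𝓘(ℝ, E) 𝓘(ℝ, E) (e.extend I ∘ (e.extend I).symm) (range I) y =
      ContinuousLinearMap.id ℝ E :=
    (Filter.EventuallyEq.mfderivWithin_eq (f₁ := e.extend I ∘ (e.extend I).symm) (f := id)
      (Filter.eventuallyEq_of_mem (chartSet_mem_nhdsWithin isOpen_univ hy)
        fun z hz => extend_symm_of_mem_chartSet hz) (extend_symm_of_mem_chartSet hy)).trans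
      (mfderivWithin_id (I.uniqueDiffOn y hy.1).uniqueMDiffWithinAt)
  intro u v huv
  have h3 : ∀ u : E, (mfderiv I 𝓘(ℝ, E) (e.extend I) ((e.extend I).symm y) :
      E →L[ℝ] E) (chartSymmDeriv I e y u) = u := fun u =>
    (congrArg (fun L : E →L[ℝ] E => L u) h1).symm.trans (congrArg (fun L : E →L[ℝ] E => L u) h2)
  rw [← h3 u, ← h3 v, huv]

theorem RiemMetric.localForm_pos (h : RiemMetric I M) {e : OpenPartialHomeomorph M H}
    (he : e ∈ IsManifold.maximalAtlas I ∞ M) {y : E} (hy : y ∈ chartSet I e univ) {u : E}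
    (hu : u ≠ 0) : 0 < localForm e h.inner y u u := by
  have hne : chartSymmDeriv I e y u ≠ 0 := fun h0 =>
    hu (chartSymmDeriv_injective he hy (h0.trans (map_zero (chartSymmDeriv I e y)).symm))
  exact h.pos ((e.extend I).symm y) (chartSymmDeriv I e y u) hne

theorem RiemMetric.localForm_symm (h : RiemMetric I M) (e : OpenPartialHomeomorph M H) (y u v : E) :
    localForm e h.inner y u v = localForm e h.inner y v u :=
  h.symm ((e.extend I).symm y) (chartSymmDeriv I e y u) (chartSymmDeriv I e y v)

theorem RiemMetric.isMetricOn (h : RiemMetric I M) {e : OpenPartialHomeomorph M H}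
    (he : e ∈ IsManifold.maximalAtlas I ∞ M) {U : Set M} (hU : IsOpen U) :
    IsMetricOn (chartSet I e U) (localForm e h.inner) where
  symm y _ u v := h.localForm_symm e y u v
  pos y hy u hu := h.localForm_pos he (chartSet_mono (subset_univ U) hy) hu
  smooth := by
    refine contDiffOn_clm_apply.2 fun u => contDiffOn_clm_apply.2 fun v =>
      contDiffOn_infty.2 fun k => ?_
    refine FamC.contDiffOn (X := Unit) (f := fun _ y => localForm e h.inner y u v)
      (uniqueDiffOn_chartSet hU) (FamC.of_local fun y hy => ?_) ()
    obtain ⟨V, hV, hpV, hf⟩ := h.famSmoothAt (X := Unit) ((e.extend I).symm y) e he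
      (symm_mem_source_of_mem_chartSet hy)
    refine ⟨_, isOpen_chartSet_aux (I := I) (e := e) hV, ⟨hy.2.1, by simpa using hpV⟩, ?_⟩
    rw [← chartSet_inter_chartSet]
    exact (hf.mono (hU.inter hV) inter_subset_right) k u v

end RiemannianMetrics

section ScalarCurvature

set_option maxSynthPendingDepth 3
set_option linter.unusedSectionVars false

variable {E : Type*} [NormedAddCommGroup E] [NormedSpace ℝ E] [FiniteDimensional ℝ E]
  {H : Type*} [TopologicalSpace H] {I : ModelWithCorners ℝ E H}
  {M : Type*} [TopologicalSpace M] [ChartedSpace H M] [IsManifold I ∞ M]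
  {E₂ : Type*} [NormedAddCommGroup E₂] [NormedSpace ℝ E₂] [FiniteDimensional ℝ E₂]
  {H₂ : Type*} [TopologicalSpace H₂] {I₂ : ModelWithCorners ℝ E₂ H₂}
  {M₂ : Type*} [TopologicalSpace M₂] [ChartedSpace H₂ M₂] [IsManifold I₂ ∞ M₂]
  {X : Type*} [TopologicalSpace X]
  {ι : Type*} [Fintype ι] [DecidableEq ι] {ι₂ : Type*} [Fintype ι₂] [DecidableEq ι₂]

theorem scalarCurvatureCoord_chartSet (b : Module.Basis ι ℝ E) {e : OpenPartialHomeomorph M H}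
    {U : Set M} (hU : IsOpen U) {y : E} (hy : y ∈ chartSet I e U) (A : FormField I M) :
    scalarCurvatureCoord b (fun z u v => localForm e A z u v) (range I) y =
      scalarCurvatureCoord b (fun z u v => localForm e A z u v) (chartSet I e U) y :=
  scalarCurvatureCoord_inter b (isOpen_chartSet_aux hU) hy fun _ _ => rfl

theorem scalarCurvatureCoord_pullback (b : Module.Basis ι ℝ E) (b₂ : Module.Basis ι₂ ℝ E₂)
    {h : RiemMetric I M} {h₂ : RiemMetric I₂ M₂} {f : M → M₂} {V : Set M} (hV : IsOpen V) {p : M}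
    (hp : p ∈ V) (hf : ContMDiffOn I I₂ ∞ f V)
    (hfr : Module.finrank ℝ E = Module.finrank ℝ E₂)
    (hh : ∀ q ∈ V, IsPullbackAt f h.inner h₂.inner q) {e : OpenPartialHomeomorph M H}
    (he : e ∈ IsManifold.maximalAtlas I ∞ M) (hpe : p ∈ e.source)
    {e₂ : OpenPartialHomeomorph M₂ H₂} (he₂ : e₂ ∈ IsManifold.maximalAtlas I₂ ∞ M₂)
    (hpe₂ : f p ∈ e₂.source) :
    scalarCurvatureCoord b (fun z u v => localForm e h.inner z u v) (range I) (e.extend I p) =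
      scalarCurvatureCoord b₂ (fun z u v => localForm e₂ h₂.inner z u v) (range I₂)
        (e₂.extend I₂ (f p)) := by
  have hU : IsOpen (V ∩ f ⁻¹' e₂.source) := hf.continuousOn.isOpen_inter_preimage hV e₂.open_source
  have hf' := hf.mono (inter_subset_left (s := V) (t := f ⁻¹' e₂.source))
  have hm : MapsTo f (V ∩ f ⁻¹' e₂.source) (e₂.source ∩ univ) := fun q hq => ⟨hq.2, trivial⟩
  have hpc := mem_chartSet (I := I) (U := V ∩ f ⁻¹' e₂.source) hpe ⟨hp, hpe₂⟩
  have hpc₂ := mem_chartSet (I := I₂) hpe₂ (mem_univ (f p))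
  have hiso : IsLocalIsometry (chartSet I e (V ∩ f ⁻¹' e₂.source)) (localForm e h.inner)
      (chartSet I₂ e₂ univ) (localForm e₂ h₂.inner) (coordMap I I₂ e e₂ f) :=
    { uniqueDiffOn := uniqueDiffOn_chartSet hU
      uniqueDiffOn₂ := uniqueDiffOn_chartSet isOpen_univ
      subset_closure := chartSet_subset_closure hU
      metric := h.isMetricOn he hU
      metric₂ := h₂.isMetricOn he₂ isOpen_univ
      smooth := contDiffOn_coordMap he he₂ hf' hm
      mapsTo := mapsTo_coordMap hm
      finrank_eq := hfr
      form_eq := fun y hy u v => by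
        rw [localForm_pullback hU he he₂ hf' hm (hh _ (symm_mem_of_mem_chartSet hy).1) hy u v,
          fderivWithin_chartSet hU hy] }
  rw [scalarCurvatureCoord_chartSet b hU hpc, scalarCurvatureCoord_chartSet b₂ isOpen_univ hpc₂,
    hiso.scalarCurvatureCoord_eq b b₂ hpc]
  congr 1
  simp only [coordMap, Function.comp_apply]
  rw [(e.extend I).left_inv (by rwa [e.extend_source])]

/-- Scalar curvature is natural with respect to local isometries. -/
theorem scal_eq_of_pullback {h : RiemMetric I M} {h₂ : RiemMetric I₂ M₂} {f : M → M₂} {V : Set M}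
    (hV : IsOpen V) {p : M} (hp : p ∈ V) (hf : ContMDiffOn I I₂ ∞ f V)
    (hfr : Module.finrank ℝ E = Module.finrank ℝ E₂)
    (hh : ∀ q ∈ V, IsPullbackAt f h.inner h₂.inner q) : scal h p = scal h₂ (f p) :=
  scalarCurvatureCoord_pullback _ _ hV hp hf hfr hh (IsManifold.chart_mem_maximalAtlas p)
    (mem_chart_source H p) (IsManifold.chart_mem_maximalAtlas (f p)) (mem_chart_source H₂ (f p))

/-- Scalar curvature can be computed in any chart. -/
theorem scal_eq_of_chart (b : Module.Basis ι ℝ E) (h : RiemMetric I M) {p : M}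
    {e : OpenPartialHomeomorph M H} (he : e ∈ IsManifold.maximalAtlas I ∞ M) (hpe : p ∈ e.source) :
    scal h p =
      scalarCurvatureCoord b (fun z u v => localForm e h.inner z u v) (range I) (e.extend I p) :=
  scalarCurvatureCoord_pullback _ b (f := id) isOpen_univ trivial contMDiffOn_id rfl
    (fun q _ => isPullbackAt_id _ q) (IsManifold.chart_mem_maximalAtlas p) (mem_chart_source H p)
    he hpe

theorem scal_congr {h h' : RiemMetric I M} {V : Set M} (hV : IsOpen V) {p : M} (hp : p ∈ V)
    (hh : ∀ q ∈ V, h.inner q = h'.inner q) : scal h p = scal h' p :=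
  scal_eq_of_pullback (f := id) hV hp contMDiffOn_id rfl fun q hq => by
    have := isPullbackAt_id h'.inner q
    intro u v
    rw [hh q hq]
    exact this u v

theorem continuous_scal {h : X → RiemMetric I M} (hc : Continuous h) :
    Continuous fun q : X × M => scal (h q.1) q.2 := by
  refine continuous_iff_continuousAt.2 fun ⟨x₀, p₀⟩ => ?_
  have he := IsManifold.chart_mem_maximalAtlas (I := I) (n := ∞) p₀
  have hps := mem_chart_source H p₀
  obtain ⟨U, hU, hpU, hf⟩ := RiemMetric.famSmoothAt_of_continuous hc p₀ _ he hps
  have h1 := continuousOn_scalarCurvatureCoord (uniqueDiffOn_chartSet hU) (Module.finBasis ℝ E)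
    (fun x => (h x).isMetricOn he hU) (hf 2)
  have hV : IsOpen ((univ : Set X) ×ˢ ((chartAt H p₀).source ∩ U)) :=
    isOpen_univ.prod ((chartAt H p₀).open_source.inter hU)
  have h2 : ContinuousOn (fun q : X × M => (q.1, (chartAt H p₀).extend I q.2))
      ((univ : Set X) ×ˢ ((chartAt H p₀).source ∩ U)) := by
    refine continuousOn_fst.prodMk ?_
    exact (OpenPartialHomeomorph.continuousOn_extend (f := chartAt H p₀)).comp continuousOn_snd
      fun q hq => by rw [OpenPartialHomeomorph.extend_source]; exact hq.2.1
  have h3 := h1.comp h2 fun q hq => ⟨trivial, mem_chartSet hq.2.1 hq.2.2⟩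
  refine (h3.congr fun q hq => ?_).continuousAt (hV.mem_nhds ⟨trivial, hps, hpU⟩)
  rw [scal_eq_of_chart (Module.finBasis ℝ E) (h q.1) he hq.2.1,
    scalarCurvatureCoord_chartSet _ hU (mem_chartSet hq.2.1 hq.2.2)]
  rfl

end ScalarCurvature

section FormOperations

set_option maxSynthPendingDepth 3
set_option linter.unusedSectionVars false

variable {E : Type*} [NormedAddCommGroup E] [NormedSpace ℝ E] [FiniteDimensional ℝ E]
  {H : Type*} [TopologicalSpace H] {I : ModelWithCorners ℝ E H}
  {M : Type*} [TopologicalSpace M] [ChartedSpace H M] [IsManifold I ∞ M]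
  {X : Type*} [TopologicalSpace X]

/-- The sum of two fields of bilinear forms. -/
def FormField.add (A A' : FormField I M) : FormField I M := fun p => A p + A' p

/-- A field of bilinear forms multiplied by a function. -/
def FormField.smul (a : M → ℝ) (A : FormField I M) : FormField I M := fun p => a p • A p

theorem FamSmoothAt.add {A A' : X → FormField I M} {p : M} (hA : FamSmoothAt A p)
    (hA' : FamSmoothAt A' p) : FamSmoothAt (fun x => (A x).add (A' x)) p := fun e he hp => by
  obtain ⟨U, hU, hpU, h⟩ := hA e he hp
  obtain ⟨U', hU', hpU', h'⟩ := hA' e he hp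
  refine ⟨U ∩ U', hU.inter hU', ⟨hpU, hpU'⟩, fun k u v => ?_⟩
  exact FamC.add (uniqueDiffOn_chartSet (hU.inter hU'))
    (h.mono (hU.inter hU') inter_subset_left k u v)
    (h'.mono (hU.inter hU') inter_subset_right k u v)

theorem FamSmoothAt.smul {A : X → FormField I M} {p : M} (hA : FamSmoothAt A p)
    {a : X → ℝ → ℝ} (ha : ∀ k, FamC univ k a) {τ : M → ℝ} (hτ : ContMDiff I 𝓘(ℝ, ℝ) ∞ τ) :
    FamSmoothAt (fun x => FormField.smul (fun q => a x (τ q)) (A x)) p := fun e he hp => by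
  obtain ⟨U, hU, hpU, h⟩ := hA e he hp
  refine ⟨U, hU, hpU, fun k u v => ?_⟩
  have hs := uniqueDiffOn_chartSet (I := I) (e := e) hU
  have hτ' : ContDiffOn ℝ ∞ (fun y => τ ((e.extend I).symm y)) (chartSet I e U) :=
    contMDiffOn_iff_contDiffOn.1 (hτ.comp_contMDiffOn (contMDiffOn_extend_symm_chartSet he U))
  have h1 : FamC (chartSet I e U) k fun x y => a x (τ ((e.extend I).symm y)) := by
    refine FamC.comp hs (Module.Basis.singleton Unit ℝ) (ha k)
      (p := fun _ y => τ ((e.extend I).symm y)) (fun i => ?_) (fun _ _ _ => trivial)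
    simpa using FamC.of_contDiffOn hs (hτ'.of_le (by exact_mod_cast le_top))
  exact FamC.mul hs h1 (h k u v)

end FormOperations

section Products

set_option maxSynthPendingDepth 3
set_option linter.unusedSectionVars false

variable {E : Type*} [NormedAddCommGroup E] [NormedSpace ℝ E] [FiniteDimensional ℝ E]
  {H : Type*} [TopologicalSpace H] {J : ModelWithCorners ℝ E H}
  {N : Type*} [TopologicalSpace N] [ChartedSpace H N] [IsManifold J ∞ N]
  {X : Type*} [TopologicalSpace X]

/-- The pullback of a form on `N` to `N × ℝ`. -/
def FormField.fst (A : FormField J N) : FormField (J.prod 𝓘(ℝ, ℝ)) (N × ℝ) := fun p =>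
  ContinuousLinearMap.bilinearComp (E := E) (F := E) (A p.1)
    (ContinuousLinearMap.fst ℝ E ℝ) (ContinuousLinearMap.fst ℝ E ℝ)

/-- The form `dt²` on `ℝ`. -/
def lineForm : FormField 𝓘(ℝ, ℝ) ℝ := fun _ => ContinuousLinearMap.mul ℝ ℝ

variable (J N) in
/-- The form `dt²` on `N × ℝ`. -/
def dtForm : FormField (J.prod 𝓘(ℝ, ℝ)) (N × ℝ) := fun _ =>
  ContinuousLinearMap.bilinearComp (E := ℝ) (F := ℝ) (ContinuousLinearMap.mul ℝ ℝ)
    (ContinuousLinearMap.snd ℝ E ℝ) (ContinuousLinearMap.snd ℝ E ℝ)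

theorem isPullbackAt_fst (A : FormField J N) (p : N × ℝ) : IsPullbackAt Prod.fst A.fst A p :=
  fun u v => by rw [mfderiv_fst]; rfl

theorem isPullbackAt_dt (p : N × ℝ) : IsPullbackAt Prod.snd (dtForm J N) lineForm p :=
  fun u v => by rw [mfderiv_snd]; rfl

theorem localForm_lineForm (y u v : ℝ) :
    localForm (I := 𝓘(ℝ, ℝ)) (OpenPartialHomeomorph.refl ℝ) lineForm y u v = u * v := by
  have h : chartSymmDeriv 𝓘(ℝ, ℝ) (OpenPartialHomeomorph.refl ℝ) y = ContinuousLinearMap.id ℝ ℝ :=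
    mfderivWithin_id (by simpa using uniqueMDiffWithinAt_univ 𝓘(ℝ, ℝ))
  simp only [localForm, h]
  rfl

theorem FamSmoothAt.fst {A : X → FormField J N} {p : N × ℝ} (hA : FamSmoothAt A p.1) :
    FamSmoothAt (fun x => (A x).fst) p :=
  hA.pullback isOpen_univ trivial contMDiffOn_fst fun _ _ _ => isPullbackAt_fst _ _

theorem refl_mem_maximalAtlas :
    OpenPartialHomeomorph.refl ℝ ∈ IsManifold.maximalAtlas 𝓘(ℝ, ℝ) ∞ ℝ :=
  IsManifold.subset_maximalAtlas (by simp)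

theorem famSmoothAt_dtForm (p : N × ℝ) : FamSmoothAt (fun _ : X => dtForm J N) p := by
  have h : FamSmoothAt (I := 𝓘(ℝ, ℝ)) (fun _ : X => lineForm) p.2 := by
    refine FamSmoothAt.of_chart refl_mem_maximalAtlas trivial isOpen_univ trivial fun k u v => ?_
    simp only [localForm_lineForm]
    exact FamC.of_contDiffOn (uniqueDiffOn_chartSet isOpen_univ) contDiffOn_const
  exact h.pullback isOpen_univ trivial contMDiffOn_snd fun _ _ _ => isPullbackAt_dt _

/-- The product of a chart of `N` with `ℝ`. -/
def prodLine (e : OpenPartialHomeomorph N H) : OpenPartialHomeomorph (N × ℝ) (ModelProd H ℝ) :=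
  e.prod (OpenPartialHomeomorph.refl ℝ)

theorem prodLine_mem_maximalAtlas {e : OpenPartialHomeomorph N H}
    (he : e ∈ IsManifold.maximalAtlas J ∞ N) :
    prodLine e ∈ IsManifold.maximalAtlas (J.prod 𝓘(ℝ, ℝ)) ∞ (N × ℝ) :=
  IsManifold.mem_maximalAtlas_prod he refl_mem_maximalAtlas

theorem chartSet_prod (e : OpenPartialHomeomorph N H) (T : Set ℝ) :
    chartSet (J.prod 𝓘(ℝ, ℝ)) (prodLine e) (univ ×ˢ T) =
      chartSet J e univ ×ˢ T := by
  ext ⟨y, t⟩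
  constructor
  · rintro ⟨⟨⟨z, r⟩, hz⟩, ⟨h1, -⟩, -, h2⟩
    exact ⟨⟨⟨z, (Prod.ext_iff.1 hz).1⟩, h1, trivial⟩, h2⟩
  · rintro ⟨⟨⟨z, hz⟩, h1, -⟩, h2⟩
    exact ⟨⟨(z, t), Prod.ext hz rfl⟩, ⟨h1, trivial⟩, trivial, h2⟩

theorem localForm_fst {e : OpenPartialHomeomorph N H} (he : e ∈ IsManifold.maximalAtlas J ∞ N)
    (A : FormField J N) {y : E × ℝ} (hy : y.1 ∈ chartSet J e univ) (u v : E × ℝ) :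
    localForm (prodLine e) A.fst y u v = localForm e A y.1 u.1 v.1 := by
  have he' := prodLine_mem_maximalAtlas he
  set e' := prodLine e
  have hU : IsOpen ((univ : Set (N × ℝ)) ∩ Prod.fst ⁻¹' e.source) :=
    isOpen_univ.inter (e.open_source.preimage continuous_fst)
  have hm : MapsTo Prod.fst ((univ : Set (N × ℝ)) ∩ Prod.fst ⁻¹' e.source) (e.source ∩ univ) :=
    fun q hq => ⟨hq.2, trivial⟩
  have hs : ∀ z : E × ℝ, z.1 ∈ chartSet J e univ →
      z ∈ chartSet (J.prod 𝓘(ℝ, ℝ)) e' (univ ∩ Prod.fst ⁻¹' e.source) := fun z hz => by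
    have h1 : z ∈ chartSet (J.prod 𝓘(ℝ, ℝ)) e' (univ ×ˢ univ) := by
      rw [chartSet_prod]
      exact ⟨hz, trivial⟩
    refine ⟨h1.1, h1.2.1, trivial, ?_⟩
    exact (e.map_target hz.2.1 :)
  have hc : ∀ z : E × ℝ, z.1 ∈ chartSet J e univ → coordMap (J.prod 𝓘(ℝ, ℝ)) J e' e Prod.fst z =
      z.1 := fun z hz => extend_symm_of_mem_chartSet hz
  have hd : fderivWithin ℝ (coordMap (J.prod 𝓘(ℝ, ℝ)) J e' e Prod.fst) (range (J.prod 𝓘(ℝ, ℝ))) y =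
      ContinuousLinearMap.fst ℝ E ℝ := by
    have hu := uniqueDiffOn_chartSet (I := J.prod 𝓘(ℝ, ℝ)) (e := e') hU y (hs y hy)
    rw [← fderivWithin_chartSet hU (hs y hy), ← fderivWithin_fst hu]
    refine fderivWithin_congr (fun z hz => ?_) (hc y hy)
    refine hc z ?_
    have h1 := chartSet_mono (I := J.prod 𝓘(ℝ, ℝ)) (e := e') (subset_univ _) hz
    rw [← univ_prod_univ, chartSet_prod] at h1
    exact h1.1
  rw [localForm_pullback hU he' he contMDiffOn_fst hm (isPullbackAt_fst A _) (hs y hy) u v, hd,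
    hc y hy]
  rfl

theorem localForm_dt {e : OpenPartialHomeomorph N H} (he : e ∈ IsManifold.maximalAtlas J ∞ N)
    {y : E × ℝ} (hy : y.1 ∈ chartSet J e univ) (u v : E × ℝ) :
    localForm (prodLine e) (dtForm J N) y u v = u.2 * v.2 := by
  have he' := prodLine_mem_maximalAtlas he
  set e' := prodLine e
  have hm : MapsTo Prod.snd (univ : Set (N × ℝ))
    ((OpenPartialHomeomorph.refl ℝ).source ∩ univ) := fun q hq => ⟨trivial, trivial⟩
  have hs : y ∈ chartSet (J.prod 𝓘(ℝ, ℝ)) e' univ := by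
    rw [← univ_prod_univ, chartSet_prod]
    exact ⟨hy, trivial⟩
  have hd : fderivWithin ℝ (coordMap (J.prod 𝓘(ℝ, ℝ)) 𝓘(ℝ, ℝ) e' (OpenPartialHomeomorph.refl ℝ)
      Prod.snd) (range (J.prod 𝓘(ℝ, ℝ))) y = ContinuousLinearMap.snd ℝ E ℝ :=
    fderivWithin_snd ((J.prod 𝓘(ℝ, ℝ)).uniqueDiffOn y hs.1)
  rw [localForm_pullback isOpen_univ he' refl_mem_maximalAtlas contMDiffOn_snd hm
    (isPullbackAt_dt _) hs u v, hd, localForm_lineForm]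
  rfl

/-- The form `(1 - p(t)) A₀ + p(t) A₁ + f(t) dt²` on `N × ℝ`. -/
def cylForm (p f : ℝ → ℝ) (A₀ A₁ : FormField J N) : FormField (J.prod 𝓘(ℝ, ℝ)) (N × ℝ) :=
  ((FormField.smul (fun q => 1 - p q.2) A₀.fst).add (FormField.smul (fun q => p q.2) A₁.fst)).add
    (FormField.smul (fun q => f q.2) (dtForm J N))

theorem cylForm_apply (p f : ℝ → ℝ) (A₀ A₁ : FormField J N) (q : N × ℝ) (u v : E × ℝ) :
    (cylForm p f A₀ A₁ q : E × ℝ →L[ℝ] E × ℝ →L[ℝ] ℝ) u v =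
      (1 - p q.2) * (A₀ q.1 : E →L[ℝ] E →L[ℝ] ℝ) u.1 v.1 +
        p q.2 * (A₁ q.1 : E →L[ℝ] E →L[ℝ] ℝ) u.1 v.1 + f q.2 * (u.2 * v.2) := rfl

theorem famSmoothAt_cylForm {p f : X → ℝ → ℝ} (hp : ∀ k, FamC univ k p) (hf : ∀ k, FamC univ k f)
    {A₀ A₁ : X → FormField J N} {q : N × ℝ} (hA₀ : FamSmoothAt A₀ q.1) (hA₁ : FamSmoothAt A₁ q.1) :
    FamSmoothAt (fun x => cylForm (p x) (f x) (A₀ x) (A₁ x)) q :=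
  ((hA₀.fst.smul (fun k => (FamC.sub uniqueDiffOn_univ (FamC.of_contDiffOn uniqueDiffOn_univ
    contDiffOn_const) (hp k) : FamC univ k fun x t => 1 - p x t)) contMDiff_snd).add
    (hA₁.fst.smul hp contMDiff_snd)).add ((famSmoothAt_dtForm q).smul hf contMDiff_snd)

theorem cylForm_symm (p f : ℝ → ℝ) (g₀ g₁ : RiemMetric J N) (q : N × ℝ) (u v : E × ℝ) :
    (cylForm p f g₀.inner g₁.inner q : E × ℝ →L[ℝ] E × ℝ →L[ℝ] ℝ) u v =
      (cylForm p f g₀.inner g₁.inner q : E × ℝ →L[ℝ] E × ℝ →L[ℝ] ℝ) v u := by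
  have h0 : (g₀.inner q.1 : E →L[ℝ] E →L[ℝ] ℝ) u.1 v.1 = (g₀.inner q.1 : E →L[ℝ] E →L[ℝ] ℝ) v.1 u.1 :=
    g₀.symm q.1 _ _
  have h1 : (g₁.inner q.1 : E →L[ℝ] E →L[ℝ] ℝ) u.1 v.1 = (g₁.inner q.1 : E →L[ℝ] E →L[ℝ] ℝ) v.1 u.1 :=
    g₁.symm q.1 _ _
  rw [cylForm_apply, cylForm_apply, h0, h1, mul_comm u.2]

theorem RiemMetric.inner_self_nonneg (g : RiemMetric J N) (x : N) (v : E) :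
    0 ≤ (g.inner x : E →L[ℝ] E →L[ℝ] ℝ) v v := by
  by_cases hv : v = 0
  · exact (congrArg (fun w : E => (g.inner x : E →L[ℝ] E →L[ℝ] ℝ) w w) hv |>.trans
      (map_zero ((g.inner x : E →L[ℝ] E →L[ℝ] ℝ) 0))).ge
  · exact (g.pos x v hv).le

theorem convexComb_pos {a b l : ℝ} (ha : 0 < a) (hb : 0 < b) (hl : l ∈ Icc (0 : ℝ) 1) :
    0 < (1 - l) * a + l * b := by
  rcases hl.1.eq_or_lt with h | h
  · simpa [← h] using ha
  · exact add_pos_of_nonneg_of_pos (mul_nonneg (by linarith [hl.2]) ha.le) (mul_pos h hb)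

theorem cylForm_pos {p f : ℝ → ℝ} (hp : ∀ t, p t ∈ Icc (0 : ℝ) 1) (hf : ∀ t, 0 < f t)
    (g₀ g₁ : RiemMetric J N) (q : N × ℝ) (u : E × ℝ) (hu : u ≠ 0) :
    0 < (cylForm p f g₀.inner g₁.inner q : E × ℝ →L[ℝ] E × ℝ →L[ℝ] ℝ) u u := by
  rw [cylForm_apply]
  by_cases h : u.1 = 0
  · have h2 : u.2 ≠ 0 := fun h2 => hu (Prod.ext h h2)
    have h3 := g₀.inner_self_nonneg q.1 u.1
    have h4 := g₁.inner_self_nonneg q.1 u.1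
    have h5 : 0 < f q.2 * (u.2 * u.2) := mul_pos (hf _) (mul_self_pos.2 h2)
    have := mul_nonneg (sub_nonneg.2 (hp q.2).2) h3
    have := mul_nonneg (hp q.2).1 h4
    linarith
  · exact add_pos_of_pos_of_nonneg (convexComb_pos (g₀.pos q.1 u.1 h) (g₁.pos q.1 u.1 h) (hp q.2))
      (mul_nonneg (hf _).le (mul_self_nonneg _))

/-- The metric `(1 - p(t)) g₀ + p(t) g₁ + f(t) dt²` on `N × ℝ`. -/
def cylMetric (p f : ℝ → ℝ) (hp : ContDiff ℝ ∞ p) (hp' : ∀ t, p t ∈ Icc (0 : ℝ) 1)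
    (hf : ContDiff ℝ ∞ f) (hf' : ∀ t, 0 < f t) (g₀ g₁ : RiemMetric J N) :
    RiemMetric (J.prod 𝓘(ℝ, ℝ)) (N × ℝ) :=
  RiemMetric.ofForm (cylForm p f g₀.inner g₁.inner) (cylForm_symm p f g₀ g₁)
    (cylForm_pos hp' hf' g₀ g₁) fun q => famSmoothAt_cylForm
      (fun _ => FamC.of_contDiffOn uniqueDiffOn_univ
        (hp.contDiffOn.of_le (by exact_mod_cast le_top)))
      (fun _ => FamC.of_contDiffOn uniqueDiffOn_univ
        (hf.contDiffOn.of_le (by exact_mod_cast le_top)))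
      (g₀.famSmoothAt q.1) (g₁.famSmoothAt q.1)

theorem cylMetric_apply {p f : ℝ → ℝ} (hp : ContDiff ℝ ∞ p) (hp' : ∀ t, p t ∈ Icc (0 : ℝ) 1)
    (hf : ContDiff ℝ ∞ f) (hf' : ∀ t, 0 < f t) (g₀ g₁ : RiemMetric J N) (q : N × ℝ)
    (u v : E × ℝ) :
    ((cylMetric p f hp hp' hf hf' g₀ g₁).inner q : E × ℝ →L[ℝ] E × ℝ →L[ℝ] ℝ) u v =
      (1 - p q.2) * (g₀.inner q.1 : E →L[ℝ] E →L[ℝ] ℝ) u.1 v.1 +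
        p q.2 * (g₁.inner q.1 : E →L[ℝ] E →L[ℝ] ℝ) u.1 v.1 + f q.2 * (u.2 * v.2) := rfl

theorem continuous_cylMetric {p f : X → ℝ → ℝ} (hp : ∀ x, ContDiff ℝ ∞ (p x))
    (hp' : ∀ x t, p x t ∈ Icc (0 : ℝ) 1) (hf : ∀ x, ContDiff ℝ ∞ (f x)) (hf' : ∀ x t, 0 < f x t)
    {g₀ g₁ : X → RiemMetric J N} (hpC : ∀ k, FamC univ k p) (hfC : ∀ k, FamC univ k f)
    (hg₀ : Continuous g₀) (hg₁ : Continuous g₁) :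
    Continuous fun x => cylMetric (p x) (f x) (hp x) (hp' x) (hf x) (hf' x) (g₀ x) (g₁ x) :=
  RiemMetric.continuous_of_famSmoothAt fun q => famSmoothAt_cylForm hpC hfC
    (RiemMetric.famSmoothAt_of_continuous hg₀ q.1) (RiemMetric.famSmoothAt_of_continuous hg₁ q.1)

/-- The metric `(1 - l) g₀ + l g₁`. -/
def mixMetric (l : unitInterval) (g₀ g₁ : RiemMetric J N) : RiemMetric J N :=
  RiemMetric.ofForm ((FormField.smul (fun _ => 1 - l) g₀.inner).add
      (FormField.smul (fun _ => l) g₁.inner))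
    (fun x v w => congrArg₂ (· + ·) (congrArg ((1 - l : ℝ) * ·) (g₀.symm x v w))
      (congrArg ((l : ℝ) * ·) (g₁.symm x v w)))
    (fun x v hv => convexComb_pos (g₀.pos x v hv) (g₁.pos x v hv) l.2)
    fun x => ((g₀.famSmoothAt x).smul (a := fun _ _ => 1 - l) (fun _ => FamC.of_contDiffOn
        uniqueDiffOn_univ contDiffOn_const) (τ := fun _ => 0) contMDiff_const).add
      ((g₁.famSmoothAt x).smul (a := fun _ _ => l) (fun _ => FamC.of_contDiffOn
        uniqueDiffOn_univ contDiffOn_const) (τ := fun _ => 0) contMDiff_const)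

theorem mixMetric_apply (l : unitInterval) (g₀ g₁ : RiemMetric J N) (x : N) (v w : E) :
    ((mixMetric l g₀ g₁).inner x : E →L[ℝ] E →L[ℝ] ℝ) v w =
      (1 - l) * (g₀.inner x : E →L[ℝ] E →L[ℝ] ℝ) v w +
        l * (g₁.inner x : E →L[ℝ] E →L[ℝ] ℝ) v w := rfl

theorem continuous_mixMetric {l : X → unitInterval} (hl : Continuous l)
    {g₀ g₁ : X → RiemMetric J N} (hg₀ : Continuous g₀) (hg₁ : Continuous g₁) :
    Continuous fun x => mixMetric (l x) (g₀ x) (g₁ x) :=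
  RiemMetric.continuous_of_famSmoothAt fun q =>
    ((RiemMetric.famSmoothAt_of_continuous hg₀ q).smul (a := fun x _ => 1 - l x)
      (fun _ => FamC.param (by fun_prop)) (τ := fun _ => 0) contMDiff_const).add
      ((RiemMetric.famSmoothAt_of_continuous hg₁ q).smul (a := fun x _ => l x)
        (fun _ => FamC.param (by fun_prop)) (τ := fun _ => 0) contMDiff_const)

theorem localForm_product {e : OpenPartialHomeomorph N H}
    (he : e ∈ IsManifold.maximalAtlas J ∞ N) {A : FormField (J.prod 𝓘(ℝ, ℝ)) (N × ℝ)}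
    {B : FormField J N} {f : ℝ → ℝ} {y : E × ℝ}
    (hA : ∀ q : N × ℝ, q.2 = y.2 → ∀ u v : E × ℝ, (A q : E × ℝ →L[ℝ] E × ℝ →L[ℝ] ℝ) u v =
      (B q.1 : E →L[ℝ] E →L[ℝ] ℝ) u.1 v.1 + f q.2 * (u.2 * v.2))
    (hy : y.1 ∈ chartSet J e univ) (u v : E × ℝ) :
    localForm (prodLine e) A y u v = localForm e B y.1 u.1 v.1 + f y.2 * (u.2 * v.2) := by
  have h2 : ((((prodLine e).extend (J.prod 𝓘(ℝ, ℝ))).symm y : N × ℝ)).2 = y.2 := rfl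
  have h1 := hA (((prodLine e).extend (J.prod 𝓘(ℝ, ℝ))).symm y) h2
    (chartSymmDeriv (J.prod 𝓘(ℝ, ℝ)) (prodLine e) y u)
    (chartSymmDeriv (J.prod 𝓘(ℝ, ℝ)) (prodLine e) y v)
  rw [h2] at h1
  rw [← localForm_fst he B hy, ← localForm_dt he hy u v]
  exact h1

theorem scal_of_product {W : RiemMetric (J.prod 𝓘(ℝ, ℝ)) (N × ℝ)} {g : RiemMetric J N}
    {f : ℝ → ℝ} (hf : ContDiff ℝ ∞ f) (hf' : ∀ t, 0 < f t) {T : Set ℝ} (hT : IsOpen T)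
    (hW : ∀ q : N × ℝ, q.2 ∈ T → ∀ u v : E × ℝ,
      (W.inner q : E × ℝ →L[ℝ] E × ℝ →L[ℝ] ℝ) u v =
        (g.inner q.1 : E →L[ℝ] E →L[ℝ] ℝ) u.1 v.1 + f q.2 * (u.2 * v.2)) {q : N × ℝ}
    (hq : q.2 ∈ T) : scal W q = scal g q.1 := by
  have he := IsManifold.chart_mem_maximalAtlas (I := J) (n := ∞) q.1
  have hq1 := mem_chart_source H q.1
  set e := chartAt H q.1
  have he' := prodLine_mem_maximalAtlas he
  have hTo : IsOpen ((univ : Set N) ×ˢ T) := isOpen_univ.prod hT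
  have hqe : q ∈ (prodLine e).source := ⟨hq1, trivial⟩
  have hmem := mem_chartSet (I := J.prod 𝓘(ℝ, ℝ)) (U := univ ×ˢ T) hqe ⟨trivial, hq⟩
  have hpm : IsProductMetric (chartSet J e univ) (localForm e g.inner) T f
      (localForm (prodLine e) W.inner) :=
    { uniqueDiffOn := uniqueDiffOn_chartSet isOpen_univ
      isOpen := hT
      metric := g.isMetricOn he isOpen_univ
      metric₂ := by
        rw [← chartSet_prod]
        exact W.isMetricOn he' hTo
      contDiff := hf
      pos := hf'
      form_eq := fun y hy => localForm_product he
        (fun q hq => hW q (hq ▸ hy.2)) hy.1 }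
  rw [scal_eq_of_chart (Module.finBasis ℝ (E × ℝ)) W he' hqe,
    scalarCurvatureCoord_chartSet _ hTo hmem,
    scal_eq_of_chart (Module.finBasis ℝ E) g he hq1,
    scalarCurvatureCoord_chartSet _ isOpen_univ (mem_chartSet hq1 trivial)]
  rw [chartSet_prod] at hmem ⊢
  exact hpm.scalarCurvatureCoord_eq _ _ hmem

end Products

section Collars

set_option maxSynthPendingDepth 3
set_option linter.unusedSectionVars false

variable {E : Type*} [NormedAddCommGroup E] [NormedSpace ℝ E] [FiniteDimensional ℝ E]
  {H : Type*} [TopologicalSpace H] {I : ModelWithCorners ℝ E H}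
  {E' : Type*} [NormedAddCommGroup E'] [NormedSpace ℝ E'] [FiniteDimensional ℝ E']
  {H' : Type*} [TopologicalSpace H'] {J : ModelWithCorners ℝ E' H'}
  {M : Type*} [TopologicalSpace M] [ChartedSpace H M] [IsManifold I ∞ M]
  {N : Type*} [TopologicalSpace N] [ChartedSpace H' N] [IsManifold J ∞ N]
  {X : Type*} [TopologicalSpace X]

namespace Collar

variable (φ : Collar I J M N)

theorem mem_source {x : N} {t : ℝ} (ht : t ∈ Ico (0 : ℝ) 1) : (x, t) ∈ φ.toPartialEquiv.source := by
  rw [φ.source_eq]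
  exact ⟨trivial, ht⟩

theorem mem_target {x : N} {t : ℝ} (ht : t ∈ Ico (0 : ℝ) 1) :
    φ.toPartialEquiv (x, t) ∈ φ.toPartialEquiv.target :=
  φ.toPartialEquiv.map_source (φ.mem_source ht)

theorem symm_apply {x : N} {t : ℝ} (ht : t ∈ Ico (0 : ℝ) 1) :
    φ.toPartialEquiv.symm (φ.toPartialEquiv (x, t)) = (x, t) :=
  φ.toPartialEquiv.left_inv (φ.mem_source ht)

theorem exists_eq {p : M} (hp : p ∈ φ.toPartialEquiv.target) :
    ∃ x : N, ∃ t ∈ Ico (0 : ℝ) 1, φ.toPartialEquiv (x, t) = p := by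
  have h := φ.toPartialEquiv.map_target hp
  rw [φ.source_eq] at h
  exact ⟨_, _, h.2, φ.toPartialEquiv.right_inv hp⟩

/-- The derivative of the inverse of the collar. -/
def symmDeriv (p : M) : E →L[ℝ] E' × ℝ :=
  mfderiv I (J.prod 𝓘(ℝ, ℝ)) φ.toPartialEquiv.symm p

theorem hasMFDerivWithinAt {x : N} {t : ℝ} (ht : t ∈ Ico (0 : ℝ) 1) :
    HasMFDerivWithinAt (J.prod 𝓘(ℝ, ℝ)) I φ.toPartialEquiv (univ ×ˢ Ico 0 1) (x, t)
      (φ.deriv x t) := by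
  have h := φ.contMDiffOn
  rw [φ.source_eq] at h
  exact ((h (x, t) ⟨trivial, ht⟩).mdifferentiableWithinAt (by simp)).hasMFDerivWithinAt

theorem hasMFDerivAt_symm {p : M} (hp : p ∈ φ.toPartialEquiv.target) :
    HasMFDerivAt I (J.prod 𝓘(ℝ, ℝ)) φ.toPartialEquiv.symm p (φ.symmDeriv p) :=
  (((φ.contMDiffOn_symm p hp).contMDiffAt (φ.isOpen_target.mem_nhds hp)).mdifferentiableAt
    (by simp)).hasMFDerivAt

theorem symmDeriv_deriv {x : N} {t : ℝ} (ht : t ∈ Ico (0 : ℝ) 1) (u : E' × ℝ) :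
    φ.symmDeriv (φ.toPartialEquiv (x, t)) (φ.deriv x t u) = u := by
  have h1 := (φ.hasMFDerivAt_symm (φ.mem_target (x := x) ht)).comp_hasMFDerivWithinAt (x, t)
    (φ.hasMFDerivWithinAt ht)
  have h2 : HasMFDerivWithinAt (J.prod 𝓘(ℝ, ℝ)) (J.prod 𝓘(ℝ, ℝ))
      (φ.toPartialEquiv.symm ∘ φ.toPartialEquiv) (univ ×ˢ Ico 0 1) (x, t)
      (ContinuousLinearMap.id ℝ (E' × ℝ)) :=
    (hasMFDerivWithinAt_id (univ ×ˢ Ico 0 1) (x, t)).congr_of_eventuallyEq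
      (Filter.eventuallyEq_of_mem self_mem_nhdsWithin fun y hy => φ.symm_apply hy.2)
      (φ.symm_apply ht)
  have hu : UniqueMDiffWithinAt (J.prod 𝓘(ℝ, ℝ)) ((univ : Set N) ×ˢ Ico (0 : ℝ) 1) (x, t) :=
    UniqueMDiffWithinAt.prod (uniqueMDiffWithinAt_univ J)
      ((uniqueDiffOn_Ico 0 1) t ht).uniqueMDiffWithinAt
  exact congrArg (fun L : E' × ℝ →L[ℝ] E' × ℝ => L u) (hu.eq h1 h2)

theorem deriv_symmDeriv {x : N} {t : ℝ} (ht : t ∈ Ico (0 : ℝ) 1) (v : E) :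
    (φ.deriv x t (φ.symmDeriv (φ.toPartialEquiv (x, t)) v) : E) = v := by
  have hp := φ.mem_target (x := x) ht
  have h0 : HasMFDerivWithinAt (J.prod 𝓘(ℝ, ℝ)) I φ.toPartialEquiv (univ ×ˢ Ico 0 1)
      (φ.toPartialEquiv.symm (φ.toPartialEquiv (x, t))) (φ.deriv x t) := by
    rw [φ.symm_apply ht]
    exact φ.hasMFDerivWithinAt ht
  have h1 := h0.comp (φ.toPartialEquiv (x, t))
    ((φ.hasMFDerivAt_symm hp).hasMFDerivWithinAt (s := φ.toPartialEquiv.target))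
    (fun q hq => by
      have := φ.toPartialEquiv.map_target hq
      rwa [φ.source_eq] at this)
  have h2 : HasMFDerivWithinAt I I (φ.toPartialEquiv ∘ φ.toPartialEquiv.symm)
      φ.toPartialEquiv.target (φ.toPartialEquiv (x, t)) (ContinuousLinearMap.id ℝ E) :=
    (hasMFDerivWithinAt_id φ.toPartialEquiv.target _).congr_of_eventuallyEq
      (Filter.eventuallyEq_of_mem self_mem_nhdsWithin fun y hy => φ.toPartialEquiv.right_inv hy)
      (φ.toPartialEquiv.right_inv hp)
  have hu : UniqueMDiffWithinAt I φ.toPartialEquiv.target (φ.toPartialEquiv (x, t)) :=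
    φ.isOpen_target.uniqueMDiffWithinAt hp
  exact congrArg (fun L : E →L[ℝ] E => L v) (hu.eq h1 h2)

theorem finrank_eq (φ : Collar I J M N) {x : N} {t : ℝ} (ht : t ∈ Ico (0 : ℝ) 1) :
    Module.finrank ℝ E = Module.finrank ℝ (E' × ℝ) :=
  (LinearEquiv.ofLinearMap
    (ContinuousLinearMap.toLinearMap (φ.symmDeriv (φ.toPartialEquiv (x, t))))
    (ContinuousLinearMap.toLinearMap (M₂ := E) (φ.deriv x t))
    (LinearMap.ext (φ.symmDeriv_deriv (x := x) ht))
    (LinearMap.ext (φ.deriv_symmDeriv (x := x) ht))).finrank_eq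

/-- The part `∂M × [0, c)` of the collar. -/
def region (c : ℝ) : Set M :=
  φ.toPartialEquiv.target ∩ φ.toPartialEquiv.symm ⁻¹' (univ ×ˢ Iio c)

theorem isOpen_region (c : ℝ) : IsOpen (φ.region c) :=
  φ.contMDiffOn_symm.continuousOn.isOpen_inter_preimage φ.isOpen_target (isOpen_univ.prod isOpen_Iio)

theorem mem_region {x : N} {t c : ℝ} (ht : t ∈ Ico (0 : ℝ) 1) :
    φ.toPartialEquiv (x, t) ∈ φ.region c ↔ t < c := by
  simp [region, φ.mem_target ht, φ.symm_apply ht]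

theorem mem_region_iff {p : M} {c : ℝ} :
    p ∈ φ.region c ↔ ∃ x : N, ∃ t ∈ Ico (0 : ℝ) 1, t < c ∧ φ.toPartialEquiv (x, t) = p := by
  constructor
  · intro hp
    obtain ⟨x, t, ht, rfl⟩ := φ.exists_eq hp.1
    exact ⟨x, t, ht, (φ.mem_region ht).1 hp, rfl⟩
  · rintro ⟨x, t, ht, htc, rfl⟩
    exact (φ.mem_region ht).2 htc

/-- The part `∂M × [0, c]` of the collar. -/
def core (c : ℝ) : Set M := φ.toPartialEquiv '' (univ ×ˢ Icc 0 c)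

theorem isClosed_core [T2Space M] [CompactSpace N] {c : ℝ} (hc : c < 1) : IsClosed (φ.core c) := by
  refine ((isCompact_univ.prod isCompact_Icc).image_of_continuousOn
    (φ.contMDiffOn.continuousOn.mono ?_)).isClosed
  rw [φ.source_eq]
  exact prod_mono_right fun t ht => ⟨ht.1, ht.2.trans_lt hc⟩

theorem core_subset_region {c c' : ℝ} (hc : c < 1) (hcc' : c < c') : φ.core c ⊆ φ.region c' := by
  rintro _ ⟨⟨x, t⟩, ⟨-, ht⟩, rfl⟩
  exact (φ.mem_region ⟨ht.1, ht.2.trans_lt hc⟩).2 (ht.2.trans_lt hcc')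

/-- The pullback of a form on `∂M × ℝ` to the collar. -/
def pullForm (B : FormField (J.prod 𝓘(ℝ, ℝ)) (N × ℝ)) : FormField I M := fun p =>
  (ContinuousLinearMap.bilinearComp (E := E' × ℝ) (F := E' × ℝ) (B (φ.toPartialEquiv.symm p))
    (φ.symmDeriv p) (φ.symmDeriv p) : E →L[ℝ] E →L[ℝ] ℝ)

theorem isPullbackAt_pullForm (B : FormField (J.prod 𝓘(ℝ, ℝ)) (N × ℝ)) (p : M) :
    IsPullbackAt φ.toPartialEquiv.symm (φ.pullForm B) B p := fun _ _ => rfl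

theorem pullForm_apply (B : FormField (J.prod 𝓘(ℝ, ℝ)) (N × ℝ)) {x : N} {t : ℝ}
    (ht : t ∈ Ico (0 : ℝ) 1) (v w : E) :
    (φ.pullForm B (φ.toPartialEquiv (x, t)) : E →L[ℝ] E →L[ℝ] ℝ) v w =
      (B (x, t) : E' × ℝ →L[ℝ] E' × ℝ →L[ℝ] ℝ) (φ.symmDeriv (φ.toPartialEquiv (x, t)) v)
        (φ.symmDeriv (φ.toPartialEquiv (x, t)) w) := by
  have key : ∀ q q' : N × ℝ, q = q' → ∀ w w' : E' × ℝ,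
      (B q : E' × ℝ →L[ℝ] E' × ℝ →L[ℝ] ℝ) w w' = (B q' : E' × ℝ →L[ℝ] E' × ℝ →L[ℝ] ℝ) w w' := by
    rintro q _ rfl w w'; rfl
  exact key _ _ (φ.symm_apply ht) _ _

theorem famSmoothAt_pullForm {B : X → FormField (J.prod 𝓘(ℝ, ℝ)) (N × ℝ)}
    (hB : ∀ q, FamSmoothAt B q) {p : M} (hp : p ∈ φ.toPartialEquiv.target) :
    FamSmoothAt (fun x => φ.pullForm (B x)) p :=
  (hB _).pullback φ.isOpen_target hp φ.contMDiffOn_symm fun x q _ => φ.isPullbackAt_pullForm (B x) q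

/-- The form `A` on `M` agrees with the form `B` on `∂M × [c', c)`. -/
def Agree (c' c : ℝ) (A : FormField I M) (B : FormField (J.prod 𝓘(ℝ, ℝ)) (N × ℝ)) : Prop :=
  ∀ (x : N), ∀ t ∈ Ico c' c, ∀ u v : E' × ℝ,
    (A (φ.toPartialEquiv (x, t)) : E →L[ℝ] E →L[ℝ] ℝ) (φ.deriv x t u) (φ.deriv x t v) =
      (B (x, t) : E' × ℝ →L[ℝ] E' × ℝ →L[ℝ] ℝ) u v

open Classical in
/-- The form which is `B` on `∂M × [0, c)` and `A` elsewhere. -/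
def glueForm (c : ℝ) (A : FormField I M) (B : FormField (J.prod 𝓘(ℝ, ℝ)) (N × ℝ)) :
    FormField I M := fun p => if p ∈ φ.region c then φ.pullForm B p else A p

variable {φ} {c c' : ℝ}

theorem glueForm_of_mem {A : FormField I M} {B : FormField (J.prod 𝓘(ℝ, ℝ)) (N × ℝ)} {p : M}
    (hp : p ∈ φ.region c) : φ.glueForm c A B p = φ.pullForm B p := if_pos hp

theorem pullForm_eq {A : FormField I M} {B : FormField (J.prod 𝓘(ℝ, ℝ)) (N × ℝ)} {x : N} {t : ℝ}
    (ht : t ∈ Ico (0 : ℝ) 1) (h : ∀ u v : E' × ℝ,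
      (A (φ.toPartialEquiv (x, t)) : E →L[ℝ] E →L[ℝ] ℝ) (φ.deriv x t u) (φ.deriv x t v) =
        (B (x, t) : E' × ℝ →L[ℝ] E' × ℝ →L[ℝ] ℝ) u v) :
    φ.pullForm B (φ.toPartialEquiv (x, t)) = A (φ.toPartialEquiv (x, t)) := by
  refine ContinuousLinearMap.ext fun v => ContinuousLinearMap.ext fun w => ?_
  refine (φ.pullForm_apply B ht v w).trans ((h _ _).symm.trans ?_)
  exact congrArg₂ (fun a b => (A (φ.toPartialEquiv (x, t)) : E →L[ℝ] E →L[ℝ] ℝ) a b)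
    (φ.deriv_symmDeriv ht v) (φ.deriv_symmDeriv ht w)

theorem glueForm_of_notMem_core {A : FormField I M} {B : FormField (J.prod 𝓘(ℝ, ℝ)) (N × ℝ)}
    (h : φ.Agree c' c A B) {p : M} (hp : p ∉ φ.core c') :
    φ.glueForm c A B p = A p := by
  by_cases hr : p ∈ φ.region c
  · rw [glueForm_of_mem hr]
    obtain ⟨x, t, ht, htc, rfl⟩ := φ.mem_region_iff.1 hr
    have htc' : c' ≤ t := by
      by_contra! hlt
      exact hp ⟨(x, t), ⟨trivial, ht.1, hlt.le⟩, rfl⟩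
    exact pullForm_eq ht (h x t ⟨htc', htc⟩)
  · exact if_neg hr

theorem glueForm_apply {A : FormField I M} {B : FormField (J.prod 𝓘(ℝ, ℝ)) (N × ℝ)} {x : N} {t : ℝ}
    (ht : t ∈ Ico (0 : ℝ) 1) (htc : t < c) (u v : E' × ℝ) :
    (φ.glueForm c A B (φ.toPartialEquiv (x, t)) : E →L[ℝ] E →L[ℝ] ℝ) (φ.deriv x t u)
      (φ.deriv x t v) = (B (x, t) : E' × ℝ →L[ℝ] E' × ℝ →L[ℝ] ℝ) u v := by
  rw [glueForm_of_mem ((φ.mem_region ht).2 htc)]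
  refine (φ.pullForm_apply B ht _ _).trans ?_
  exact congrArg₂ (fun a b => (B (x, t) : E' × ℝ →L[ℝ] E' × ℝ →L[ℝ] ℝ) a b)
      (φ.symmDeriv_deriv ht u) (φ.symmDeriv_deriv ht v)

theorem famSmoothAt_glueForm [T2Space M] [CompactSpace N] (hcc' : c' < c) (hc1 : c ≤ 1)
    {A : X → FormField I M} {B : X → FormField (J.prod 𝓘(ℝ, ℝ)) (N × ℝ)}
    (hA : ∀ p, FamSmoothAt A p) (hB : ∀ q, FamSmoothAt B q) (h : ∀ x, φ.Agree c' c (A x) (B x))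
    (p : M) : FamSmoothAt (fun x => φ.glueForm c (A x) (B x)) p := by
  by_cases hr : p ∈ φ.region c
  · exact (φ.famSmoothAt_pullForm hB hr.1).congr (φ.isOpen_region c) hr
      fun x q hq => glueForm_of_mem hq
  · exact (hA p).congr (φ.isClosed_core (hcc'.trans_le hc1)).isOpen_compl
      (fun hp => hr (φ.core_subset_region (hcc'.trans_le hc1) hcc' hp))
      fun x q hq => glueForm_of_notMem_core (h x) hq

theorem glueForm_symm {h : RiemMetric I M} {W : RiemMetric (J.prod 𝓘(ℝ, ℝ)) (N × ℝ)} (p : M)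
    (v w : E) : (φ.glueForm c h.inner W.inner p : E →L[ℝ] E →L[ℝ] ℝ) v w =
      (φ.glueForm c h.inner W.inner p : E →L[ℝ] E →L[ℝ] ℝ) w v := by
  by_cases hr : p ∈ φ.region c
  · rw [glueForm_of_mem hr]
    exact W.symm (φ.toPartialEquiv.symm p) (φ.symmDeriv p v) (φ.symmDeriv p w)
  · simp only [glueForm, if_neg hr]
    exact h.symm p v w

theorem glueForm_pos {h : RiemMetric I M} {W : RiemMetric (J.prod 𝓘(ℝ, ℝ)) (N × ℝ)} (p : M)
    (v : E) (hv : v ≠ 0) : 0 < (φ.glueForm c h.inner W.inner p : E →L[ℝ] E →L[ℝ] ℝ) v v := by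
  by_cases hr : p ∈ φ.region c
  · rw [glueForm_of_mem hr]
    refine W.pos (φ.toPartialEquiv.symm p) (φ.symmDeriv p v) fun h0 => hv ?_
    obtain ⟨x, t, ht, -, rfl⟩ := φ.mem_region_iff.1 hr
    have h1 := φ.deriv_symmDeriv (x := x) ht v
    have h2 : (φ.symmDeriv (φ.toPartialEquiv (x, t)) v : E' × ℝ) = 0 := h0
    rw [← h1, h2]
    exact map_zero (φ.deriv x t : E' × ℝ →L[ℝ] E)
  · simp only [glueForm, if_neg hr]
    exact h.pos p v hv

theorem scal_eq_of_agree {h : RiemMetric I M} {W : RiemMetric (J.prod 𝓘(ℝ, ℝ)) (N × ℝ)}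
    (hW : φ.Agree 0 c h.inner W.inner) {x : N} {t : ℝ} (ht : t ∈ Ico (0 : ℝ) 1) (htc : t < c) :
    scal h (φ.toPartialEquiv (x, t)) = scal W (x, t) := by
  rw [scal_eq_of_pullback (h₂ := W) (φ.isOpen_region c) ((φ.mem_region ht).2 htc)
    (φ.contMDiffOn_symm.mono inter_subset_left) (φ.finrank_eq (x := x) ht) fun q hq u v => ?_]
  · rw [φ.symm_apply ht]
  · have h1 := φ.isPullbackAt_pullForm W.inner q u v
    obtain ⟨y, s, hs, hsc, rfl⟩ := φ.mem_region_iff.1 hq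
    rwa [pullForm_eq hs (hW y s ⟨hs.1, hsc⟩)] at h1

variable (φ) in
/-- The metric which is `W` on `∂M × [0, c)` and `h` elsewhere. -/
def glueMetric [T2Space M] [CompactSpace N] (hcc' : c' < c) (hc1 : c ≤ 1) (h : RiemMetric I M)
    (W : RiemMetric (J.prod 𝓘(ℝ, ℝ)) (N × ℝ)) (hW : φ.Agree c' c h.inner W.inner) :
    RiemMetric I M :=
  RiemMetric.ofForm (φ.glueForm c h.inner W.inner) glueForm_symm glueForm_pos
    (famSmoothAt_glueForm hcc' hc1 h.famSmoothAt W.famSmoothAt fun _ => hW)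

section

variable [T2Space M] [CompactSpace N] {hcc' : c' < c} {hc1 : c ≤ 1}

theorem continuous_glueMetric {h : X → RiemMetric I M}
    {W : X → RiemMetric (J.prod 𝓘(ℝ, ℝ)) (N × ℝ)} (hh : Continuous h) (hWc : Continuous W)
    {hW : ∀ x, φ.Agree c' c (h x).inner (W x).inner} :
    Continuous fun x => φ.glueMetric hcc' hc1 (h x) (W x) (hW x) :=
  RiemMetric.continuous_of_famSmoothAt (famSmoothAt_glueForm hcc' hc1
    (RiemMetric.famSmoothAt_of_continuous hh) (RiemMetric.famSmoothAt_of_continuous hWc) hW)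

theorem scal_glueMetric {h : RiemMetric I M} {W : RiemMetric (J.prod 𝓘(ℝ, ℝ)) (N × ℝ)}
    {hW : φ.Agree c' c h.inner W.inner} {x : N} {t : ℝ} (ht : t ∈ Ico (0 : ℝ) 1) (htc : t < c) :
    scal (φ.glueMetric hcc' hc1 h W hW) (φ.toPartialEquiv (x, t)) = scal W (x, t) :=
  scal_eq_of_agree (fun _ _ hs u v => glueForm_apply ⟨hs.1, hs.2.trans_le hc1⟩ hs.2 u v) ht htc

theorem scal_glueMetric_of_notMem_core {h : RiemMetric I M}
    {W : RiemMetric (J.prod 𝓘(ℝ, ℝ)) (N × ℝ)} {hW : φ.Agree c' c h.inner W.inner} {p : M}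
    (hp : p ∉ φ.core c') : scal (φ.glueMetric hcc' hc1 h W hW) p = scal h p :=
  scal_congr (φ.isClosed_core (hcc'.trans_le hc1)).isOpen_compl hp
    fun _ hq => glueForm_of_notMem_core hW hq

theorem glueMetric_mem_pscMetrics {h : RiemMetric I M} {W : RiemMetric (J.prod 𝓘(ℝ, ℝ)) (N × ℝ)}
    {hW : φ.Agree c' c h.inner W.inner} (hh : h ∈ pscMetrics I M)
    (hs : ∀ x, ∀ t ∈ Ico 0 c, 0 < scal W (x, t)) :
    φ.glueMetric hcc' hc1 h W hW ∈ pscMetrics I M := fun p => by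
  by_cases hr : p ∈ φ.region c
  · obtain ⟨x, t, ht, htc, rfl⟩ := φ.mem_region_iff.1 hr
    rw [scal_glueMetric ht htc]
    exact hs x t ⟨ht.1, htc⟩
  · rw [scal_glueMetric_of_notMem_core fun hp =>
      hr (φ.core_subset_region (hcc'.trans_le hc1) hcc' hp)]
    exact hh p

end

end Collar

end Collars

section Separation

set_option maxSynthPendingDepth 3
set_option linter.unusedSectionVars false

variable {E : Type*} [NormedAddCommGroup E] [NormedSpace ℝ E] [FiniteDimensional ℝ E]
  {H : Type*} [TopologicalSpace H] {I : ModelWithCorners ℝ E H}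
  {M : Type*} [TopologicalSpace M] [ChartedSpace H M] [IsManifold I ∞ M]

theorem RiemMetric.ext_inner {h h' : RiemMetric I M} (hh : ∀ p, h.inner p = h'.inner p) :
    h = h' := by
  have : h.inner = h'.inner := funext hh
  cases h
  cases h'
  cases this
  rfl

theorem FamC.continuous_apply {X E : Type*} [TopologicalSpace X] [NormedAddCommGroup E]
    [NormedSpace ℝ E] {f : X → E → ℝ} {s : Set E} {k : ℕ} (hf : FamC s k f) {y : E} (hy : y ∈ s) :
    Continuous fun x => f x y :=
  hf.continuousOn.comp_continuous (continuous_id.prodMk continuous_const) fun _ => ⟨trivial, hy⟩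

theorem RiemMetric.continuous_localForm {X : Type*} [TopologicalSpace X] {h : X → RiemMetric I M}
    (hc : Continuous h) (p : M) (u v : E) :
    Continuous fun x => localForm (chartAt H p) (h x).inner ((chartAt H p).extend I p) u v := by
  obtain ⟨U, hU, hpU, hf⟩ := famSmoothAt_of_continuous hc p _
    (IsManifold.chart_mem_maximalAtlas p) (mem_chart_source H p)
  exact (hf 0 u v).continuous_apply (mem_chartSet (mem_chart_source H p) hpU)

theorem RiemMetric.eq_of_localForm {h h' : RiemMetric I M} (hh : ∀ (p : M) (u v : E),
    localForm (chartAt H p) h.inner ((chartAt H p).extend I p) u v =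
      localForm (chartAt H p) h'.inner ((chartAt H p).extend I p) u v) : h = h' := by
  refine RiemMetric.ext_inner fun p => ?_
  have hps := mem_chart_source H p
  have hs : Function.Surjective (chartSymmDeriv I (chartAt H p) ((chartAt H p).extend I p)) :=
    LinearMap.injective_iff_surjective.1 (chartSymmDeriv_injective
      (IsManifold.chart_mem_maximalAtlas p) (mem_chartSet hps trivial))
  have hp : ((chartAt H p).extend I).symm ((chartAt H p).extend I p) = p :=
    ((chartAt H p).extend I).left_inv (by rwa [(chartAt H p).extend_source])
  have key : ∀ q, q = p → (∀ v w : E, (h.inner q : E →L[ℝ] E →L[ℝ] ℝ) v w =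
      (h'.inner q : E →L[ℝ] E →L[ℝ] ℝ) v w) → h.inner p = h'.inner p := by
    rintro q rfl hq
    exact ContinuousLinearMap.ext fun v => ContinuousLinearMap.ext fun w => hq v w
  refine key _ hp fun v w => ?_
  obtain ⟨v, rfl⟩ := hs v
  obtain ⟨w, rfl⟩ := hs w
  exact hh p v w

instance : T2Space (RiemMetric I M) :=
  T2Space.of_injective_continuous (f := fun (h : RiemMetric I M) (q : M × E × E) =>
      localForm (chartAt H q.1) h.inner ((chartAt H q.1).extend I q.1) q.2.1 q.2.2)
    (fun _ _ hh => RiemMetric.eq_of_localForm fun p u v => congrFun hh (p, u, v))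
    (continuous_pi fun q => RiemMetric.continuous_localForm continuous_id q.1 q.2.1 q.2.2)

end Separation

section Restriction

set_option maxSynthPendingDepth 3
set_option linter.unusedSectionVars false

variable {E : Type*} [NormedAddCommGroup E] [NormedSpace ℝ E] [FiniteDimensional ℝ E]
  {H : Type*} [TopologicalSpace H] {I : ModelWithCorners ℝ E H}
  {E' : Type*} [NormedAddCommGroup E'] [NormedSpace ℝ E'] [FiniteDimensional ℝ E']
  {H' : Type*} [TopologicalSpace H'] {J : ModelWithCorners ℝ E' H'}
  {M : Type*} [TopologicalSpace M] [ChartedSpace H M] [IsManifold I ∞ M]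
  {N : Type*} [TopologicalSpace N] [ChartedSpace H' N] [IsManifold J ∞ N]
  {X : Type*} [TopologicalSpace X] {φ : Collar I J M N}

theorem Collar.contMDiff_zero (φ : Collar I J M N) :
    ContMDiff J I ∞ fun x : N => φ.toPartialEquiv (x, 0) :=
  φ.contMDiffOn.comp_contMDiff (contMDiff_id.prodMk contMDiff_const)
    fun _ => φ.mem_source (by simp)

theorem Collar.mfderiv_zero (φ : Collar I J M N) (x : N) (v : E') :
    (mfderiv J I (fun x : N => φ.toPartialEquiv (x, 0)) x v : E) = φ.deriv x 0 (v, 0) := by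
  have h1 : HasMFDerivAt J (J.prod 𝓘(ℝ, ℝ)) (fun x : N => (x, (0 : ℝ))) x
      (ContinuousLinearMap.inl ℝ E' ℝ) := (hasMFDerivAt_id x).prodMk (hasMFDerivAt_const (0 : ℝ) x)
  have h2 := (φ.hasMFDerivWithinAt (x := x) (t := 0) (by simp)).comp x
    (h1.hasMFDerivWithinAt (s := univ)) (show (univ : Set N) ⊆
      (fun y : N => (y, (0 : ℝ))) ⁻¹' (univ ×ˢ Ico 0 1) from fun y _ => ⟨trivial, by simp⟩)
  have h3 := (hasMFDerivWithinAt_univ.1 h2).mfderiv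
  exact congrArg (fun L : E' →L[ℝ] E => L v) h3

theorem IsCylindricalOn.mono {c c' : ℝ} {h : RiemMetric I M} {g : RiemMetric J N}
    (hg : IsCylindricalOn φ c h g) (hc : c' ≤ c) : IsCylindricalOn φ c' h g :=
  fun x t ht => hg x t ⟨ht.1, ht.2.trans hc⟩

theorem pscMetricsCyl_subset {c c' : ℝ} (hc : c' ≤ c) :
    pscMetricsCyl φ c ⊆ pscMetricsCyl φ c' :=
  fun _ hh => ⟨hh.1, hh.2.imp fun _ hg => hg.mono hc⟩

theorem IsCylindricalOn.isPullbackAt {c : ℝ} (hc : 0 ≤ c) {h : RiemMetric I M}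
    {g : RiemMetric J N} (hg : IsCylindricalOn φ c h g) (x : N) :
    IsPullbackAt (fun x : N => φ.toPartialEquiv (x, 0)) g.inner h.inner x := fun v w => by
  have h1 := hg x 0 ⟨le_rfl, hc⟩ v w 0 0
  rw [mul_zero, add_zero] at h1
  refine h1.symm.trans ?_
  exact congrArg₂ (fun a b : E => (h.inner (φ.toPartialEquiv (x, 0)) : E →L[ℝ] E →L[ℝ] ℝ) a b)
    (φ.mfderiv_zero x v).symm (φ.mfderiv_zero x w).symm

theorem IsCylindricalOn.unique {c c' : ℝ} (hc : 0 ≤ c) (hc' : 0 ≤ c') {h : RiemMetric I M}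
    {g g' : RiemMetric J N} (hg : IsCylindricalOn φ c h g) (hg' : IsCylindricalOn φ c' h g') :
    g = g' :=
  RiemMetric.ext_inner fun x => ContinuousLinearMap.ext fun v => ContinuousLinearMap.ext fun w =>
    (hg.isPullbackAt hc x v w).trans (hg'.isPullbackAt hc' x v w).symm

/-- The product metric `g + dt²` on `N × ℝ`. -/
def lineMetric (g : RiemMetric J N) : RiemMetric (J.prod 𝓘(ℝ, ℝ)) (N × ℝ) :=
  cylMetric (fun _ => 0) (fun _ => 1) contDiff_const (fun _ => ⟨le_rfl, zero_le_one⟩)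
    contDiff_const (fun _ => one_pos) g g

theorem lineMetric_apply (g : RiemMetric J N) (q : N × ℝ) (u v : E' × ℝ) :
    ((lineMetric g).inner q : E' × ℝ →L[ℝ] E' × ℝ →L[ℝ] ℝ) u v =
      (g.inner q.1 : E' →L[ℝ] E' →L[ℝ] ℝ) u.1 v.1 + u.2 * v.2 := by
  refine (cylMetric_apply _ _ _ _ g g q u v).trans ?_
  ring

theorem IsCylindricalOn.agree {c : ℝ} {h : RiemMetric I M} {g : RiemMetric J N}
    (hg : IsCylindricalOn φ c h g) : φ.Agree 0 c h.inner (lineMetric g).inner :=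
  fun x t ht u v => (hg x t ⟨ht.1, ht.2.le⟩ u.1 v.1 u.2 v.2).trans
    (lineMetric_apply g (x, t) u v).symm

theorem scal_lineMetric (g : RiemMetric J N) (q : N × ℝ) : scal (lineMetric g) q = scal g q.1 :=
  scal_of_product (f := fun _ => 1) contDiff_const (fun _ => one_pos) isOpen_univ
    (fun q _ u v => by rw [lineMetric_apply, one_mul]) trivial

theorem IsCylindricalOn.mem_pscMetrics {c : ℝ} (hc : 0 < c) {h : RiemMetric I M}
    {g : RiemMetric J N} (hg : IsCylindricalOn φ c h g) (hh : h ∈ pscMetrics I M) :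
    g ∈ pscMetrics J N := fun x => by
  have h1 := Collar.scal_eq_of_agree hg.agree (x := x) (t := 0) (by simp) hc
  rw [scal_lineMetric] at h1
  exact h1 ▸ hh _

theorem continuous_of_isCylindricalOn {h : X → RiemMetric I M} {g : X → RiemMetric J N}
    (hh : Continuous h) (hg : ∀ x, ∃ c, 0 ≤ c ∧ IsCylindricalOn φ c (h x) (g x)) :
    Continuous g := by
  refine RiemMetric.continuous_of_famSmoothAt fun p =>
    (RiemMetric.famSmoothAt_of_continuous hh _).pullback isOpen_univ trivial
      φ.contMDiff_zero.contMDiffOn fun x q _ => ?_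
  obtain ⟨c, hc, hcyl⟩ := hg x
  exact hcyl.isPullbackAt hc q

namespace PSCMetricsCollared

theorem exists_isCylindricalOn (h : PSCMetricsCollared φ) :
    ∃ g : RiemMetric J N, ∃ c ∈ Ioo (0 : ℝ) 1, IsCylindricalOn φ c h.metric g := by
  obtain ⟨c, -, g, hg⟩ := mem_iUnion.1 h.2
  exact ⟨g, c, c.2, hg⟩

theorem metric_mem (h : PSCMetricsCollared φ) : h.metric ∈ pscMetrics I M := by
  obtain ⟨c, hh, -⟩ := mem_iUnion.1 h.2
  exact hh

/-- The restriction of a collared metric to the boundary. -/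
def res (h : PSCMetricsCollared φ) : pscMetrics J N :=
  ⟨h.exists_isCylindricalOn.choose, by
    obtain ⟨c, hc, hg⟩ := h.exists_isCylindricalOn.choose_spec
    exact hg.mem_pscMetrics hc.1 h.metric_mem⟩

theorem res_spec (h : PSCMetricsCollared φ) :
    ∃ c ∈ Ioo (0 : ℝ) 1, IsCylindricalOn φ c h.metric (res h).1 :=
  h.exists_isCylindricalOn.choose_spec

theorem isCylindricalOn_iff (h : PSCMetricsCollared φ) (g : RiemMetric J N) :
    (∃ c ∈ Ioo (0 : ℝ) 1, IsCylindricalOn φ c h.metric g) ↔ g = (res h : RiemMetric J N) := by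
  obtain ⟨c', hc', hr⟩ := h.res_spec
  constructor
  · rintro ⟨c, hc, hg⟩
    exact hg.unique hc.1.le hc'.1.le hr
  · rintro rfl
    exact ⟨c', hc', hr⟩

theorem continuous_incl (c : Ioo (0 : ℝ) 1) : Continuous (incl φ c) :=
  continuous_iSup_rng (i := c) continuous_coinduced_rng

theorem continuous_metric : Continuous (metric : PSCMetricsCollared φ → RiemMetric I M) :=
  continuous_iSup_dom.2 fun _ => continuous_coinduced_dom.2 continuous_subtype_val

theorem continuous_res : Continuous (res : PSCMetricsCollared φ → pscMetrics J N) := by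
  refine Continuous.subtype_mk (continuous_of_isCylindricalOn (φ := φ) continuous_metric fun h => ?_) _
  obtain ⟨c, hc, hr⟩ := h.res_spec
  exact ⟨c, hc.1.le, hr⟩

theorem isClosed_of_finite {S : Set (PSCMetricsCollared φ)}
    (hS : ∀ c : Ioo (0 : ℝ) 1, {h ∈ S | h.metric ∈ pscMetricsCyl φ c}.Finite) : IsClosed S := by
  refine isClosed_iSup_iff.2 fun c => isClosed_coinduced.2 ?_
  have hinj : Function.Injective (incl φ c) := Set.inclusion_injective (Set.subset_iUnion (fun c : Ioo (0 : ℝ) 1 => pscMetricsCyl φ c) c)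
  have h1 : (incl φ c ⁻¹' S).Finite := by
    refine ((hS c).preimage hinj.injOn).subset fun h hh => ⟨hh, h.2⟩
  exact h1.isClosed

/-- A compact family of collared metrics is cylindrical on a common part of the collar. -/
theorem exists_forall_mem_pscMetricsCyl {D : Type*} [TopologicalSpace D] [CompactSpace D]
    {F : D → PSCMetricsCollared φ} (hF : Continuous F) :
    ∃ c ∈ Ioo (0 : ℝ) 1, ∀ z, (F z).metric ∈ pscMetricsCyl φ c := by
  by_contra! hcon
  have hpos : ∀ n : ℕ, (1 : ℝ) / (n + 2) ∈ Ioo (0 : ℝ) 1 := fun n =>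
    ⟨by positivity, by rw [div_lt_one (by positivity)]; linarith [(Nat.cast_nonneg n : (0 : ℝ) ≤ n)]⟩
  choose z hz using fun n : ℕ => hcon _ (hpos n)
  have hlarge : ∀ c : Ioo (0 : ℝ) 1, ∃ m : ℕ, ∀ k, m ≤ k → (F (z k)).metric ∉ pscMetricsCyl φ c := by
    intro c
    obtain ⟨m, hm⟩ := exists_nat_one_div_lt c.2.1
    refine ⟨m, fun k hk hmem => hz k (pscMetricsCyl_subset (hm.le.trans' ?_) hmem)⟩
    have : (m : ℝ) ≤ k := by exact_mod_cast hk
    exact one_div_le_one_div_of_le (by positivity) (by linarith)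
  have hclosed : ∀ n : ℕ, IsClosed ((fun k => F (z k)) '' Ici n) := fun n => by
    refine isClosed_of_finite fun c => ?_
    obtain ⟨m, hm⟩ := hlarge c
    refine ((finite_lt_nat m).image fun k => F (z k)).subset ?_
    rintro _ ⟨⟨k, -, rfl⟩, hk⟩
    exact ⟨k, not_le.1 fun hmk => hm k hmk hk, rfl⟩
  obtain ⟨w, hw⟩ := IsCompact.nonempty_iInter_of_sequence_nonempty_isCompact_isClosed
    (fun n : ℕ => F ⁻¹' ((fun k => F (z k)) '' Ici n))
    (fun n => preimage_mono (image_mono (Ici_subset_Ici.2 n.le_succ)))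
    (fun n => ⟨z n, n, self_mem_Ici, rfl⟩) ((hclosed 0).preimage hF).isCompact
    (fun n => (hclosed n).preimage hF)
  obtain ⟨c, hc⟩ := mem_iUnion.1 (F w).2
  obtain ⟨m, hm⟩ := hlarge c
  obtain ⟨k, hk, hkw⟩ := mem_iInter.1 hw m
  refine hm k hk ?_
  rw [show F (z k) = F w from hkw]
  exact hc

end PSCMetricsCollared

end Restriction

/-- A continuous function on a compact space which is positive on the zeros of a nonnegative
function is positive near these zeros, uniformly. -/
theorem exists_forall_lt_imp_pos {Q : Type*} [TopologicalSpace Q] [CompactSpace Q] {Ψ d : Q → ℝ}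
    (hΨ : Continuous Ψ) (hd : Continuous d) (hd0 : ∀ q, 0 ≤ d q) (h : ∀ q, d q = 0 → 0 < Ψ q) :
    ∃ δ > 0, ∀ q, d q < δ → 0 < Ψ q := by
  rcases {q | Ψ q ≤ 0}.eq_empty_or_nonempty with he | hne
  · refine ⟨1, one_pos, fun q _ => ?_⟩
    by_contra! hq
    exact eq_empty_iff_forall_notMem.1 he q hq
  · obtain ⟨q₀, hq₀, hmin⟩ := (isClosed_le hΨ continuous_const).isCompact.exists_isMinOn hne
      hd.continuousOn
    refine ⟨d q₀, (hd0 q₀).lt_of_ne fun h0 => (h q₀ h0.symm).not_ge hq₀, fun q hq => ?_⟩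
    by_contra! hle
    exact hq.not_ge (hmin hle)

section Profiles

/-- A smooth function which is `1` on `(-∞, 3a]` and `0` on `[4a, ∞)`. -/
def descent (a t : ℝ) : ℝ := Real.smoothTransition ((4 * a - t) / a)

/-- A smooth function which is `1` on `[2a, 5a]` and `0` outside of `[a, 6a]`. -/
def plateau (a t : ℝ) : ℝ :=
  Real.smoothTransition ((t - a) / a) * Real.smoothTransition ((6 * a - t) / a)

/-- The length element `1 + (R² - 1) β`, for `R = 1 + s / δ` and `β` the function `plateau a`. -/
def stretch (a δ s t : ℝ) : ℝ := 1 + ((1 + s / δ) ^ 2 - 1) * plateau a t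

variable {a δ s t : ℝ}

theorem contDiff_descent : ContDiff ℝ ∞ (descent a) :=
  Real.smoothTransition.contDiff.comp ((contDiff_const.sub contDiff_id).div_const a)

theorem descent_mem : descent a t ∈ Icc (0 : ℝ) 1 :=
  ⟨Real.smoothTransition.nonneg _, Real.smoothTransition.le_one _⟩

theorem descent_eq_one (ha : 0 < a) (ht : t ≤ 3 * a) : descent a t = 1 :=
  Real.smoothTransition.one_of_one_le ((one_le_div ha).2 (by linarith))

theorem descent_eq_zero (ha : 0 < a) (ht : 4 * a ≤ t) : descent a t = 0 :=
  Real.smoothTransition.zero_of_nonpos (div_nonpos_of_nonpos_of_nonneg (by linarith) ha.le)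

theorem contDiff_plateau : ContDiff ℝ ∞ (plateau a) :=
  (Real.smoothTransition.contDiff.comp ((contDiff_id.sub contDiff_const).div_const a)).mul
    (Real.smoothTransition.contDiff.comp ((contDiff_const.sub contDiff_id).div_const a))

theorem plateau_nonneg : 0 ≤ plateau a t :=
  mul_nonneg (Real.smoothTransition.nonneg _) (Real.smoothTransition.nonneg _)

theorem plateau_eq_one (ha : 0 < a) (h : 2 * a ≤ t) (h' : t ≤ 5 * a) : plateau a t = 1 := by
  rw [plateau, Real.smoothTransition.one_of_one_le ((one_le_div ha).2 (by linarith)),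
    Real.smoothTransition.one_of_one_le ((one_le_div ha).2 (by linarith)), one_mul]

theorem plateau_eq_zero_of_le (ha : 0 < a) (h : t ≤ a) : plateau a t = 0 := by
  rw [plateau, Real.smoothTransition.zero_of_nonpos
    (div_nonpos_of_nonpos_of_nonneg (by linarith) ha.le), zero_mul]

theorem plateau_eq_zero_of_ge (ha : 0 < a) (h : 6 * a ≤ t) : plateau a t = 0 := by
  rw [plateau, mul_comm, Real.smoothTransition.zero_of_nonpos
    (div_nonpos_of_nonpos_of_nonneg (by linarith) ha.le), zero_mul]

theorem contDiff_stretch : ContDiff ℝ ∞ (stretch a δ s) :=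
  contDiff_const.add (contDiff_const.mul contDiff_plateau)

theorem stretch_pos (hδ : 0 < δ) (hs : 0 ≤ s) : 0 < stretch a δ s t := by
  have h1 : 0 ≤ s / δ := by positivity
  have h2 : 0 ≤ ((1 + s / δ) ^ 2 - 1) * plateau a t := mul_nonneg (by nlinarith) plateau_nonneg
  rw [stretch]
  linarith

theorem stretch_zero : stretch a δ 0 t = 1 := by simp [stretch]

end Profiles

section Rescaling

set_option maxSynthPendingDepth 3
set_option linter.unusedSectionVars false

variable {E : Type*} [NormedAddCommGroup E] [NormedSpace ℝ E] [FiniteDimensional ℝ E]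
  {H : Type*} [TopologicalSpace H] {J : ModelWithCorners ℝ E H}
  {N : Type*} [TopologicalSpace N] [ChartedSpace H N] [IsManifold J ∞ N]

/-- The affine reparametrization of the second factor of `N × ℝ`. -/
def rescale (t₀ ε : ℝ) (q : N × ℝ) : N × ℝ := (q.1, t₀ + ε * q.2)

theorem contMDiff_rescale (t₀ ε : ℝ) :
    ContMDiff (J.prod 𝓘(ℝ, ℝ)) (J.prod 𝓘(ℝ, ℝ)) ∞ (rescale t₀ ε : N × ℝ → N × ℝ) :=
  contMDiff_fst.prodMk ((contDiff_const.add (contDiff_const.mul contDiff_id)).contMDiff.comp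
    contMDiff_snd)

theorem mfderiv_rescale (t₀ ε : ℝ) (q : N × ℝ) (u : E × ℝ) :
    (mfderiv (J.prod 𝓘(ℝ, ℝ)) (J.prod 𝓘(ℝ, ℝ)) (rescale t₀ ε : N × ℝ → N × ℝ) q u : E × ℝ) =
      (u.1, ε * u.2) := by
  have h1 : HasFDerivAt (fun t : ℝ => t₀ + ε * t) (ε • ContinuousLinearMap.id ℝ ℝ) q.2 :=
    ((hasFDerivAt_id q.2).const_mul ε).const_add t₀
  have h2 : HasMFDerivAt 𝓘(ℝ, ℝ) 𝓘(ℝ, ℝ) (fun t : ℝ => t₀ + ε * t) q.2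
    (ε • ContinuousLinearMap.id ℝ ℝ) := h1.hasMFDerivAt
  have h3 := (hasMFDerivAt_fst (I := J) (I' := 𝓘(ℝ, ℝ)) q).prodMk
    (h2.comp q (hasMFDerivAt_snd (I := J) (I' := 𝓘(ℝ, ℝ)) q))
  exact congrArg (fun L : E × ℝ →L[ℝ] E × ℝ => L u) h3.mfderiv

theorem scal_rescale {W W' : RiemMetric (J.prod 𝓘(ℝ, ℝ)) (N × ℝ)} {t₀ ε : ℝ} {T : Set ℝ}
    (hT : IsOpen T) (hW : ∀ x : N, ∀ t, t₀ + ε * t ∈ T → ∀ u v : E × ℝ,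
      (W'.inner (x, t) : E × ℝ →L[ℝ] E × ℝ →L[ℝ] ℝ) u v =
        (W.inner (x, t₀ + ε * t) : E × ℝ →L[ℝ] E × ℝ →L[ℝ] ℝ) (u.1, ε * u.2) (v.1, ε * v.2))
    (x : N) (ht₀ : t₀ ∈ T) : scal W' (x, 0) = scal W (x, t₀) := by
  have hV : IsOpen (rescale t₀ ε ⁻¹' ((univ : Set N) ×ˢ T)) :=
    (isOpen_univ.prod hT).preimage (contMDiff_rescale (J := J) t₀ ε).continuous
  have h0 : rescale t₀ ε (x, (0 : ℝ)) = (x, t₀) := by simp [rescale]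
  rw [scal_eq_of_pullback hV (p := (x, (0 : ℝ))) (by simpa [rescale] using ht₀)
    (contMDiff_rescale t₀ ε).contMDiffOn rfl fun q hq u v => ?_, h0]
  refine (hW q.1 q.2 hq.2 u v).trans ?_
  exact congrArg₂ (fun a b : E × ℝ =>
    (W.inner (rescale t₀ ε q) : E × ℝ →L[ℝ] E × ℝ →L[ℝ] ℝ) a b)
    (mfderiv_rescale (J := J) t₀ ε q u).symm (mfderiv_rescale (J := J) t₀ ε q v).symm

end Rescaling

section Bridges

set_option maxSynthPendingDepth 3
set_option linter.unusedSectionVars false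

variable {E : Type*} [NormedAddCommGroup E] [NormedSpace ℝ E] [FiniteDimensional ℝ E]
  {H : Type*} [TopologicalSpace H] {J : ModelWithCorners ℝ E H}
  {N : Type*} [TopologicalSpace N] [ChartedSpace H N] [IsManifold J ∞ N]
  {X : Type*} [TopologicalSpace X] {a δ s : ℝ} {g₀ g₁ : RiemMetric J N}

/-- The metric on `N × ℝ` which passes from `g₁ + dt²` to `g₀ + dt²`, along a stretched cylinder. -/
def bridge (a : ℝ) {δ s : ℝ} (hδ : 0 < δ) (hs : 0 ≤ s) (g₀ g₁ : RiemMetric J N) :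
    RiemMetric (J.prod 𝓘(ℝ, ℝ)) (N × ℝ) :=
  cylMetric (descent a) (stretch a δ s) contDiff_descent (fun _ => descent_mem) contDiff_stretch
    (fun _ => stretch_pos hδ hs) g₀ g₁

/-- The metric `(1 - p) g₀ + p g₁ + dt²` for the rescaled function `p(t) = descent(t₀ + ε t)`. -/
def slowBridge (a t₀ ε : ℝ) (g₀ g₁ : RiemMetric J N) : RiemMetric (J.prod 𝓘(ℝ, ℝ)) (N × ℝ) :=
  cylMetric (fun t => descent a (t₀ + ε * t)) (fun _ => 1)
    (contDiff_descent.comp (contDiff_const.add (contDiff_const.mul contDiff_id)))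
    (fun _ => descent_mem) contDiff_const (fun _ => one_pos) g₀ g₁

theorem bridge_apply (hδ : 0 < δ) (hs : 0 ≤ s) (q : N × ℝ) (u v : E × ℝ) :
    ((bridge a hδ hs g₀ g₁).inner q : E × ℝ →L[ℝ] E × ℝ →L[ℝ] ℝ) u v =
      (1 - descent a q.2) * (g₀.inner q.1 : E →L[ℝ] E →L[ℝ] ℝ) u.1 v.1 +
        descent a q.2 * (g₁.inner q.1 : E →L[ℝ] E →L[ℝ] ℝ) u.1 v.1 +
          stretch a δ s q.2 * (u.2 * v.2) :=
  cylMetric_apply _ _ _ _ g₀ g₁ q u v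

theorem slowBridge_apply (t₀ ε : ℝ) (q : N × ℝ) (u v : E × ℝ) :
    ((slowBridge a t₀ ε g₀ g₁).inner q : E × ℝ →L[ℝ] E × ℝ →L[ℝ] ℝ) u v =
      (1 - descent a (t₀ + ε * q.2)) * (g₀.inner q.1 : E →L[ℝ] E →L[ℝ] ℝ) u.1 v.1 +
        descent a (t₀ + ε * q.2) * (g₁.inner q.1 : E →L[ℝ] E →L[ℝ] ℝ) u.1 v.1 +
          1 * (u.2 * v.2) :=
  cylMetric_apply _ _ _ _ g₀ g₁ q u v

theorem bridge_apply_of_le (ha : 0 < a) (hδ : 0 < δ) (hs : 0 ≤ s) {q : N × ℝ} (hq : q.2 ≤ 3 * a)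
    (u v : E × ℝ) : ((bridge a hδ hs g₀ g₁).inner q : E × ℝ →L[ℝ] E × ℝ →L[ℝ] ℝ) u v =
      (g₁.inner q.1 : E →L[ℝ] E →L[ℝ] ℝ) u.1 v.1 + stretch a δ s q.2 * (u.2 * v.2) := by
  rw [bridge_apply, descent_eq_one ha hq]
  ring

theorem bridge_apply_of_ge (ha : 0 < a) (hδ : 0 < δ) (hs : 0 ≤ s) {q : N × ℝ} (hq : 4 * a ≤ q.2)
    (u v : E × ℝ) : ((bridge a hδ hs g₀ g₁).inner q : E × ℝ →L[ℝ] E × ℝ →L[ℝ] ℝ) u v =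
      (g₀.inner q.1 : E →L[ℝ] E →L[ℝ] ℝ) u.1 v.1 + stretch a δ s q.2 * (u.2 * v.2) := by
  rw [bridge_apply, descent_eq_zero ha hq]
  ring

theorem continuous_bridge (hδ : 0 < δ) {r : X → ℝ} (hr : Continuous r) (hr0 : ∀ x, 0 ≤ r x)
    {g₀ g₁ : X → RiemMetric J N} (hg₀ : Continuous g₀) (hg₁ : Continuous g₁) :
    Continuous fun x => bridge a hδ (hr0 x) (g₀ x) (g₁ x) := by
  have hu : UniqueDiffOn ℝ (univ : Set ℝ) := uniqueDiffOn_univ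
  refine continuous_cylMetric (p := fun _ => descent a) (f := fun x => stretch a δ (r x))
    (fun _ => contDiff_descent) (fun _ _ => descent_mem) (fun _ => contDiff_stretch)
    (fun x _ => stretch_pos hδ (hr0 x)) (fun k => ?_) (fun k => ?_) hg₀ hg₁
  · exact FamC.of_contDiffOn hu (contDiff_descent.contDiffOn.of_le (by exact_mod_cast le_top))
  · refine FamC.add hu (FamC.param continuous_const) (FamC.mul hu (FamC.param (by fun_prop)) ?_)
    exact FamC.of_contDiffOn hu (contDiff_plateau.contDiffOn.of_le (by exact_mod_cast le_top))

theorem continuous_slowBridge {τ ε : X → ℝ} (hτ : Continuous τ) (hε : Continuous ε)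
    {g₀ g₁ : X → RiemMetric J N} (hg₀ : Continuous g₀) (hg₁ : Continuous g₁) :
    Continuous fun x => slowBridge a (τ x) (ε x) (g₀ x) (g₁ x) := by
  have hu : UniqueDiffOn ℝ (univ : Set ℝ) := uniqueDiffOn_univ
  refine continuous_cylMetric (p := fun x t => descent a (τ x + ε x * t)) (f := fun _ _ => 1)
    _ (fun _ _ => descent_mem) (fun _ => contDiff_const) (fun _ _ => one_pos) (fun k => ?_)
    (fun k => FamC.param continuous_const) hg₀ hg₁
  have h1 : FamC (X := X) univ k fun _ => descent a :=
    FamC.of_contDiffOn hu (contDiff_descent.contDiffOn.of_le (by exact_mod_cast le_top))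
  refine FamC.comp hu (Module.Basis.singleton Unit ℝ) h1 (p := fun x t => τ x + ε x * t)
    (fun i => ?_) (fun _ _ _ => trivial)
  have h2 : FamC univ k fun x t => τ x + ε x * t :=
    FamC.add hu (FamC.param hτ) (FamC.mul hu (FamC.param hε)
      (FamC.of_contDiffOn hu contDiffOn_id))
  simpa using h2

theorem scal_slowBridge_zero (t₀ : ℝ) (q : N × ℝ) : scal (slowBridge a t₀ 0 g₀ g₁) q =
    scal (mixMetric ⟨descent a t₀, descent_mem⟩ g₀ g₁) q.1 := by
  refine scal_of_product (f := fun _ => 1) contDiff_const (fun _ => one_pos) isOpen_univ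
    (fun q _ u v => ?_) trivial
  rw [slowBridge_apply, mixMetric_apply, zero_mul, add_zero]

theorem scal_slowBridge_self (t₀ ε : ℝ) (g : RiemMetric J N) (q : N × ℝ) :
    scal (slowBridge a t₀ ε g g) q = scal g q.1 := by
  refine scal_of_product (f := fun _ => 1) contDiff_const (fun _ => one_pos) isOpen_univ
    (fun q _ u v => ?_) trivial
  rw [slowBridge_apply]
  ring

theorem scal_bridge_of_lt (ha : 0 < a) (hδ : 0 < δ) (hs : 0 ≤ s) {q : N × ℝ} (hq : q.2 < 3 * a) :
    scal (bridge a hδ hs g₀ g₁) q = scal g₁ q.1 :=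
  scal_of_product contDiff_stretch (fun _ => stretch_pos hδ hs) isOpen_Iio
    (fun _ hq => bridge_apply_of_le ha hδ hs (le_of_lt hq)) hq

theorem scal_bridge_of_gt (ha : 0 < a) (hδ : 0 < δ) (hs : 0 ≤ s) {q : N × ℝ} (hq : 4 * a < q.2) :
    scal (bridge a hδ hs g₀ g₁) q = scal g₀ q.1 :=
  scal_of_product contDiff_stretch (fun _ => stretch_pos hδ hs) isOpen_Ioi
    (fun _ hq => bridge_apply_of_ge ha hδ hs (le_of_lt hq)) hq

theorem scal_bridge_of_mem (ha : 0 < a) (hδ : 0 < δ) (hs : 0 ≤ s) (x : N) {t : ℝ}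
    (ht : t ∈ Icc (3 * a) (4 * a)) : scal (bridge a hδ hs g₀ g₁) (x, t) =
      scal (slowBridge a t (δ / (δ + s)) g₀ g₁) (x, 0) := by
  have ht' : t ∈ Ioo (2 * a) (5 * a) := ⟨by linarith [ht.1], by linarith [ht.2]⟩
  refine (scal_rescale (ε := δ / (δ + s)) isOpen_Ioo (fun x τ hτ u v => ?_) x
    ht').symm
  rw [slowBridge_apply, bridge_apply, stretch, plateau_eq_one ha hτ.1.le hτ.2.le]
  have h1 : (1 + s / δ) * (δ / (δ + s)) = 1 := by
    have : δ + s ≠ 0 := by positivity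
    field_simp
  have h2 : (1 + ((1 + s / δ) ^ 2 - 1) * 1) * (δ / (δ + s) * u.2 * (δ / (δ + s) * v.2)) =
      ((1 + s / δ) * (δ / (δ + s))) ^ 2 * (u.2 * v.2) := by ring
  rw [h2, h1, one_pow]

theorem mixMetric_one : mixMetric 1 g₀ g₁ = g₁ :=
  RiemMetric.ext_inner fun x => ContinuousLinearMap.ext fun v => ContinuousLinearMap.ext fun w =>
    (mixMetric_apply 1 g₀ g₁ x v w).trans (by simp)

theorem mixMetric_zero : mixMetric 0 g₀ g₁ = g₀ :=
  RiemMetric.ext_inner fun x => ContinuousLinearMap.ext fun v => ContinuousLinearMap.ext fun w =>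
    (mixMetric_apply 0 g₀ g₁ x v w).trans (by simp)

theorem mixMetric_self (l : unitInterval) (g : RiemMetric J N) : mixMetric l g g = g :=
  RiemMetric.ext_inner fun x => ContinuousLinearMap.ext fun v => ContinuousLinearMap.ext fun w =>
    (mixMetric_apply l g g x v w).trans (by rw [← add_mul, sub_add_cancel, one_mul])

/-- A sufficiently stretched bridge has positive scalar curvature. -/
theorem exists_scal_bridge_pos [CompactSpace X] [CompactSpace N] (ha : 0 < a)
    {r : X → ℝ} (hr : Continuous r) (hr0 : ∀ x, 0 ≤ r x) {g₀ g₁ : X → RiemMetric J N}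
    (hg₀ : Continuous g₀) (hg₁ : Continuous g₁) (hr1 : ∀ x, r x = 0 → g₁ x = g₀ x)
    (hmix : ∀ x l, mixMetric l (g₀ x) (g₁ x) ∈ pscMetrics J N) :
    ∃ δ, ∃ hδ : 0 < δ, ∀ x q, 0 < scal (bridge a hδ (hr0 x) (g₀ x) (g₁ x)) q := by
  have h₀ : ∀ x, g₀ x ∈ pscMetrics J N := fun x => by
    simpa only [mixMetric_zero] using hmix x 0
  have h₁ : ∀ x, g₁ x ∈ pscMetrics J N := fun x => by
    simpa only [mixMetric_one] using hmix x 1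
  have hc : Continuous fun q : X × Icc (3 * a) (4 * a) × unitInterval × N =>
      scal (slowBridge a q.2.1 q.2.2.1 (g₀ q.1) (g₁ q.1)) (q.2.2.2, (0 : ℝ)) := by
    have h1 := continuous_scal (continuous_slowBridge (a := a)
      (X := X × Icc (3 * a) (4 * a) × unitInterval × N)
      (τ := fun q => q.2.1) (ε := fun q => q.2.2.1) (by fun_prop) (by fun_prop)
      (hg₀.comp continuous_fst) (hg₁.comp continuous_fst))
    exact h1.comp (f := fun q : X × Icc (3 * a) (4 * a) × unitInterval × N =>
      (q, (q.2.2.2, (0 : ℝ)))) (by fun_prop)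
  obtain ⟨δ, hδ, hpos⟩ := exists_forall_lt_imp_pos hc
    (d := fun q => r q.1 * q.2.2.1) (by fun_prop)
    (fun q => mul_nonneg (hr0 _) q.2.2.1.2.1) fun ⟨x, t, ε, y⟩ hd => by
      rcases mul_eq_zero.1 hd with h | h
      · rw [hr1 x h, scal_slowBridge_self]
        exact h₀ x y
      · simp only at h ⊢
        rw [h, scal_slowBridge_zero]
        exact hmix x _ y
  refine ⟨δ, hδ, fun x ⟨y, t⟩ => ?_⟩
  rcases lt_or_ge t (3 * a) with ht | ht
  · rw [scal_bridge_of_lt ha hδ (hr0 x) ht]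
    exact h₁ x y
  rcases lt_or_ge (4 * a) t with ht' | ht'
  · rw [scal_bridge_of_gt ha hδ (hr0 x) ht']
    exact h₀ x y
  rw [scal_bridge_of_mem ha hδ (hr0 x) y ⟨ht, ht'⟩]
  have hp : 0 < δ + r x := add_pos_of_pos_of_nonneg hδ (hr0 x)
  refine hpos ⟨x, ⟨t, ht, ht'⟩, ⟨δ / (δ + r x), by positivity, ?_⟩, y⟩ ?_
  · exact (div_le_one hp).2 (le_add_of_nonneg_right (hr0 x))
  · change r x * (δ / (δ + r x)) < δ
    rw [mul_div_assoc', div_lt_iff₀ hp]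
    nlinarith [hr0 x]

end Bridges

section Lifting

set_option maxSynthPendingDepth 3
set_option linter.unusedSectionVars false

variable {E : Type*} [NormedAddCommGroup E] [NormedSpace ℝ E] [FiniteDimensional ℝ E]
  {H : Type*} [TopologicalSpace H] {I : ModelWithCorners ℝ E H}
  {E' : Type*} [NormedAddCommGroup E'] [NormedSpace ℝ E'] [FiniteDimensional ℝ E']
  {H' : Type*} [TopologicalSpace H'] {J : ModelWithCorners ℝ E' H'}
  {M : Type*} [TopologicalSpace M] [ChartedSpace H M] [IsManifold I ∞ M]
  {N : Type*} [TopologicalSpace N] [ChartedSpace H' N] [IsManifold J ∞ N]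
  {X : Type*} [TopologicalSpace X] {φ : Collar I J M N}

theorem Collar.glueMetric_eq_self [T2Space M] [CompactSpace N] {c c' : ℝ} {hcc' : c' < c}
    {hc1 : c ≤ 1} {h : RiemMetric I M} {W : RiemMetric (J.prod 𝓘(ℝ, ℝ)) (N × ℝ)}
    {hW : φ.Agree c' c h.inner W.inner} (hW' : φ.Agree 0 c h.inner W.inner) :
    φ.glueMetric hcc' hc1 h W hW = h := by
  refine RiemMetric.ext_inner fun p => ?_
  by_cases hp : p ∈ φ.region c
  · refine (Collar.glueForm_of_mem hp).trans ?_
    obtain ⟨x, t, ht, htc, rfl⟩ := φ.mem_region_iff.1 hp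
    exact Collar.pullForm_eq ht (hW' x t ⟨ht.1, htc⟩)
  · exact if_neg hp

/-- Cylindrical metrics can be changed near the boundary, in order to change the metric on the
boundary, if the old and the new one are joined by a segment of psc metrics. -/
theorem exists_pscMetrics_isCylindricalOn [T2Space M] [CompactSpace N] [CompactSpace X]
    {F : X → RiemMetric I M} (hF : Continuous F) (hFp : ∀ x, F x ∈ pscMetrics I M)
    {r : X → ℝ} (hr : Continuous r) (hr0 : ∀ x, 0 ≤ r x) {g₀ g₁ : X → RiemMetric J N}
    (hg₀ : Continuous g₀) (hg₁ : Continuous g₁) (hr1 : ∀ x, r x = 0 → g₁ x = g₀ x)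
    (hmix : ∀ x l, mixMetric l (g₀ x) (g₁ x) ∈ pscMetrics J N) {c : ℝ} (hc : c ∈ Ioo (0 : ℝ) 1)
    (hcyl : ∀ x, IsCylindricalOn φ c (F x) (g₀ x)) :
    ∃ c' ∈ Ioo (0 : ℝ) 1, ∃ K : X → RiemMetric I M, Continuous K ∧ (∀ x, K x ∈ pscMetrics I M) ∧
      (∀ x, IsCylindricalOn φ c' (K x) (g₁ x)) ∧ ∀ x, r x = 0 → K x = F x := by
  obtain ⟨a, ha, rfl⟩ : ∃ a, 0 < a ∧ c = 7 * a := ⟨c / 7, div_pos hc.1 (by norm_num), by ring⟩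
  obtain ⟨δ, hδ, hpos⟩ := exists_scal_bridge_pos ha hr hr0 hg₀ hg₁ hr1 hmix
  have hlt : 6 * a < 7 * a := by linarith
  have hagree : ∀ x, φ.Agree (6 * a) (7 * a) (F x).inner
      (bridge a hδ (hr0 x) (g₀ x) (g₁ x)).inner := fun x y t ht u v => by
    have h4 : 4 * a ≤ t := by linarith [ht.1]
    rw [bridge_apply_of_ge (q := (y, t)) ha hδ (hr0 x) h4, stretch,
      plateau_eq_zero_of_ge ha ht.1, mul_zero, add_zero, one_mul]
    exact hcyl x y t ⟨by linarith [ht.1], ht.2.le⟩ u.1 v.1 u.2 v.2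
  refine ⟨a, ⟨ha, by linarith [hc.2]⟩, fun x => φ.glueMetric hlt hc.2.le (F x)
    (bridge a hδ (hr0 x) (g₀ x) (g₁ x)) (hagree x),
    Collar.continuous_glueMetric hF (continuous_bridge hδ hr hr0 hg₀ hg₁),
    fun x => Collar.glueMetric_mem_pscMetrics (hFp x) fun y t _ => hpos x (y, t),
    fun x y t ht (v w : E') b b' => ?_, fun x hx => Collar.glueMetric_eq_self fun y t ht u v => ?_⟩
  · have h1 : t ∈ Ico (0 : ℝ) 1 := ⟨ht.1, by linarith [ht.2, hc.2]⟩
    have h3 : t ≤ 3 * a := by linarith [ht.2]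
    refine (Collar.glueForm_apply (c := 7 * a) h1 (by linarith [ht.2]) (v, b) (w, b')).trans ?_
    rw [bridge_apply_of_le (q := (y, t)) ha hδ (hr0 x) h3, stretch,
      plateau_eq_zero_of_le ha ht.2, mul_zero, add_zero, one_mul]
  · have h1 : (bridge a hδ (hr0 x) (g₀ x) (g₁ x)).inner (y, t) u v =
        (g₀ x).inner y u.1 v.1 + u.2 * v.2 := by
      refine (bridge_apply (a := a) hδ (hr0 x) (y, t) u v).trans ?_
      rw [hr1 x hx, hx, stretch_zero]
      ring
    exact (hcyl x y t ⟨ht.1, ht.2.le⟩ u.1 v.1 u.2 v.2).trans h1.symm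

/-- The homotopy lifting property, at the level of Riemannian metrics. -/
theorem exists_lift [T2Space M] [CompactSpace N] [CompactSpace X] {F : X → RiemMetric I M}
    (hF : Continuous F) (hFp : ∀ x, F x ∈ pscMetrics I M) {G : X × unitInterval → RiemMetric J N}
    (hG : Continuous G) (hGp : ∀ q, G q ∈ pscMetrics J N) {c : ℝ} (hc : c ∈ Ioo (0 : ℝ) 1)
    (hcyl : ∀ x, IsCylindricalOn φ c (F x) (G (x, 0))) :
    ∃ c' ∈ Ioo (0 : ℝ) 1, ∃ K : X × unitInterval → RiemMetric I M, Continuous K ∧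
      (∀ q, K q ∈ pscMetrics I M) ∧ (∀ q, IsCylindricalOn φ c' (K q) (G q)) ∧
        ∀ x, K (x, 0) = F x := by
  have hcont : Continuous fun q : X × unitInterval × unitInterval × unitInterval × N =>
      scal (mixMetric q.2.2.2.1 (G (q.1, q.2.1)) (G (q.1, q.2.2.1))) q.2.2.2.2 := by
    have h1 := continuous_scal (continuous_mixMetric (J := J) (N := N)
      (X := X × unitInterval × unitInterval × unitInterval × N) (l := fun q => q.2.2.2.1)
      (by fun_prop) (hG.comp (f := fun q => (q.1, q.2.1)) (by fun_prop))
      (hG.comp (f := fun q => (q.1, q.2.2.1)) (by fun_prop)))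
    exact h1.comp (f := fun q : X × unitInterval × unitInterval × unitInterval × N =>
      (q, q.2.2.2.2)) (by fun_prop)
  obtain ⟨δ, hδ, hpos⟩ := exists_forall_lt_imp_pos hcont
    (d := fun q => |(q.2.1 : ℝ) - q.2.2.1|) (by fun_prop) (fun _ => abs_nonneg _)
    fun ⟨x, s, s', l, y⟩ hd => by
      have hs : s = s' := Subtype.ext (sub_eq_zero.1 (abs_eq_zero.1 hd))
      simp only [hs, mixMetric_self]
      exact hGp _ y
  obtain ⟨m, hm⟩ := exists_nat_one_div_lt hδ
  set μ : ℝ := 1 / (m + 1)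
  have hμ : 0 < μ := by positivity
  let pr : ℝ → unitInterval := projIcc 0 1 zero_le_one
  have hpr : Continuous pr := continuous_projIcc
  have hG' : ∀ k : ℕ, Continuous fun q : X × unitInterval =>
      G (q.1, pr (min (q.2 : ℝ) (k * μ))) := fun k => hG.comp (by fun_prop)
  have key : ∀ k : ℕ, ∃ c' ∈ Ioo (0 : ℝ) 1, ∃ K : X × unitInterval → RiemMetric I M,
      Continuous K ∧ (∀ q, K q ∈ pscMetrics I M) ∧
        (∀ q, IsCylindricalOn φ c' (K q) (G (q.1, pr (min (q.2 : ℝ) (k * μ))))) ∧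
          ∀ x, K (x, 0) = F x := by
    intro k
    induction k with
    | zero =>
      refine ⟨c, hc, fun q => F q.1, hF.comp continuous_fst, fun q => hFp _, fun q => ?_,
        fun _ => rfl⟩
      have h0 : pr (min (q.2 : ℝ) ((0 : ℕ) * μ)) = 0 :=
        projIcc_of_le_left _ (by simp)
      rw [h0]
      exact hcyl q.1
    | succ k ih =>
      obtain ⟨c₁, hc₁, K₁, hK₁, hK₁p, hK₁c, hK₁0⟩ := ih
      have hk : ((k + 1 : ℕ) : ℝ) * μ = k * μ + μ := by push_cast; ring
      obtain ⟨c', hc', K, hK, hKp, hKc, hK0⟩ := exists_pscMetrics_isCylindricalOn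
        (r := fun q : X × unitInterval => max 0 ((q.2 : ℝ) - k * μ)) hK₁ hK₁p (by fun_prop)
        (fun q => le_max_left _ _) (hG' k) (hG' (k + 1)) (fun q hq => by
          have h1 : (q.2 : ℝ) ≤ k * μ := by simpa using max_eq_left_iff.1 hq
          rw [min_eq_left h1, hk, min_eq_left (by linarith)]) (fun q l y => by
          refine hpos (q.1, pr _, pr _, l, y) (lt_of_le_of_lt ?_ hm)
          have h1 := abs_projIcc_sub_projIcc (h := zero_le_one (α := ℝ))
            (c := min (q.2 : ℝ) (k * μ)) (d := min (q.2 : ℝ) ((k + 1 : ℕ) * μ))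
          refine h1.trans ((abs_min_sub_min_le_max _ _ _ _).trans ?_)
          rw [hk, sub_self, abs_zero, sub_add_cancel_left, abs_neg, abs_of_pos hμ]
          exact max_le hμ.le le_rfl) hc₁ hK₁c
      refine ⟨c', hc', K, hK, hKp, hKc, fun x => ?_⟩
      rw [← hK₁0 x]
      refine hK0 _ (max_eq_left ?_)
      have : 0 ≤ k * μ := by positivity
      simpa using this
  obtain ⟨c', hc', K, hK, hKp, hKc, hK0⟩ := key (m + 1)
  refine ⟨c', hc', K, hK, hKp, fun q => ?_, hK0⟩
  have h1 : ((m + 1 : ℕ) : ℝ) * μ = 1 := by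
    simp only [μ]
    push_cast
    field_simp
  have h2 := hKc q
  rw [h1, min_eq_left q.2.2.2] at h2
  rwa [show pr (q.2 : ℝ) = q.2 from projIcc_val _ q.2] at h2

/-- The restriction to the boundary is a Serre fibration. -/
theorem PSCMetricsCollared.isSerreFibration_res [T2Space M] [CompactSpace N] :
    IsSerreFibration (res : PSCMetricsCollared φ → pscMetrics J N) := by
  refine ⟨continuous_res, fun n F G hFG => ?_⟩
  obtain ⟨c, hc, hFc⟩ := exists_forall_mem_pscMetricsCyl F.continuous
  have hcyl : ∀ z, IsCylindricalOn φ c (F z).metric (G (z, 0)).1 := fun z => by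
    obtain ⟨-, g, hg⟩ := hFc z
    rw [← hFG z, ← ((F z).isCylindricalOn_iff g).1 ⟨c, hc, hg⟩]
    exact hg
  obtain ⟨c', hc', K, hK, hKp, hKc, hK0⟩ := exists_lift
    (continuous_metric.comp F.continuous) (fun z => (F z).metric_mem)
    (G := fun q => (G q).1) (continuous_subtype_val.comp G.continuous) (fun q => (G q).2) hc hcyl
  let K' : _ → pscMetricsCyl φ c' := fun q => ⟨K q, hKp q, _, hKc q⟩
  refine ⟨⟨fun q => incl φ ⟨c', hc'⟩ (K' q), (continuous_incl _).comp (hK.subtype_mk _)⟩,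
    fun z => Subtype.ext (hK0 z), fun q => Subtype.ext ?_⟩
  exact ((isCylindricalOn_iff _ _).1 ⟨c', hc', hKc q⟩).symm

end Lifting

end PSC

end

theorem mainTheorem2
    {E : Type*} [NormedAddCommGroup E] [NormedSpace ℝ E] [FiniteDimensional ℝ E]
    {H : Type*} [TopologicalSpace H] (I : ModelWithCorners ℝ E H)
    {E' : Type*} [NormedAddCommGroup E'] [NormedSpace ℝ E'] [FiniteDimensional ℝ E']
    {H' : Type*} [TopologicalSpace H'] (J : ModelWithCorners ℝ E' H')
    (M : Type*) [TopologicalSpace M] [ChartedSpace H M] [IsManifold I ∞ M]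
    [T2Space M] [CompactSpace M]
    (N : Type*) [TopologicalSpace N] [ChartedSpace H' N] [IsManifold J ∞ N]
    [T2Space N] [CompactSpace N] [BoundarylessManifold J N]
    (φ : PSC.Collar I J M N) :
    ∃ res : PSC.PSCMetricsCollared φ → PSC.pscMetrics J N,
      (∀ (h : PSC.PSCMetricsCollared φ) (g : PSC.RiemMetric J N),
        (∃ c ∈ Ioo (0 : ℝ) 1, PSC.IsCylindricalOn φ c h.metric g) ↔ g = (res h : PSC.RiemMetric J N)) ∧
      PSC.IsSerreFibration res :=
  ⟨PSC.PSCMetricsCollared.res, PSC.PSCMetricsCollared.isCylindricalOn_iff,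
    PSC.PSCMetricsCollared.isSerreFibration_res⟩
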